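/- Let $k$ be a field, let $t$ be a positive integer, and let $K=k^t$. Let $A$ be an augmented dg $K$-ring, that is, a monoid in dg $K$-bimodules on which $k$ acts centrally (with differential of degree $-1$), together with a dg $K$-ring morphism $\varepsilon\colon A\to K$ which splits the unit $K\to A$. Write $\overline A=\operatorname{Ker}\varepsilon$. Assume that $A$ is finite dimensional over $k$ and complete, i.e. $\bigcap_{i\ge 1}\overline A^{\,i}=0$. Let $A^\vee$ be the $k$-dual dg $K$-coring of $A$, with coaugmentation coideal $\overline{A^\vee}=\overline A^\vee$, and let $\Omega A^\vee$ be its cobar construction (the Koszul dual of $A$): the tensor ring $T_K(s^{-1}\overline{A^\vee})$ with the differential determined by the graded Leibniz rule, by $d=0$ on $K$ and by $$d\langle c\rangle=-\langle d c\rangle-\sum(-1)^{|c_1|}\langle c_1\rangle\langle c_2\rangle ,\qquad \overline\Delta(c)=\sum c_1\otimes c_2 .$$ Then the dg $k$-algebra $\Omega=\Omega A^\vee$ is homologically smooth: the dg $\Omega$-bimodule $\Omega$ lies in $\operatorname{per}\Omega^e$, the smallest full triangulated subcategory of the derived category of dg $\Omega$-bimodules (equivalently, of dg modules over $\Omega^e=\Omega^{\mathrm{op}}\otimes_k\Omega$)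 which contains $\Omega^e$ and is closed under direct summands. -/

import Mathlib

open scoped TensorProduct
open CategoryTheory

universe u v w

namespace DG

/-! ## Gradings -/

section Graded

variable {k : Type u} [Field k] {M : Type v} [AddCommGroup M] [Module k M]
  {N : Type w} [AddCommGroup N] [Module k N] {gr : ℤ → Submodule k M}

/-- The linear map on a graded vector space which is `f i` on the component of degree `i`. -/
noncomputable def gradedLift (h : DirectSum.IsInternal gr) (f : ℤ → M →ₗ[k] N) : M →ₗ[k] N :=
  (DirectSum.toModule k ℤ N fun i => f i ∘ₗ (gr i).subtype) ∘ₗ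
    (LinearEquiv.ofBijective (DirectSum.coeLinearMap gr) h).symm.toLinearMap

theorem gradedLift_apply (h : DirectSum.IsInternal gr) (f : ℤ → M →ₗ[k] N) {i : ℤ} {m : M}
    (hm : m ∈ gr i) : gradedLift h f m = f i m := by
  have : (LinearEquiv.ofBijective (DirectSum.coeLinearMap gr) h).symm m
      = DirectSum.lof k ℤ (fun i => gr i) i ⟨m, hm⟩ := by
    refine (LinearEquiv.symm_apply_eq _).2 ?_
    exact (DirectSum.coeLinearMap_lof gr i ⟨m, hm⟩).symm
  refine (congrArg (DirectSum.toModule k ℤ N fun i => f i ∘ₗ (gr i).subtype) this).trans ?_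
  exact DirectSum.toModule_lof k i _

theorem graded_le (h : DirectSum.IsInternal gr) {S : Submodule k M} (hS : ∀ i, gr i ≤ S) (m : M) :
    m ∈ S := by
  have := h.submodule_iSup_eq_top
  exact (this ▸ iSup_le hS : ⊤ ≤ S) trivial

theorem graded_ext (h : DirectSum.IsInternal gr) {f g : M →ₗ[k] N}
    (H : ∀ i, ∀ m ∈ gr i, f m = g m) (m : M) : f m = g m :=
  graded_le h (S := LinearMap.eqLocus f g) (fun i m hm => H i m hm) m

/-- The projection of a graded vector space onto its component of degree `i`. -/
noncomputable def proj (h : DirectSum.IsInternal gr) (i : ℤ) : M →ₗ[k] M :=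
  gradedLift h fun j => if j = i then LinearMap.id else 0

theorem proj_self (h : DirectSum.IsInternal gr) {i : ℤ} {m : M} (hm : m ∈ gr i) :
    proj h i m = m := by
  simp [proj, gradedLift_apply h _ hm]

theorem proj_ne (h : DirectSum.IsInternal gr) {i j : ℤ} (hij : i ≠ j) {m : M} (hm : m ∈ gr i) :
    proj h j m = 0 := by
  simp [proj, gradedLift_apply h _ hm, hij]

theorem isInternal_of_proj (π : ℤ → M →ₗ[k] M) (h1 : ∀ i, ∀ m ∈ gr i, π i m = m)
    (h2 : ∀ i j, i ≠ j → ∀ m ∈ gr i, π j m = 0) (h3 : ∀ S : Submodule k M, (∀ i, gr i ≤ S) → ∀ m, m ∈ S) :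
    DirectSum.IsInternal gr := by
  rw [DirectSum.isInternal_submodule_iff_iSupIndep_and_iSup_eq_top]
  refine ⟨?_, eq_top_iff.2 fun m _ => h3 _ (fun i => le_iSup gr i) m⟩
  intro i
  rw [Submodule.disjoint_def]
  intro x hx hx'
  have : (⨆ j, ⨆ (_ : j ≠ i), gr j) ≤ LinearMap.ker (π i) :=
    iSup_le fun j => iSup_le fun hj y hy => h2 j i hj y hy
  rw [← h1 i x hx]
  exact this hx'

/-- A family of subspaces of the components which still spans everything is the grading. -/
theorem le_of_iSup_eq_top (h : DirectSum.IsInternal gr) {gr' : ℤ → Submodule k M}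
    (hle : ∀ i, gr' i ≤ gr i) (ht : ⨆ i, gr' i = ⊤) (n : ℤ) : gr n ≤ gr' n := by
  intro x hx
  have key : (⨆ i, gr' i) ≤ (gr' n).comap (proj h n) := by
    refine iSup_le fun i y hy => ?_
    rw [Submodule.mem_comap]
    by_cases hin : i = n
    · subst hin
      rwa [proj_self h (hle i hy)]
    · rw [proj_ne h hin (hle i hy)]
      exact zero_mem _
  have := key (ht ▸ Submodule.mem_top : x ∈ _)
  rwa [Submodule.mem_comap, proj_self h hx] at this

/-- The map `x ↦ (-1) ^ |x| x`. -/
noncomputable def parity (h : DirectSum.IsInternal gr) : M →ₗ[k] M :=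
  gradedLift h fun i => i.negOnePow • LinearMap.id

theorem parity_apply (h : DirectSum.IsInternal gr) {i : ℤ} {m : M} (hm : m ∈ gr i) :
    parity h m = i.negOnePow • m := by
  simp [parity, gradedLift_apply h _ hm]

theorem smul_mem_gr {i : ℤ} {m : M} (hm : m ∈ gr i) (e : ℤˣ) : e • m ∈ gr i := by
  rcases Int.units_eq_one_or e with rfl | rfl
  · simpa using hm
  · simpa using hm

theorem parity_mem (h : DirectSum.IsInternal gr) {i : ℤ} {m : M} (hm : m ∈ gr i) :
    parity h m ∈ gr i := by
  rw [parity_apply h hm]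
  exact smul_mem_gr hm _

theorem negOnePow_smul_smul (i : ℤ) (m : M) : i.negOnePow • i.negOnePow • m = m := by
  rw [smul_smul, Int.units_mul_self, one_smul]

theorem map_units_smul (f : M →ₗ[k] N) (e : ℤˣ) (m : M) : f (e • m) = e • f m := by
  rcases Int.units_eq_one_or e with rfl | rfl <;> simp

theorem map₂_units_smul {P : Type*} [AddCommGroup P] [Module k P] (f : M →ₗ[k] N →ₗ[k] P) (e : ℤˣ)
    (m : M) (n : N) : f (e • m) n = e • f m n := by
  rcases Int.units_eq_one_or e with rfl | rfl <;> simp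

theorem parity_parity (h : DirectSum.IsInternal gr) (m : M) : parity h (parity h m) = m := by
  refine graded_ext h (f := parity h ∘ₗ parity h) (g := LinearMap.id) (fun i m hm => ?_) m
  simp only [LinearMap.comp_apply, LinearMap.id_apply]
  rw [parity_apply h hm, map_units_smul, parity_apply h hm, negOnePow_smul_smul]

theorem parity_anticomm (h : DirectSum.IsInternal gr) (d : M →ₗ[k] M)
    (hd : ∀ i, ∀ m ∈ gr i, d m ∈ gr (i - 1)) (m : M) : d (parity h m) = -parity h (d m) := by
  refine graded_ext h (f := d ∘ₗ parity h) (g := -(parity h ∘ₗ d)) (fun i m hm => ?_) m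
  simp only [LinearMap.comp_apply, LinearMap.neg_apply]
  rw [parity_apply h hm, map_units_smul, parity_apply h (hd i m hm), Int.negOnePow_sub,
    Int.negOnePow_one]
  simp

end Graded

/-! ## Differential graded algebras -/

/-- A dg `k`-algebra structure on the `k`-algebra `A`, with differential of degree `-1`. -/
structure DGAlgStr (k : Type u) (A : Type v) [Field k] [Ring A] [Algebra k A] where
  gr : ℤ → Submodule k A
  isInternal : DirectSum.IsInternal gr
  one_mem : (1 : A) ∈ gr 0
  mul_mem : ∀ i j : ℤ, ∀ a ∈ gr i, ∀ b ∈ gr j, a * b ∈ gr (i + j)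
  d : A →ₗ[k] A
  d_mem : ∀ i : ℤ, ∀ a ∈ gr i, d a ∈ gr (i - 1)
  d_d : ∀ a, d (d a) = 0
  leibniz : ∀ i : ℤ, ∀ a ∈ gr i, ∀ b, d (a * b) = d a * b + i.negOnePow • (a * d b)

section GrAlg

variable {k : Type u} {A : Type v} [Field k] [Ring A] [Algebra k A] {gr : ℤ → Submodule k A}

theorem units_smul_mul (e : ℤˣ) (a b : A) : (e • a) * b = e • (a * b) := by
  rcases Int.units_eq_one_or e with rfl | rfl <;> simp

theorem mul_units_smul (e : ℤˣ) (a b : A) : a * (e • b) = e • (a * b) := by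
  rcases Int.units_eq_one_or e with rfl | rfl <;> simp

theorem parity_mul (h : DirectSum.IsInternal gr)
    (hm : ∀ i j : ℤ, ∀ a ∈ gr i, ∀ b ∈ gr j, a * b ∈ gr (i + j)) (a b : A) :
    parity h (a * b) = parity h a * parity h b := by
  refine graded_ext h (f := parity h ∘ₗ (LinearMap.mul k A).flip b)
    (g := (LinearMap.mul k A).flip (parity h b) ∘ₗ parity h) (fun i a ha => ?_) a
  refine graded_ext h (f := parity h ∘ₗ LinearMap.mul k A a)
    (g := LinearMap.mul k A (parity h a) ∘ₗ parity h) (fun j b hb => ?_) b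
  simp only [LinearMap.comp_apply, LinearMap.mul_apply']
  rw [parity_apply h ha, parity_apply h hb, parity_apply h (hm i j a ha b hb), units_smul_mul,
    mul_units_smul, smul_smul, Int.negOnePow_add]

theorem parity_one (h : DirectSum.IsInternal gr) (h1 : (1 : A) ∈ gr 0) : parity h 1 = 1 := by
  rw [parity_apply h h1]; simp

end GrAlg

theorem DGAlgStr.d_mul {k : Type u} {A : Type v} [Field k] [Ring A] [Algebra k A]
    (𝔸 : DGAlgStr k A) (a b : A) :
    𝔸.d (a * b) = 𝔸.d a * b + parity 𝔸.isInternal a * 𝔸.d b := by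
  refine graded_ext 𝔸.isInternal (f := 𝔸.d ∘ₗ (LinearMap.mul k A).flip b)
    (g := (LinearMap.mul k A).flip b ∘ₗ 𝔸.d +
      (LinearMap.mul k A).flip (𝔸.d b) ∘ₗ parity 𝔸.isInternal) (fun i a ha => ?_) a
  simp only [LinearMap.comp_apply, LinearMap.add_apply, LinearMap.flip_apply,
    LinearMap.mul_apply']
  rw [𝔸.leibniz i a ha b, parity_apply _ ha, units_smul_mul]

theorem DGAlgStr.d_one {k : Type u} {A : Type v} [Field k] [Ring A] [Algebra k A]
    (𝔸 : DGAlgStr k A) : 𝔸.d 1 = 0 := by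
  have := 𝔸.d_mul 1 1
  rw [parity_one _ 𝔸.one_mem] at this
  simpa using this

/-! ## Differential graded bimodules -/

/-- Dg bimodules over a dg `k`-algebra `𝔸`, on which `k` acts centrally. These are the same thing
as dg modules over the enveloping dg algebra of `𝔸`. The left and right multiplication by `a` are
`l a` and `r a`. -/
structure DGBimod {k : Type u} {A : Type v} [Field k] [Ring A] [Algebra k A]
    (𝔸 : DGAlgStr k A) where
  carrier : Type v
  [addCommGroup : AddCommGroup carrier]
  [module : Module k carrier]
  l : A →ₗ[k] carrier →ₗ[k] carrier
  r : A →ₗ[k] carrier →ₗ[k] carrier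
  l_one : ∀ m, l 1 m = m
  l_mul : ∀ a b m, l (a * b) m = l a (l b m)
  r_one : ∀ m, r 1 m = m
  r_mul : ∀ a b m, r (a * b) m = r b (r a m)
  l_r : ∀ a b m, l a (r b m) = r b (l a m)
  gr : ℤ → Submodule k carrier
  isInternal : DirectSum.IsInternal gr
  l_mem : ∀ i j : ℤ, ∀ a ∈ 𝔸.gr i, ∀ m ∈ gr j, l a m ∈ gr (i + j)
  r_mem : ∀ i j : ℤ, ∀ m ∈ gr i, ∀ b ∈ 𝔸.gr j, r b m ∈ gr (i + j)
  d : carrier →ₗ[k] carrier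
  d_mem : ∀ i : ℤ, ∀ m ∈ gr i, d m ∈ gr (i - 1)
  d_d : ∀ m, d (d m) = 0
  d_l : ∀ i : ℤ, ∀ a ∈ 𝔸.gr i, ∀ m, d (l a m) = l (𝔸.d a) m + i.negOnePow • l a (d m)
  d_r : ∀ i : ℤ, ∀ m ∈ gr i, ∀ b, d (r b m) = r b (d m) + i.negOnePow • r (𝔸.d b) m

attribute [instance] DGBimod.addCommGroup DGBimod.module

namespace DGBimod

variable {k : Type u} {A : Type v} [Field k] [Ring A] [Algebra k A] {𝔸 : DGAlgStr k A}

/-- Morphisms of dg bimodules: bimodule maps of degree `0` which commute with the differentials. -/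
@[ext]
structure Hom (M N : DGBimod 𝔸) where
  f : M.carrier →ₗ[k] N.carrier
  map_l : ∀ a m, f (M.l a m) = N.l a (f m)
  map_r : ∀ a m, f (M.r a m) = N.r a (f m)
  map_mem : ∀ i : ℤ, ∀ m ∈ M.gr i, f m ∈ N.gr i
  map_d : ∀ m, f (M.d m) = N.d (f m)

instance : Category (DGBimod 𝔸) where
  Hom := Hom
  id M := ⟨LinearMap.id, fun _ _ => rfl, fun _ _ => rfl, fun _ _ h => h, fun _ => rfl⟩
  comp F G := ⟨G.f ∘ₗ F.f, fun a m => by simp [F.map_l, G.map_l],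
    fun a m => by simp [F.map_r, G.map_r], fun i m hm => G.map_mem i _ (F.map_mem i m hm),
    fun m => by simp [F.map_d, G.map_d]⟩

theorem d_l' (M : DGBimod 𝔸) (a : A) (m : M.carrier) :
    M.d (M.l a m) = M.l (𝔸.d a) m + M.l (parity 𝔸.isInternal a) (M.d m) := by
  refine graded_ext 𝔸.isInternal (f := M.d ∘ₗ M.l.flip m)
    (g := M.l.flip m ∘ₗ 𝔸.d + M.l.flip (M.d m) ∘ₗ parity 𝔸.isInternal) (fun i a ha => ?_) a
  simp only [LinearMap.comp_apply, LinearMap.add_apply, LinearMap.flip_apply]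
  rw [M.d_l i a ha m, parity_apply _ ha, map₂_units_smul]

/-- Quasi-isomorphisms: the morphisms which are injective and surjective on homology. -/
def quasiIso (𝔸 : DGAlgStr k A) : MorphismProperty (DGBimod 𝔸) := fun M N F =>
  (∀ m, M.d m = 0 → (∃ n, F.f m = N.d n) → ∃ m', m = M.d m') ∧
    ∀ n, N.d n = 0 → ∃ m, M.d m = 0 ∧ ∃ n', n = F.f m + N.d n'

/-- The suspension `M[1]`, with `M[1]_i = M_{i-1}`, differential `-d`, and left action
`a • m = (-1) ^ |a| a m`. -/
noncomputable def shift (M : DGBimod 𝔸) : DGBimod 𝔸 where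
  carrier := M.carrier
  l := M.l ∘ₗ parity 𝔸.isInternal
  r := M.r
  l_one m := by simp [parity_one _ 𝔸.one_mem, M.l_one]
  l_mul a b m := by simp [parity_mul _ 𝔸.mul_mem, M.l_mul]
  r_one := M.r_one
  r_mul := M.r_mul
  l_r a b m := M.l_r _ b m
  gr i := M.gr (i - 1)
  isInternal := by
    refine isInternal_of_proj (fun i => proj M.isInternal (i - 1))
      (fun i m hm => proj_self _ hm) (fun i j hij m hm => proj_ne _ (by omega) hm)
      (fun S hS m => graded_le M.isInternal (fun i => ?_) m)
    simpa using hS (i + 1)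
  l_mem i j a ha m hm := by
    have := M.l_mem i (j - 1) _ (parity_mem 𝔸.isInternal ha) m hm
    rwa [← add_sub_assoc] at this
  r_mem i j m hm b hb := by
    have := M.r_mem (i - 1) j m hm b hb
    rwa [sub_add_eq_add_sub] at this
  d := -M.d
  d_mem i m hm := neg_mem (M.d_mem (i - 1) m hm)
  d_d m := by simp [M.d_d]
  d_l i a ha m := by
    simp only [LinearMap.neg_apply, LinearMap.comp_apply]
    rw [M.d_l', parity_anticomm 𝔸.isInternal 𝔸.d 𝔸.d_mem, parity_parity, parity_apply _ ha,
      map₂_units_smul, negOnePow_smul_smul]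
    simp [add_comm]
  d_r i m hm b := by
    simp only [LinearMap.neg_apply]
    rw [M.d_r (i - 1) m hm b, Int.negOnePow_sub, Int.negOnePow_one]
    simp [add_comm]

/-- The mapping cone `N ⊕ M[1]` of `F : M ⟶ N`, with `d (n, m) = (d n + F m, - d m)`. -/
noncomputable def cone {M N : DGBimod 𝔸} (F : M ⟶ N) : DGBimod 𝔸 where
  carrier := N.carrier × M.carrier
  l := LinearMap.mk₂ k (fun a x => (N.l a x.1, M.l (parity 𝔸.isInternal a) x.2))
    (by simp) (by simp) (by simp) (by simp)
  r := LinearMap.mk₂ k (fun a x => (N.r a x.1, M.r a x.2)) (by simp) (by simp) (by simp)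
    (by simp)
  l_one x := Prod.ext (N.l_one x.1) (M.shift.l_one x.2)
  l_mul a b x := Prod.ext (N.l_mul a b x.1) (M.shift.l_mul a b x.2)
  r_one x := Prod.ext (N.r_one x.1) (M.r_one x.2)
  r_mul a b x := Prod.ext (N.r_mul a b x.1) (M.r_mul a b x.2)
  l_r a b x := Prod.ext (N.l_r a b x.1) (M.shift.l_r a b x.2)
  gr i := (N.gr i).prod (M.gr (i - 1))
  isInternal := by
    refine isInternal_of_proj
      (fun i => LinearMap.prodMap (proj N.isInternal i) (proj M.isInternal (i - 1)))
      (fun i x hx => ?_) (fun i j hij x hx => ?_) (fun S hS x => ?_)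
    · exact Prod.ext (proj_self _ hx.1) (proj_self _ hx.2)
    · exact Prod.ext (proj_ne _ hij hx.1) (proj_ne _ (by omega) hx.2)
    · have h1 : LinearMap.inl k N.carrier M.carrier x.1 ∈ S :=
        graded_le N.isInternal (S := S.comap (LinearMap.inl k _ _))
          (fun i n hn => hS i ⟨hn, zero_mem _⟩) x.1
      have h2 : LinearMap.inr k N.carrier M.carrier x.2 ∈ S :=
        graded_le M.isInternal (S := S.comap (LinearMap.inr k _ _))
          (fun i n hn => hS (i + 1) ⟨zero_mem _, by simpa using hn⟩) x.2
      simpa using add_mem h1 h2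
  l_mem i j a ha x hx := ⟨N.l_mem i j a ha _ hx.1, M.shift.l_mem i j a ha _ hx.2⟩
  r_mem i j x hx b hb := ⟨N.r_mem i j _ hx.1 b hb, M.shift.r_mem i j _ hx.2 b hb⟩
  d := LinearMap.prod (LinearMap.coprod N.d F.f) (-(M.d ∘ₗ LinearMap.snd k _ _))
  d_mem i x hx := ⟨add_mem (N.d_mem i _ hx.1) (F.map_mem (i - 1) _ hx.2),
    M.shift.d_mem i _ hx.2⟩
  d_d x := by
    refine Prod.ext ?_ (M.shift.d_d _)
    change N.d (N.d x.1 + F.f x.2) + F.f (-M.d x.2) = 0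
    simp [N.d_d, F.map_d]
  d_l i a ha x := by
    refine Prod.ext ?_ (M.shift.d_l i a ha x.2)
    change N.d (N.l a x.1) + F.f (M.l (parity 𝔸.isInternal a) x.2)
      = N.l (𝔸.d a) x.1 + i.negOnePow • N.l a (N.d x.1 + F.f x.2)
    rw [N.d_l i a ha, F.map_l, parity_apply _ ha, map₂_units_smul, map_add, smul_add, add_assoc]
  d_r i x hx b := by
    refine Prod.ext ?_ (M.shift.d_r i x.2 hx.2 b)
    change N.d (N.r b x.1) + F.f (M.r b x.2)
      = N.r b (N.d x.1 + F.f x.2) + i.negOnePow • N.r (𝔸.d b) x.1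
    rw [N.d_r i x.1 hx.1, F.map_r, map_add]
    abel

/-- The diagonal bimodule: `𝔸` as a dg bimodule over itself. -/
def diagonal (𝔸 : DGAlgStr k A) : DGBimod 𝔸 where
  carrier := A
  l := LinearMap.mul k A
  r := (LinearMap.mul k A).flip
  l_one m := by simp
  l_mul a b m := by simp [mul_assoc]
  r_one m := by simp
  r_mul a b m := by simp [mul_assoc]
  l_r a b m := by simp [mul_assoc]
  gr := 𝔸.gr
  isInternal := 𝔸.isInternal
  l_mem i j a ha m hm := 𝔸.mul_mem i j a ha m hm
  r_mem i j a ha m hm := 𝔸.mul_mem i j a ha m hm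
  d := 𝔸.d
  d_mem := 𝔸.d_mem
  d_d := 𝔸.d_d
  d_l i a ha m := 𝔸.leibniz i a ha m
  d_r i m hm b := 𝔸.leibniz i m hm b

theorem isInternal_tensor {gr : ℤ → Submodule k A} (h : DirectSum.IsInternal gr) :
    DirectSum.IsInternal fun n : ℤ =>
      ⨆ i : ℤ, Submodule.map₂ (TensorProduct.mk k A A) (gr i) (gr (n - i)) := by
  have hπ : ∀ (n i j : ℤ), ∀ a ∈ gr i, ∀ b ∈ gr j,
      TensorProduct.lift (gradedLift h fun i => (TensorProduct.mk k A A).compl₂ (proj h (n - i)))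
        (a ⊗ₜ[k] b) = if i + j = n then a ⊗ₜ[k] b else 0 := by
    intro n i j a ha b hb
    rw [TensorProduct.lift.tmul, gradedLift_apply h _ ha, LinearMap.compl₂_apply]
    split_ifs with hn
    · have : j = n - i := by omega
      subst this
      rw [proj_self h hb]
      rfl
    · rw [proj_ne h (by omega) hb]
      simp
  refine isInternal_of_proj (fun n => TensorProduct.lift
      (gradedLift h fun i => (TensorProduct.mk k A A).compl₂ (proj h (n - i))))
    (fun n x hx => ?_) (fun n n' hn x hx => ?_) (fun S hS x => ?_)
  · refine (iSup_le fun i => Submodule.map₂_le.2 fun a ha b hb => ?_ :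
      _ ≤ LinearMap.eqLocus _ LinearMap.id) hx
    change _ = _
    rw [TensorProduct.mk_apply, hπ n i (n - i) a ha b hb, if_pos (by omega)]
    rfl
  · refine (iSup_le fun i => Submodule.map₂_le.2 fun a ha b hb => ?_ : _ ≤ LinearMap.ker _) hx
    rw [LinearMap.mem_ker, TensorProduct.mk_apply, hπ n' i (n - i) a ha b hb, if_neg (by omega)]
  · induction x using TensorProduct.induction_on with
    | zero => exact zero_mem _
    | add x y hx hy => exact add_mem hx hy
    | tmul a b =>
      refine graded_le h (S := S.comap ((TensorProduct.mk k A A).flip b)) (fun i a ha => ?_) a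
      refine graded_le h (S := S.comap (TensorProduct.mk k A A a)) (fun j b hb => ?_) b
      refine hS (i + j) (Submodule.mem_iSup_of_mem i (Submodule.apply_mem_map₂ _ ha ?_))
      simpa using hb

/-- The dg bimodule `𝔸 ⊗ 𝔸` over the ground field with the outer bimodule structure
`a (x ⊗ y) b = a x ⊗ y b` and `d (x ⊗ y) = d x ⊗ y + (-1) ^ |x| x ⊗ d y`. It corresponds to the
enveloping dg algebra as a module over itself. -/
noncomputable def free (𝔸 : DGAlgStr k A) : DGBimod 𝔸 where
  carrier := A ⊗[k] A
  l := LinearMap.rTensorHom A ∘ₗ LinearMap.mul k A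
  r := LinearMap.lTensorHom A ∘ₗ (LinearMap.mul k A).flip
  l_one x := by
    induction x using TensorProduct.induction_on <;> simp_all
  l_mul a b x := by
    induction x using TensorProduct.induction_on <;> simp_all [mul_assoc]
  r_one x := by
    induction x using TensorProduct.induction_on <;> simp_all
  r_mul a b x := by
    induction x using TensorProduct.induction_on <;> simp_all [mul_assoc]
  l_r a b x := by
    induction x using TensorProduct.induction_on <;> simp_all
  gr n := ⨆ i : ℤ, Submodule.map₂ (TensorProduct.mk k A A) (𝔸.gr i) (𝔸.gr (n - i))
  isInternal := isInternal_tensor 𝔸.isInternal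
  l_mem i j a ha x hx := by
    refine (iSup_le fun p => Submodule.map₂_le.2 fun b hb c hc => ?_ :
      _ ≤ Submodule.comap (LinearMap.rTensor A (LinearMap.mul k A a)) (⨆ q : ℤ,
        Submodule.map₂ (TensorProduct.mk k A A) (𝔸.gr q) (𝔸.gr (i + j - q)))) hx
    refine Submodule.mem_iSup_of_mem (i + p)
      (Submodule.apply_mem_map₂ _ (𝔸.mul_mem _ _ a ha b hb) ?_)
    rwa [add_sub_add_left_eq_sub]
  r_mem i j x hx c hc := by
    refine (iSup_le fun p => Submodule.map₂_le.2 fun a ha b hb => ?_ :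
      _ ≤ Submodule.comap (LinearMap.lTensor A ((LinearMap.mul k A).flip c)) (⨆ q : ℤ,
        Submodule.map₂ (TensorProduct.mk k A A) (𝔸.gr q) (𝔸.gr (i + j - q)))) hx
    refine Submodule.mem_iSup_of_mem p (Submodule.apply_mem_map₂ _ ha ?_)
    have := 𝔸.mul_mem _ _ b hb c hc
    rwa [sub_add_eq_add_sub] at this
  d := LinearMap.rTensor A 𝔸.d + TensorProduct.map (parity 𝔸.isInternal) 𝔸.d
  d_mem n x hx := by
    refine (iSup_le fun p => Submodule.map₂_le.2 fun a ha b hb => ?_ :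
      _ ≤ Submodule.comap (LinearMap.rTensor A 𝔸.d +
        TensorProduct.map (parity 𝔸.isInternal) 𝔸.d) (⨆ q : ℤ,
        Submodule.map₂ (TensorProduct.mk k A A) (𝔸.gr q) (𝔸.gr (n - 1 - q)))) hx
    refine add_mem (Submodule.mem_iSup_of_mem (p - 1)
      (Submodule.apply_mem_map₂ _ (𝔸.d_mem _ a ha) ?_))
      (Submodule.mem_iSup_of_mem p (Submodule.apply_mem_map₂ _ (parity_mem _ ha) ?_))
    · rwa [sub_sub_sub_cancel_right]
    · have := 𝔸.d_mem _ b hb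
      rwa [sub_right_comm] at this
  d_d x := by
    induction x using TensorProduct.induction_on with
    | zero => simp
    | add x y hx hy => rw [map_add, map_add, hx, hy, add_zero]
    | tmul a b =>
      simp [𝔸.d_d, parity_anticomm 𝔸.isInternal 𝔸.d 𝔸.d_mem, TensorProduct.neg_tmul]
  d_l i a ha x := by
    induction x using TensorProduct.induction_on with
    | zero => simp
    | add x y hx hy =>
      rw [map_add, map_add, hx, hy, map_add, map_add, map_add, smul_add]
      abel
    | tmul b c =>
      have : ∀ y : A ⊗[k] A, (LinearMap.rTensorHom A ∘ₗ LinearMap.mul k A) (i.negOnePow • a) y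
          = i.negOnePow • (LinearMap.rTensorHom A ∘ₗ LinearMap.mul k A) a y := fun y => by
        rcases Int.units_eq_one_or i.negOnePow with h | h <;> simp [h]
      rw [← this, ← parity_apply 𝔸.isInternal ha]
      simp [𝔸.d_mul, parity_mul _ 𝔸.mul_mem, TensorProduct.add_tmul, add_assoc]
  d_r n x hx c := by
    refine (iSup_le fun p => Submodule.map₂_le.2 fun a ha b hb => ?_ :
      _ ≤ LinearMap.eqLocus
        ((LinearMap.rTensor A 𝔸.d + TensorProduct.map (parity 𝔸.isInternal) 𝔸.d) ∘ₗ
          (LinearMap.lTensorHom A ∘ₗ (LinearMap.mul k A).flip) c)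
        ((LinearMap.lTensorHom A ∘ₗ (LinearMap.mul k A).flip) c ∘ₗ
          (LinearMap.rTensor A 𝔸.d + TensorProduct.map (parity 𝔸.isInternal) 𝔸.d) +
          n.negOnePow • (LinearMap.lTensorHom A ∘ₗ (LinearMap.mul k A).flip) (𝔸.d c))) hx
    have hn : n.negOnePow = p.negOnePow * (n - p).negOnePow := by
      rw [← Int.negOnePow_add, add_sub_cancel]
    simp only [LinearMap.mem_eqLocus, TensorProduct.mk_apply, LinearMap.comp_apply,
      LinearMap.add_apply, LinearMap.smul_apply, LinearMap.coe_lTensorHom, LinearMap.lTensor_tmul,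
      LinearMap.rTensor_tmul, LinearMap.flip_apply, LinearMap.mul_apply', TensorProduct.map_tmul,
      map_add]
    rw [𝔸.leibniz _ b hb c, TensorProduct.tmul_add, add_assoc, parity_apply _ ha, hn]
    congr 2
    rcases Int.units_eq_one_or p.negOnePow with h | h <;>
    rcases Int.units_eq_one_or (n - p).negOnePow with h' | h' <;>
    simp [h, h', TensorProduct.neg_tmul, TensorProduct.tmul_neg]

end DGBimod

/-! ## Derived categories and homological smoothness -/

section Derived

variable {k : Type u} {A : Type v} [Field k] [Ring A] [Algebra k A]

/-- The derived category of dg bimodules, i.e. of dg modules over the enveloping dg algebra. -/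
abbrev DerivedCat (𝔸 : DGAlgStr k A) := (DGBimod.quasiIso 𝔸).Localization

/-- A dg bimodule as an object of the derived category. -/
abbrev toDerived {𝔸 : DGAlgStr k A} (M : DGBimod 𝔸) : DerivedCat 𝔸 :=
  (DGBimod.quasiIso 𝔸).Q.obj M

/-- Thick subcategories of the derived category: full subcategories closed under direct summands
(hence under isomorphisms), under `[1]` and `[-1]`, and under cones. Here one uses that every
distinguished triangle is isomorphic to `M ⟶ N ⟶ cone F ⟶ M[1]` for a morphism `F : M ⟶ N` of
dg bimodules. -/
structure IsThick {𝔸 : DGAlgStr k A} (P : ObjectProperty (DerivedCat 𝔸)) : Prop where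
  retract : ∀ {X Y : DerivedCat 𝔸}, Retract X Y → P Y → P X
  shift : ∀ M : DGBimod 𝔸, P (toDerived M.shift) ↔ P (toDerived M)
  cone : ∀ {M N : DGBimod 𝔸} (F : M ⟶ N),
    P (toDerived M) → P (toDerived N) → P (toDerived (DGBimod.cone F))

/-- The perfect derived category: the smallest full triangulated subcategory which contains the
enveloping dg algebra and is closed under direct summands. -/
def IsPerfect {𝔸 : DGAlgStr k A} (X : DerivedCat 𝔸) : Prop :=
  ∀ P : ObjectProperty (DerivedCat 𝔸), IsThick P → P (toDerived (DGBimod.free 𝔸)) → P X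

/-- A dg algebra is homologically smooth if it is perfect as a dg bimodule over itself. -/
def IsHomologicallySmooth (𝔸 : DGAlgStr k A) : Prop :=
  IsPerfect (toDerived (DGBimod.diagonal 𝔸))

end Derived

/-! ## Tensor rings -/

/-- A graded `K`-bimodule structure on `V`, for a commutative `k`-algebra `K` sitting in degree `0`,
with `k` acting centrally. The left and right multiplication by `x` are `l x` and `r x`. -/
structure GrBimod (k : Type u) (K : Type w) (V : Type v) [Field k] [CommRing K] [Algebra k K]
    [AddCommGroup V] [Module k V] where
  l : K →ₐ[k] Module.End k V
  r : K →ₐ[k] Module.End k V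
  l_r : ∀ x y v, l x (r y v) = r y (l x v)
  gr : ℤ → Submodule k V
  isInternal : DirectSum.IsInternal gr
  l_mem : ∀ i : ℤ, ∀ x, ∀ v ∈ gr i, l x v ∈ gr i
  r_mem : ∀ i : ℤ, ∀ x, ∀ v ∈ gr i, r x v ∈ gr i

section TensorRing

variable {k : Type u} {K : Type w} {V : Type v} [Field k] [CommRing K] [Algebra k K]
  [AddCommGroup V] [Module k V]

/-- The relations defining the tensor ring of a `K`-bimodule `V` as a quotient of the free
`k`-algebra on the vector space `K × V`. -/
inductive TensorRing.Rel (β : GrBimod k K V) :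
    TensorAlgebra k (K × V) → TensorAlgebra k (K × V) → Prop
  | one : Rel β (TensorAlgebra.ι k (1, 0)) 1
  | mul (x y : K) : Rel β (TensorAlgebra.ι k (x * y, 0))
      (TensorAlgebra.ι k (x, 0) * TensorAlgebra.ι k (y, 0))
  | left (x : K) (v : V) : Rel β (TensorAlgebra.ι k (0, β.l x v))
      (TensorAlgebra.ι k (x, 0) * TensorAlgebra.ι k (0, v))
  | right (v : V) (x : K) : Rel β (TensorAlgebra.ι k (0, β.r x v))
      (TensorAlgebra.ι k (0, v) * TensorAlgebra.ι k (x, 0))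

/-- The tensor ring `T_K(V) = K ⊕ V ⊕ V ⊗_K V ⊕ ⋯` of a `K`-bimodule `V`, as the `k`-algebra
generated by the algebra `K` and the vector space `V`, in which the products of elements of `K` with
elements of `V` are given by the bimodule structure. -/
def TensorRing (β : GrBimod k K V) : Type (max u v w) := RingQuot (TensorRing.Rel β)

namespace TensorRing

variable (β : GrBimod k K V)

noncomputable instance : Ring (TensorRing β) := inferInstanceAs (Ring (RingQuot (Rel β)))

noncomputable instance : Algebra k (TensorRing β) :=
  inferInstanceAs (Algebra k (RingQuot (Rel β)))

/-- The quotient map. -/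
noncomputable def mk : TensorAlgebra k (K × V) →ₐ[k] TensorRing β := RingQuot.mkAlgHom k (Rel β)

/-- The inclusion of `K`. -/
noncomputable def coef : K →ₐ[k] TensorRing β :=
  AlgHom.ofLinearMap ((mk β).toLinearMap ∘ₗ TensorAlgebra.ι k ∘ₗ LinearMap.inl k K V)
    ((RingQuot.mkAlgHom_rel k (Rel.one (β := β))).trans (map_one _))
    (fun x y => (RingQuot.mkAlgHom_rel k (Rel.mul (β := β) x y)).trans (map_mul _ _ _))

/-- The inclusion of `V`. -/
noncomputable def gen : V →ₗ[k] TensorRing β :=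
  (mk β).toLinearMap ∘ₗ TensorAlgebra.ι k ∘ₗ LinearMap.inr k K V

theorem gen_l (x : K) (v : V) : gen β (β.l x v) = coef β x * gen β v :=
  (RingQuot.mkAlgHom_rel k (Rel.left (β := β) x v)).trans (map_mul _ _ _)

theorem gen_r (x : K) (v : V) : gen β (β.r x v) = gen β v * coef β x :=
  (RingQuot.mkAlgHom_rel k (Rel.right (β := β) v x)).trans (map_mul _ _ _)

section lift

variable {β} {B : Type*} [Ring B] [Algebra k B]

/-- The universal property of the tensor ring. -/
noncomputable def lift (f : K →ₐ[k] B) (g : V →ₗ[k] B) (hl : ∀ x v, g (β.l x v) = f x * g v)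
    (hr : ∀ x v, g (β.r x v) = g v * f x) : TensorRing β →ₐ[k] B :=
  RingQuot.liftAlgHom k ⟨TensorAlgebra.lift k (LinearMap.coprod f.toLinearMap g), by
    intro a b h
    induction h with
    | one => simp
    | mul x y => simp
    | left x v => simp [hl]
    | right v x => simp [hr]⟩

variable {f : K →ₐ[k] B} {g : V →ₗ[k] B} {hl : ∀ x v, g (β.l x v) = f x * g v}
    {hr : ∀ x v, g (β.r x v) = g v * f x}

theorem lift_coef (x : K) : lift f g hl hr (coef β x) = f x :=
  (RingQuot.liftAlgHom_mkAlgHom_apply k _ _ _).trans (by simp)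

theorem lift_gen (v : V) : lift f g hl hr (gen β v) = g v :=
  (RingQuot.liftAlgHom_mkAlgHom_apply k _ _ _).trans (by simp)

end lift

variable {β}

/-- The tensor ring is generated by `K` and `V`. -/
theorem induction {S : Subalgebra k (TensorRing β)} (h1 : ∀ x, coef β x ∈ S)
    (h2 : ∀ v, gen β v ∈ S) (x : TensorRing β) : x ∈ S := by
  obtain ⟨y, rfl⟩ := RingQuot.mkAlgHom_surjective k (Rel β) x
  change mk β y ∈ S
  induction y using TensorAlgebra.induction with
  | algebraMap c => rw [AlgHom.commutes]; exact S.algebraMap_mem c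
  | ι z =>
    have : mk β (TensorAlgebra.ι k z) = coef β z.1 + gen β z.2 := by
      change _ = mk β (TensorAlgebra.ι k (z.1, 0)) + mk β (TensorAlgebra.ι k (0, z.2))
      rw [← map_add, ← map_add]
      simp
    rw [this]
    exact add_mem (h1 _) (h2 _)
  | mul a b ha hb => rw [map_mul]; exact mul_mem ha hb
  | add a b ha hb => rw [map_add]; exact add_mem ha hb

/-- A graded family of subspaces containing the generators spans the tensor ring. -/
theorem iSup_eq_top {G : ℤ → Submodule k (TensorRing β)}
    (hmul : ∀ i j : ℤ, ∀ a ∈ G i, ∀ b ∈ G j, a * b ∈ G (i + j)) (h1 : ∀ x, coef β x ∈ G 0)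
    (h2 : ∀ i : ℤ, ∀ v ∈ β.gr i, gen β v ∈ G i) : ⨆ i, G i = ⊤ := by
  have hm : ∀ a b, a ∈ (⨆ i, G i) → b ∈ (⨆ i, G i) → a * b ∈ (⨆ i, G i) := by
    intro a b ha hb
    refine (iSup_le fun i x hx => ?_ :
      _ ≤ (⨆ i, G i).comap ((LinearMap.mul k (TensorRing β)).flip b)) ha
    refine (iSup_le fun j y hy => ?_ :
      _ ≤ (⨆ i, G i).comap (LinearMap.mul k (TensorRing β) x)) hb
    exact Submodule.mem_iSup_of_mem (i + j) (hmul i j x hx y hy)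
  let S : Subalgebra k (TensorRing β) := Submodule.toSubalgebra (⨆ i, G i)
    (Submodule.mem_iSup_of_mem 0 (by simpa using h1 1)) hm
  refine eq_top_iff.2 fun x _ => ?_
  exact induction (S := S) (fun x => Submodule.mem_iSup_of_mem 0 (h1 x))
    (fun v => graded_le β.isInternal (S := (⨆ i, G i).comap (gen β))
      (fun i v hv => Submodule.mem_iSup_of_mem i (h2 i v hv)) v) x

variable (β)

/-- The degree-`i` inclusion `a ↦ a T^i` into Laurent polynomials. -/
noncomputable def monomial (i : ℤ) : TensorRing β →ₗ[k] AddMonoidAlgebra (TensorRing β) ℤ where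
  toFun a := AddMonoidAlgebra.single i a
  map_add' _ _ := AddMonoidAlgebra.single_add _ _ _
  map_smul' _ _ := (AddMonoidAlgebra.smul_single _ _ _).symm

theorem monomial_one : monomial β 0 1 = 1 := rfl

theorem monomial_mul (i j : ℤ) (a b : TensorRing β) :
    monomial β i a * monomial β j b = monomial β (i + j) (a * b) :=
  AddMonoidAlgebra.single_mul_single ..

/-- `x ↦ x` on `K`. -/
noncomputable def coactCoef : K →ₐ[k] AddMonoidAlgebra (TensorRing β) ℤ :=
  (AlgHom.ofLinearMap (monomial β 0) (monomial_one β)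
    (fun a b => (monomial_mul β 0 0 a b).symm)).comp (coef β)

/-- `v ↦ v T^i` for `v` of degree `i`. -/
noncomputable def coactGen : V →ₗ[k] AddMonoidAlgebra (TensorRing β) ℤ :=
  gradedLift β.isInternal fun i => monomial β i ∘ₗ gen β

theorem coactGen_apply {i : ℤ} {v : V} (hv : v ∈ β.gr i) :
    coactGen β v = monomial β i (gen β v) := gradedLift_apply _ _ hv

theorem coactGen_l (x : K) (v : V) : coactGen β (β.l x v) = coactCoef β x * coactGen β v := by
  refine graded_ext β.isInternal (f := coactGen β ∘ₗ β.l x)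
    (g := LinearMap.mul k _ (coactCoef β x) ∘ₗ coactGen β) (fun i v hv => ?_) v
  simp only [LinearMap.comp_apply, LinearMap.mul_apply']
  rw [coactGen_apply β (β.l_mem i x v hv), coactGen_apply β hv, gen_l]
  exact (zero_add i ▸ monomial_mul β 0 i _ _).symm

theorem coactGen_r (x : K) (v : V) : coactGen β (β.r x v) = coactGen β v * coactCoef β x := by
  refine graded_ext β.isInternal (f := coactGen β ∘ₗ β.r x)
    (g := (LinearMap.mul k _).flip (coactCoef β x) ∘ₗ coactGen β) (fun i v hv => ?_) v
  simp only [LinearMap.comp_apply, LinearMap.flip_apply, LinearMap.mul_apply']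
  rw [coactGen_apply β (β.r_mem i x v hv), coactGen_apply β hv, gen_r]
  exact (add_zero i ▸ monomial_mul β i 0 _ _).symm

/-- The algebra map `T_K(V) → T_K(V)[T, T⁻¹]` with `x ↦ x` for `x` in `K`, and `v ↦ v T^i` for `v`
in `V` of degree `i`; it multiplies every element of degree `n` by `T^n`. -/
noncomputable def coact : TensorRing β →ₐ[k] AddMonoidAlgebra (TensorRing β) ℤ :=
  lift (coactCoef β) (coactGen β) (coactGen_l β) (coactGen_r β)

/-- The grading of `T_K(V)`: the component of degree `n` is spanned by the products `v₁ ⋯ v_m` of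
homogeneous elements of `V` whose degrees have sum `n` (and by `K` if `n = 0`). -/
noncomputable def gr (n : ℤ) : Submodule k (TensorRing β) :=
  LinearMap.eqLocus (coact β).toLinearMap (monomial β n)

variable {β}

theorem mem_gr {n : ℤ} {x : TensorRing β} :
    x ∈ gr β n ↔ coact β x = AddMonoidAlgebra.single n x := Iff.rfl

theorem coef_mem (x : K) : coef β x ∈ gr β 0 := by
  rw [mem_gr, coact, lift_coef]
  rfl

theorem gen_mem (i : ℤ) (v : V) (hv : v ∈ β.gr i) : gen β v ∈ gr β i := by
  rw [mem_gr, coact, lift_gen, coactGen_apply β hv]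
  rfl

theorem gr_mul_mem (i j : ℤ) (a : TensorRing β) (ha : a ∈ gr β i) (b : TensorRing β)
    (hb : b ∈ gr β j) : a * b ∈ gr β (i + j) := by
  rw [mem_gr] at *
  rw [map_mul, ha, hb, AddMonoidAlgebra.single_mul_single]

theorem gr_one_mem : (1 : TensorRing β) ∈ gr β 0 := by
  simpa using coef_mem (β := β) 1

/-- The coefficient of `T^n`. -/
noncomputable def coeff (β : GrBimod k K V) (n : ℤ) :
    AddMonoidAlgebra (TensorRing β) ℤ →ₗ[k] TensorRing β where
  toFun p := p.coeff n
  map_add' _ _ := by simp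
  map_smul' _ _ := by simp

theorem gr_isInternal : DirectSum.IsInternal (gr β) := by
  refine isInternal_of_proj (fun n => coeff β n ∘ₗ (coact β).toLinearMap)
    (fun i m hm => ?_) (fun i j hij m hm => ?_) (fun S hS m => ?_)
  · change (coact β m).coeff i = m
    rw [mem_gr.1 hm]
    exact Finsupp.single_eq_same
  · change (coact β m).coeff j = 0
    rw [mem_gr.1 hm]
    exact Finsupp.single_eq_of_ne' hij
  · have : (⊤ : Submodule k (TensorRing β)) ≤ S := by
      rw [← iSup_eq_top (G := gr β) gr_mul_mem coef_mem gen_mem]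
      exact iSup_le hS
    exact this trivial

section deriv

variable (β) (δ : V →ₗ[k] TensorRing β) (hl : ∀ x v, δ (β.l x v) = coef β x * δ v)
  (hr : ∀ x v, δ (β.r x v) = δ v * coef β x)

theorem parity_coef (x : K) : parity (gr_isInternal (β := β)) (coef β x) = coef β x := by
  rw [parity_apply _ (coef_mem x)]; simp

/-- The algebra map `a ↦ !![(-1) ^ |a| a, D a; 0, a]` which encodes the derivation `D`. -/
noncomputable def derivHom : TensorRing β →ₐ[k] Matrix (Fin 2) (Fin 2) (TensorRing β) :=
  lift (AlgHom.comp (AlgHom.ofLinearMap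
      (LinearMap.mk ⟨fun a => (!![a, 0; 0, a] : Matrix (Fin 2) (Fin 2) (TensorRing β)),
        fun a b => by simp⟩ (fun c a => by simp))
      (by simp [Matrix.one_fin_two]) (fun a b => by simp)) (coef β))
    (LinearMap.mk ⟨fun v => (!![parity (gr_isInternal (β := β)) (gen β v), δ v; 0, gen β v] :
        Matrix (Fin 2) (Fin 2) (TensorRing β)), fun a b => by simp⟩ (fun c a => by simp))
    (fun x v => by
      simp [hl, gen_l, parity_mul gr_isInternal gr_mul_mem, parity_coef])
    (fun x v => by
      simp [hr, gen_r, parity_mul gr_isInternal gr_mul_mem, parity_coef])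

/-- The derivation `D` of the tensor ring with `D x = 0` for `x` in `K`, `D v = δ v` for `v` in `V`,
and `D (a b) = D a b + (-1) ^ |a| a D b`. -/
noncomputable def deriv : TensorRing β →ₗ[k] TensorRing β :=
  LinearMap.mk ⟨fun a => derivHom β δ hl hr a 0 1, fun a b => by simp⟩ (fun c a => by simp)

variable {β δ hl hr}

theorem deriv_coef (x : K) : deriv β δ hl hr (coef β x) = 0 := by
  change derivHom β δ hl hr (coef β x) 0 1 = 0
  rw [derivHom, lift_coef]
  simp

theorem deriv_gen (v : V) : deriv β δ hl hr (gen β v) = δ v := by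
  change derivHom β δ hl hr (gen β v) 0 1 = δ v
  rw [derivHom, lift_gen]
  simp

theorem derivHom_aux (a : TensorRing β) : derivHom β δ hl hr a 0 0 = parity gr_isInternal a ∧
    derivHom β δ hl hr a 1 0 = 0 ∧ derivHom β δ hl hr a 1 1 = a := by
  let S : Subalgebra k (TensorRing β) :=
    { carrier := {a | derivHom β δ hl hr a 0 0 = parity gr_isInternal a ∧
        derivHom β δ hl hr a 1 0 = 0 ∧ derivHom β δ hl hr a 1 1 = a}
      mul_mem' := by
        rintro a b ⟨h1, h2, h3⟩ ⟨h4, h5, h6⟩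
        simp [Matrix.mul_apply, h1, h2, h3, h4, h5, h6, parity_mul gr_isInternal gr_mul_mem]
      add_mem' := by
        rintro a b ⟨h1, h2, h3⟩ ⟨h4, h5, h6⟩
        simp [h1, h2, h3, h4, h5, h6]
      algebraMap_mem' := by
        intro c
        simp [Algebra.algebraMap_eq_smul_one, parity_one gr_isInternal gr_one_mem] }
  refine induction (S := S) (fun x => ?_) (fun v => ?_) a
  · change _ ∧ _ ∧ _
    rw [derivHom, lift_coef]
    simp [parity_coef]
  · change _ ∧ _ ∧ _
    rw [derivHom, lift_gen]
    simp

theorem deriv_mul (a b : TensorRing β) : deriv β δ hl hr (a * b)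
    = deriv β δ hl hr a * b + parity gr_isInternal a * deriv β δ hl hr b := by
  change derivHom β δ hl hr (a * b) 0 1 = derivHom β δ hl hr a 0 1 * b +
    parity gr_isInternal a * derivHom β δ hl hr b 0 1
  rw [map_mul, Matrix.mul_apply, Fin.sum_univ_two, (derivHom_aux a).1, (derivHom_aux b).2.2,
    add_comm]

theorem deriv_mem (hδ : ∀ i : ℤ, ∀ v ∈ β.gr i, δ v ∈ gr β (i - 1)) (n : ℤ) (a : TensorRing β)
    (ha : a ∈ gr β n) : deriv β δ hl hr a ∈ gr β (n - 1) := by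
  let G : ℤ → Submodule k (TensorRing β) := fun n =>
    gr β n ⊓ (gr β (n - 1)).comap (deriv β δ hl hr)
  have := le_of_iSup_eq_top (gr' := G) gr_isInternal (fun i => inf_le_left)
    (iSup_eq_top (fun i j a ha b hb => ⟨gr_mul_mem i j a ha.1 b hb.1, ?_⟩)
      (fun x => ⟨coef_mem x, ?_⟩) (fun i v hv => ⟨gen_mem i v hv, ?_⟩)) n ha
  · exact this.2
  · change deriv β δ hl hr (a * b) ∈ gr β (i + j - 1)
    rw [deriv_mul]
    refine add_mem ?_ ?_
    · have := gr_mul_mem _ _ _ ha.2 _ hb.1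
      rwa [sub_add_eq_add_sub] at this
    · have := gr_mul_mem _ _ _ (parity_mem gr_isInternal ha.1) _ hb.2
      rwa [← add_sub_assoc] at this
  · change deriv β δ hl hr (coef β x) ∈ gr β (0 - 1)
    rw [deriv_coef]
    exact zero_mem _
  · change deriv β δ hl hr (gen β v) ∈ gr β (i - 1)
    rw [deriv_gen]
    exact hδ i v hv

theorem deriv_deriv (hδ : ∀ i : ℤ, ∀ v ∈ β.gr i, δ v ∈ gr β (i - 1))
    (hδδ : ∀ v, deriv β δ hl hr (δ v) = 0) (a : TensorRing β) :
    deriv β δ hl hr (deriv β δ hl hr a) = 0 := by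
  let S : Subalgebra k (TensorRing β) :=
    { carrier := {a | deriv β δ hl hr (deriv β δ hl hr a) = 0}
      mul_mem' := by
        intro a b ha hb
        rw [Set.mem_ofPred_eq] at *
        rw [deriv_mul, map_add, deriv_mul, deriv_mul, ha, hb,
          parity_anticomm gr_isInternal _ (deriv_mem hδ)]
        simp
      add_mem' := by
        intro a b ha hb
        rw [Set.mem_ofPred_eq] at *
        rw [map_add, map_add, ha, hb, add_zero]
      algebraMap_mem' := by
        intro c
        have : algebraMap k (TensorRing β) c = coef β (algebraMap k K c) :=
          ((coef β).commutes c).symm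
        rw [Set.mem_ofPred_eq, this, deriv_coef, map_zero] }
  refine induction (S := S) (fun x => ?_) (fun v => ?_) a
  · change deriv β δ hl hr (deriv β δ hl hr _) = 0
    rw [deriv_coef, map_zero]
  · change deriv β δ hl hr (deriv β δ hl hr _) = 0
    rw [deriv_gen, hδδ]

end deriv

/-- The dg algebra structure on the tensor ring `T_K(V)` whose differential is the derivation
extending `δ : V → T_K(V)`. -/
noncomputable def dgAlgStr (β : GrBimod k K V) (δ : V →ₗ[k] TensorRing β)
    (hl : ∀ x v, δ (β.l x v) = coef β x * δ v) (hr : ∀ x v, δ (β.r x v) = δ v * coef β x)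
    (hδ : ∀ i : ℤ, ∀ v ∈ β.gr i, δ v ∈ gr β (i - 1))
    (hδδ : ∀ v, deriv β δ hl hr (δ v) = 0) : DGAlgStr k (TensorRing β) where
  gr := gr β
  isInternal := gr_isInternal
  one_mem := gr_one_mem
  mul_mem := gr_mul_mem
  d := deriv β δ hl hr
  d_mem := deriv_mem hδ
  d_d := deriv_deriv hδ hδδ
  leibniz i a ha b := by
    rw [deriv_mul, parity_apply _ ha, units_smul_mul]

end TensorRing

end TensorRing

/-! ## Augmented dg `K`-rings for `K = k^t` -/

/-- An augmented dg `K`-ring structure on the `k`-algebra `A`, where `K = k^t`. A `K`-ring is the same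
as a `k`-algebra `A` with an algebra map `unit : K → A`, whose image need not be central: the
`K`-bimodule structure is `x a y = unit x * a * unit y`. -/
structure AugDGKRing (k : Type u) (t : ℕ) (A : Type v) [Field k] [Ring A] [Algebra k A] extends
    DGAlgStr k A where
  unit : (Fin t → k) →ₐ[k] A
  unit_mem : ∀ x, unit x ∈ gr 0
  d_unit : ∀ x, d (unit x) = 0
  aug : A →ₐ[k] (Fin t → k)
  aug_unit : ∀ x, aug (unit x) = x
  aug_mem : ∀ i : ℤ, i ≠ 0 → ∀ a ∈ gr i, aug a = 0
  aug_d : ∀ a, aug (d a) = 0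

namespace AugDGKRing

variable {k : Type u} {t : ℕ} {A : Type v} [Field k] [Ring A] [Algebra k A]

section

variable (𝔸 : AugDGKRing k t A)

/-- The augmentation ideal. -/
noncomputable def augIdeal : Submodule k A := LinearMap.ker 𝔸.aug.toLinearMap

/-- `A` is complete if the intersection of all powers `I ^ n`, `n ≥ 1`, of its augmentation ideal
`I` is zero. -/
def IsComplete : Prop := ⨅ n : ℕ, 𝔸.augIdeal ^ (n + 1) = ⊥

variable {𝔸}

theorem mem_augIdeal {a : A} : a ∈ 𝔸.augIdeal ↔ 𝔸.aug a = 0 := Iff.rfl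

theorem aug_coe (a : 𝔸.augIdeal) : 𝔸.aug (a : A) = 0 := a.2

theorem aug_proj (i : ℤ) (a : A) (ha : 𝔸.aug a = 0) : 𝔸.aug (proj 𝔸.isInternal i a) = 0 := by
  have key : ∀ a, 𝔸.aug (proj 𝔸.isInternal i a) = if i = 0 then 𝔸.aug a else 0 := by
    intro a
    refine graded_ext 𝔸.isInternal (f := 𝔸.aug.toLinearMap ∘ₗ proj 𝔸.isInternal i)
      (g := if i = 0 then 𝔸.aug.toLinearMap else 0) (fun j a ha => ?_) a |>.trans ?_
    · rw [LinearMap.comp_apply]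
      by_cases hij : j = i
      · subst hij
        rw [proj_self _ ha]
        split_ifs with h
        · rfl
        · exact 𝔸.aug_mem j h a ha
      · rw [proj_ne _ hij ha, map_zero]
        split_ifs with h
        · exact (𝔸.aug_mem j (by omega) a ha).symm
        · rfl
    · split_ifs <;> rfl
  rw [key, ha, ite_self]

theorem aug_parity (a : A) : 𝔸.aug (parity 𝔸.isInternal a) = 𝔸.aug a := by
  refine graded_ext 𝔸.isInternal (f := 𝔸.aug.toLinearMap ∘ₗ parity 𝔸.isInternal)
    (g := 𝔸.aug.toLinearMap) (fun j a ha => ?_) a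
  rw [LinearMap.comp_apply, parity_apply _ ha, map_units_smul]
  by_cases hj : j = 0
  · subst hj; simp
  · have : 𝔸.aug.toLinearMap a = 0 := 𝔸.aug_mem j hj a ha
    rw [this, smul_zero]

variable (𝔸)

/-! The operations on the augmentation ideal. -/

/-- Multiplication. -/
noncomputable def barMul : 𝔸.augIdeal →ₗ[k] 𝔸.augIdeal →ₗ[k] 𝔸.augIdeal :=
  LinearMap.mk₂ k (fun a b => ⟨a * b, by rw [mem_augIdeal, map_mul, aug_coe, zero_mul]⟩)
    (fun a b c => Subtype.ext (add_mul _ _ _)) (fun c a b => Subtype.ext (smul_mul_assoc _ _ _))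
    (fun a b c => Subtype.ext (mul_add _ _ _)) (fun c a b => Subtype.ext (mul_smul_comm _ _ _))

/-- Left multiplication by elements of `K`. -/
noncomputable def barL (x : Fin t → k) : 𝔸.augIdeal →ₗ[k] 𝔸.augIdeal :=
  (LinearMap.mulLeft k (𝔸.unit x)).restrict
    (fun a ha => by rw [mem_augIdeal] at *; simp [ha])

/-- Right multiplication by elements of `K`. -/
noncomputable def barR (x : Fin t → k) : 𝔸.augIdeal →ₗ[k] 𝔸.augIdeal :=
  (LinearMap.mulRight k (𝔸.unit x)).restrict
    (fun a ha => by rw [mem_augIdeal] at *; simp [ha])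

/-- The differential. -/
noncomputable def barD : 𝔸.augIdeal →ₗ[k] 𝔸.augIdeal :=
  𝔸.d.restrict (fun a _ => 𝔸.aug_d a)

/-- The map `a ↦ (-1) ^ |a| a`. -/
noncomputable def barParity : 𝔸.augIdeal →ₗ[k] 𝔸.augIdeal :=
  (parity 𝔸.isInternal).restrict (fun a ha => (aug_parity a).trans ha)

/-- The projections onto the homogeneous components. -/
noncomputable def barProj (i : ℤ) : 𝔸.augIdeal →ₗ[k] 𝔸.augIdeal :=
  (proj 𝔸.isInternal i).restrict (fun a ha => aug_proj i a ha)

@[simp] theorem coe_barMul (a b : 𝔸.augIdeal) : (𝔸.barMul a b : A) = a * b := rfl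
@[simp] theorem coe_barL (x : Fin t → k) (a : 𝔸.augIdeal) : (𝔸.barL x a : A) = 𝔸.unit x * a := rfl
@[simp] theorem coe_barR (x : Fin t → k) (a : 𝔸.augIdeal) : (𝔸.barR x a : A) = a * 𝔸.unit x := rfl
@[simp] theorem coe_barD (a : 𝔸.augIdeal) : (𝔸.barD a : A) = 𝔸.d a := rfl
@[simp] theorem coe_barParity (a : 𝔸.augIdeal) :
    (𝔸.barParity a : A) = parity 𝔸.isInternal (a : A) := rfl
@[simp] theorem coe_barProj (i : ℤ) (a : 𝔸.augIdeal) :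
    (𝔸.barProj i a : A) = proj 𝔸.isInternal i (a : A) := rfl

theorem parity_unit (x : Fin t → k) : parity 𝔸.isInternal (𝔸.unit x) = 𝔸.unit x := by
  rw [parity_apply _ (𝔸.unit_mem x)]; simp

theorem proj_mem (i : ℤ) (a : A) : proj 𝔸.isInternal i a ∈ 𝔸.gr i := by
  refine graded_le 𝔸.isInternal (S := (𝔸.gr i).comap (proj 𝔸.isInternal i)) (fun j a ha => ?_) a
  rw [Submodule.mem_comap]
  by_cases h : j = i
  · subst h; rwa [proj_self _ ha]
  · rw [proj_ne _ h ha]; exact zero_mem _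

theorem exists_finset [FiniteDimensional k A] :
    ∃ s : Finset ℤ, ∀ a, ∑ i ∈ s, proj 𝔸.isInternal i a = a := by
  classical
  have hf := WellFoundedGT.finite_ne_bot_of_iSupIndep 𝔸.isInternal.submodule_iSupIndep
  refine ⟨hf.toFinset, fun a => ?_⟩
  have := graded_ext 𝔸.isInternal (f := ∑ i ∈ hf.toFinset, proj 𝔸.isInternal i)
    (g := LinearMap.id) (fun j a ha => ?_) a
  · simpa using this
  · rw [LinearMap.sum_apply, LinearMap.id_apply, Finset.sum_eq_single j, proj_self _ ha]
    · exact fun i _ hi => proj_ne _ (Ne.symm hi) ha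
    · intro hj
      have : 𝔸.gr j = ⊥ := by simpa using hj
      rw [this, Submodule.mem_bot] at ha
      rw [ha, map_zero]

/-! ## The dual coring -/

/-- The coaugmentation coideal of the graded `k`-dual coring of `A`: the `k`-dual of the
augmentation ideal. (All of this is for finite dimensional `A`, where the graded dual is the
dual.) -/
abbrev DualBar := Module.Dual k 𝔸.augIdeal

/-- The component of degree `i` of the dual: the linear forms supported in degree `-i`. -/
def dualGr (i : ℤ) : Submodule k 𝔸.DualBar where
  carrier := {f | ∀ j : ℤ, j ≠ -i → ∀ a : 𝔸.augIdeal, (a : A) ∈ 𝔸.gr j → f a = 0}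
  zero_mem' := fun _ _ _ _ => rfl
  add_mem' := fun {f g} hf hg j hj a ha => by
    rw [LinearMap.add_apply, hf j hj a ha, hg j hj a ha, add_zero]
  smul_mem' := fun c f hf j hj a ha => by
    rw [LinearMap.smul_apply, hf j hj a ha, smul_zero]

/-- The map `f ↦ (-1) ^ |f| f`. -/
noncomputable def dualParity : 𝔸.DualBar →ₗ[k] 𝔸.DualBar := 𝔸.barParity.dualMap

/-- The differential `f ↦ - (-1) ^ |f| f ∘ d` of the dual. -/
noncomputable def dualD : 𝔸.DualBar →ₗ[k] 𝔸.DualBar := -(𝔸.barD.dualMap ∘ₗ 𝔸.dualParity)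

/-- The reduced coproduct `Δ` of the dual, dual to the multiplication: if `Δ f = ∑ f₁ ⊗ f₂` then
`f (a * b) = ∑ f₂ a * f₁ b`. This is the representative over `k` of the coproduct in the tensor
product over `K` which lies in the subspace `⨁ V e_i ⊗ e_i V` of `V ⊗_k V`; that subspace maps
isomorphically onto `V ⊗_K V`. -/
noncomputable def dualCoprod [FiniteDimensional k A] : 𝔸.DualBar →ₗ[k] 𝔸.DualBar ⊗[k] 𝔸.DualBar :=
  (TensorProduct.dualDistribEquiv k 𝔸.augIdeal 𝔸.augIdeal).symm.toLinearMap ∘ₗ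
    (TensorProduct.lift 𝔸.barMul.flip).dualMap

variable {𝔸}

theorem bar_isInternal [FiniteDimensional k A] :
    DirectSum.IsInternal fun i => (𝔸.gr i).comap 𝔸.augIdeal.subtype := by
  obtain ⟨s, hs⟩ := 𝔸.exists_finset
  refine isInternal_of_proj 𝔸.barProj (fun i m hm => Subtype.ext (proj_self _ hm))
    (fun i j hij m hm => Subtype.ext (proj_ne _ hij hm)) (fun S hS m => ?_)
  have : m = ∑ i ∈ s, 𝔸.barProj i m := Subtype.ext (by simp [hs])
  rw [this]
  exact sum_mem fun i _ => hS i (𝔸.proj_mem i _)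

theorem dual_eq_sum [FiniteDimensional k A] : ∃ s : Finset ℤ, ∀ f : 𝔸.DualBar,
    ∑ i ∈ s, (𝔸.barProj (-i)).dualMap f = f := by
  classical
  obtain ⟨s, hs⟩ := 𝔸.exists_finset
  refine ⟨s.image Neg.neg, fun f => ?_⟩
  rw [Finset.sum_image (fun a _ b _ h => neg_injective h)]
  ext a
  have : a = ∑ i ∈ s, 𝔸.barProj i a := Subtype.ext (by simp [hs])
  conv_rhs => rw [this]
  simp [LinearMap.sum_apply]

theorem dualProj_mem (i : ℤ) (f : 𝔸.DualBar) : (𝔸.barProj (-i)).dualMap f ∈ 𝔸.dualGr i := by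
  intro j hj a ha
  have : 𝔸.barProj (-i) a = 0 := Subtype.ext (proj_ne _ hj ha)
  rw [LinearMap.dualMap_apply, this, map_zero]

theorem dual_isInternal [FiniteDimensional k A] : DirectSum.IsInternal 𝔸.dualGr := by
  obtain ⟨s, hs⟩ := dual_eq_sum (𝔸 := 𝔸)
  refine isInternal_of_proj (fun i => (𝔸.barProj (-i)).dualMap) (fun i f hf => ?_)
    (fun i j hij f hf => ?_) (fun S hS f => ?_)
  · ext a
    refine graded_ext (bar_isInternal (𝔸 := 𝔸)) (f := (𝔸.barProj (-i)).dualMap f) (g := f)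
      (fun j a ha => ?_) a
    rw [LinearMap.dualMap_apply]
    by_cases h : j = -i
    · subst h
      exact congrArg f (Subtype.ext (proj_self _ ha))
    · have : 𝔸.barProj (-i) a = 0 := Subtype.ext (proj_ne _ h ha)
      rw [this, map_zero, hf j h a ha]
  · ext a
    rw [LinearMap.dualMap_apply]
    exact hf (-j) (by omega) _ (𝔸.proj_mem _ _)
  · rw [← hs f]
    exact sum_mem fun i _ => hS i (dualProj_mem i f)

theorem dualParity_apply [FiniteDimensional k A] {i : ℤ} {f : 𝔸.DualBar} (hf : f ∈ 𝔸.dualGr i) :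
    𝔸.dualParity f = i.negOnePow • f := by
  ext a
  refine graded_ext (bar_isInternal (𝔸 := 𝔸)) (f := 𝔸.dualParity f) (g := i.negOnePow • f)
      (fun j a ha => ?_) a
  have h1 : 𝔸.barParity a = j.negOnePow • a := Subtype.ext (parity_apply _ ha)
  change f (𝔸.barParity a) = i.negOnePow • f a
  rw [h1, map_units_smul]
  by_cases h : j = -i
  · rw [h, Int.negOnePow_neg]
  · rw [hf j h a ha, smul_zero, smul_zero]

theorem barParity_barParity (a : 𝔸.augIdeal) : 𝔸.barParity (𝔸.barParity a) = a :=
  Subtype.ext (parity_parity _ _)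

theorem barD_barParity (a : 𝔸.augIdeal) : 𝔸.barD (𝔸.barParity a) = -𝔸.barParity (𝔸.barD a) :=
  Subtype.ext (parity_anticomm _ _ 𝔸.d_mem _)

theorem dualParity_dualParity (f : 𝔸.DualBar) : 𝔸.dualParity (𝔸.dualParity f) = f := by
  ext a
  exact congrArg f (barParity_barParity a)

theorem dualD_apply (f : 𝔸.DualBar) (a : 𝔸.augIdeal) :
    𝔸.dualD f a = f (𝔸.barD (𝔸.barParity a)) := by
  rw [barD_barParity, map_neg]
  rfl

theorem dualD_dualD (f : 𝔸.DualBar) : 𝔸.dualD (𝔸.dualD f) = 0 := by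
  ext a
  rw [dualD_apply, dualD_apply]
  have : 𝔸.barD (𝔸.barParity (𝔸.barD (𝔸.barParity a))) = 0 := by
    rw [← neg_neg (𝔸.barParity (𝔸.barD _)), ← barD_barParity, map_neg]
    exact neg_eq_zero.2 (Subtype.ext (𝔸.d_d _))
  rw [this, map_zero, LinearMap.zero_apply]

theorem dualD_dualParity (f : 𝔸.DualBar) : 𝔸.dualD (𝔸.dualParity f) = -𝔸.dualParity (𝔸.dualD f) := by
  ext a
  rw [LinearMap.neg_apply, dualD_apply]
  change f (𝔸.barParity (𝔸.barD (𝔸.barParity a))) = -𝔸.dualD f (𝔸.barParity a)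
  rw [dualD_apply, ← map_neg, barD_barParity (𝔸.barParity a), neg_neg]

theorem dualD_mem {i : ℤ} {f : 𝔸.DualBar} (hf : f ∈ 𝔸.dualGr i) : 𝔸.dualD f ∈ 𝔸.dualGr (i - 1) := by
  intro j hj a ha
  rw [dualD_apply]
  exact hf (j - 1) (by omega) _ (𝔸.d_mem _ _ (parity_mem _ ha))

section pairing

/-- The pairing `(f ⊗ g, a ⊗ b) ↦ g a * f b`. -/
noncomputable def ev (a b : 𝔸.augIdeal) (z : 𝔸.DualBar ⊗[k] 𝔸.DualBar) : k :=
  TensorProduct.dualDistrib k 𝔸.augIdeal 𝔸.augIdeal z (b ⊗ₜ a)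

theorem ev_tmul (a b : 𝔸.augIdeal) (f g : 𝔸.DualBar) : ev a b (f ⊗ₜ g) = f b * g a := rfl

theorem ev_add (a b : 𝔸.augIdeal) (z w : 𝔸.DualBar ⊗[k] 𝔸.DualBar) :
    ev a b (z + w) = ev a b z + ev a b w := by
  simp [ev]

theorem ev_zero (a b : 𝔸.augIdeal) : ev a b (0 : 𝔸.DualBar ⊗[k] 𝔸.DualBar) = 0 := by
  simp [ev]

theorem dualDistrib_injective (M N : Type*) [AddCommGroup M] [Module k M] [AddCommGroup N]
    [Module k N] [FiniteDimensional k M] [FiniteDimensional k N] :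
    Function.Injective (TensorProduct.dualDistrib k M N) :=
  (TensorProduct.dualDistribEquiv k M N).injective

theorem ev_ext [FiniteDimensional k A] {z w : 𝔸.DualBar ⊗[k] 𝔸.DualBar} (h : ∀ a b, ev a b z = ev a b w) : z = w := by
  refine dualDistrib_injective _ _ (TensorProduct.ext' fun b a => h a b)

theorem ev_coprod [FiniteDimensional k A] (a b : 𝔸.augIdeal) (f : 𝔸.DualBar) :
    ev a b (𝔸.dualCoprod f) = f (𝔸.barMul a b) := by
  have : TensorProduct.dualDistrib k 𝔸.augIdeal 𝔸.augIdeal (𝔸.dualCoprod f)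
      = (TensorProduct.lift 𝔸.barMul.flip).dualMap f :=
    (TensorProduct.dualDistribEquiv k 𝔸.augIdeal 𝔸.augIdeal).apply_symm_apply _
  rw [ev, this]
  rfl

/-- The pairing transforms maps of the two factors into their transposes. -/
theorem ev_map (P Q : 𝔸.augIdeal →ₗ[k] 𝔸.augIdeal) (a b : 𝔸.augIdeal)
    (z : 𝔸.DualBar ⊗[k] 𝔸.DualBar) :
    ev a b (TensorProduct.map P.dualMap Q.dualMap z) = ev (Q a) (P b) z := by
  induction z using TensorProduct.induction_on with
  | zero => simp [ev_zero]
  | tmul f g => rfl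
  | add x y hx hy => rw [map_add, ev_add, ev_add, hx, hy]

theorem coprod_parity [FiniteDimensional k A] (f : 𝔸.DualBar) : 𝔸.dualCoprod (𝔸.dualParity f)
    = TensorProduct.map 𝔸.dualParity 𝔸.dualParity (𝔸.dualCoprod f) := by
  refine ev_ext fun a b => ?_
  rw [dualParity, ev_map, ev_coprod, ev_coprod]
  exact congrArg f (Subtype.ext (parity_mul _ 𝔸.mul_mem _ _))

theorem dualD_eq : 𝔸.dualD = (𝔸.barD ∘ₗ 𝔸.barParity).dualMap := by
  ext f a
  exact dualD_apply f a

theorem coprod_d [FiniteDimensional k A] (f : 𝔸.DualBar) : 𝔸.dualCoprod (𝔸.dualD f)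
    = TensorProduct.map 𝔸.dualD LinearMap.id (𝔸.dualCoprod f)
      + TensorProduct.map 𝔸.dualParity 𝔸.dualD (𝔸.dualCoprod f) := by
  refine ev_ext fun a b => ?_
  have hid : (LinearMap.id : 𝔸.DualBar →ₗ[k] 𝔸.DualBar)
    = (LinearMap.id : 𝔸.augIdeal →ₗ[k] 𝔸.augIdeal).dualMap := rfl
  rw [ev_add, hid, dualD_eq, dualParity, ev_map, ev_map, ev_coprod, ev_coprod, ev_coprod,
    LinearMap.dualMap_apply, ← map_add]
  refine congrArg f (Subtype.ext ?_)
  simp only [LinearMap.comp_apply, LinearMap.id_apply, Submodule.coe_add, coe_barMul, coe_barD,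
    coe_barParity]
  rw [parity_mul _ 𝔸.mul_mem, 𝔸.d_mul, parity_parity, add_comm]

/-- The triple pairing. -/
noncomputable def ev₃ (a b c : 𝔸.augIdeal) (z : 𝔸.DualBar ⊗[k] (𝔸.DualBar ⊗[k] 𝔸.DualBar)) : k :=
  TensorProduct.dualDistrib k 𝔸.augIdeal (𝔸.augIdeal ⊗[k] 𝔸.augIdeal)
    (TensorProduct.map LinearMap.id (TensorProduct.dualDistrib k 𝔸.augIdeal 𝔸.augIdeal) z)
    (c ⊗ₜ (b ⊗ₜ a))

theorem ev₃_tmul (a b c : 𝔸.augIdeal) (f : 𝔸.DualBar) (z : 𝔸.DualBar ⊗[k] 𝔸.DualBar) :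
    ev₃ a b c (f ⊗ₜ z) = f c * ev a b z := rfl

theorem ev₃_add (a b c : 𝔸.augIdeal) (z w : 𝔸.DualBar ⊗[k] (𝔸.DualBar ⊗[k] 𝔸.DualBar)) :
    ev₃ a b c (z + w) = ev₃ a b c z + ev₃ a b c w := by
  simp [ev₃]

theorem ev₃_zero (a b c : 𝔸.augIdeal) :
    ev₃ a b c (0 : 𝔸.DualBar ⊗[k] (𝔸.DualBar ⊗[k] 𝔸.DualBar)) = 0 := by
  simp [ev₃]

theorem ev₃_ext [FiniteDimensional k A] {z w : 𝔸.DualBar ⊗[k] (𝔸.DualBar ⊗[k] 𝔸.DualBar)}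
    (h : ∀ a b c, ev₃ a b c z = ev₃ a b c w) : z = w := by
  have hinj : Function.Injective (TensorProduct.map (LinearMap.id : 𝔸.DualBar →ₗ[k] 𝔸.DualBar)
      (TensorProduct.dualDistrib k 𝔸.augIdeal 𝔸.augIdeal)) :=
    (TensorProduct.congr (LinearEquiv.refl k 𝔸.DualBar)
      (TensorProduct.dualDistribEquiv k 𝔸.augIdeal 𝔸.augIdeal)).injective
  have hinj₂ : Function.Injective
      (TensorProduct.dualDistrib k 𝔸.augIdeal (𝔸.augIdeal ⊗[k] 𝔸.augIdeal)) :=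
    (TensorProduct.dualDistribEquiv k 𝔸.augIdeal (𝔸.augIdeal ⊗[k] 𝔸.augIdeal)).injective
  refine hinj (hinj₂ (TensorProduct.ext ?_))
  refine LinearMap.ext fun c => TensorProduct.ext' fun b a => h a b c

theorem ev₃_right [FiniteDimensional k A] (a b c : 𝔸.augIdeal) (z : 𝔸.DualBar ⊗[k] 𝔸.DualBar) :
    ev₃ a b c (TensorProduct.map LinearMap.id 𝔸.dualCoprod z) = ev (𝔸.barMul a b) c z := by
  induction z using TensorProduct.induction_on with
  | zero => simp [ev_zero, ev₃_zero]
  | tmul f g => rw [TensorProduct.map_tmul, ev₃_tmul, ev_coprod, ev_tmul]; rfl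
  | add x y hx hy => rw [map_add, ev_add, ev₃_add, hx, hy]

theorem ev₃_assoc (a b c : 𝔸.augIdeal) (z : 𝔸.DualBar ⊗[k] 𝔸.DualBar) (h : 𝔸.DualBar) :
    ev₃ a b c (TensorProduct.assoc k _ _ _ (z ⊗ₜ h)) = ev b c z * h a := by
  induction z using TensorProduct.induction_on with
  | zero => simp [ev_zero, ev₃_zero]
  | tmul f g => rw [TensorProduct.assoc_tmul, ev₃_tmul, ev_tmul, ev_tmul, mul_assoc]
  | add x y hx hy => rw [TensorProduct.add_tmul, map_add, ev_add, ev₃_add, hx, hy, add_mul]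

theorem ev₃_left [FiniteDimensional k A] (a b c : 𝔸.augIdeal) (z : 𝔸.DualBar ⊗[k] 𝔸.DualBar) :
    ev₃ a b c (TensorProduct.assoc k _ _ _ (TensorProduct.map 𝔸.dualCoprod LinearMap.id z))
      = ev a (𝔸.barMul b c) z := by
  induction z using TensorProduct.induction_on with
  | zero => simp [ev_zero, ev₃_zero]
  | tmul f g => rw [TensorProduct.map_tmul, ev₃_assoc, ev_coprod, ev_tmul]; rfl
  | add x y hx hy => rw [map_add, map_add, ev_add, ev₃_add, hx, hy]

theorem coassoc [FiniteDimensional k A] (f : 𝔸.DualBar) :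
    TensorProduct.assoc k _ _ _ (TensorProduct.map 𝔸.dualCoprod LinearMap.id (𝔸.dualCoprod f))
      = TensorProduct.map LinearMap.id 𝔸.dualCoprod (𝔸.dualCoprod f) := by
  refine ev₃_ext fun a b c => ?_
  rw [ev₃_left, ev₃_right, ev_coprod, ev_coprod]
  exact congrArg f (Subtype.ext (mul_assoc _ _ _).symm)

end pairing

/-! ## The Koszul dual -/

variable [FiniteDimensional k A] (𝔸)

/-- The desuspension of the dual of the augmentation ideal as a graded `K`-bimodule: an element
of degree `i` is a linear form of degree `i + 1`, and `(x f y) a = f (y a x)`. -/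
noncomputable def desuspDual : GrBimod k (Fin t → k) 𝔸.DualBar where
  l := AlgHom.ofLinearMap
    (LinearMap.mk ⟨fun x => (𝔸.barR x).dualMap, fun x y => by
        ext f a
        exact (congrArg f (Subtype.ext (by simp [mul_add]))).trans (map_add f _ _)⟩
      (fun c x => by
        ext f a; exact (congrArg f (Subtype.ext (by simp))).trans (map_smul f c _)))
    (by ext f a; exact congrArg f (Subtype.ext (by simp)))
    (fun x y => by ext f a; exact congrArg f (Subtype.ext (by simp [mul_assoc])))
  r := AlgHom.ofLinearMap
    (LinearMap.mk ⟨fun x => (𝔸.barL x).dualMap, fun x y => by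
        ext f a
        exact (congrArg f (Subtype.ext (by simp [add_mul]))).trans (map_add f _ _)⟩
      (fun c x => by
        ext f a; exact (congrArg f (Subtype.ext (by simp))).trans (map_smul f c _)))
    (by ext f a; exact congrArg f (Subtype.ext (by simp)))
    (fun x y => by
      ext f a; exact congrArg f (Subtype.ext (by rw [mul_comm x y]; simp [mul_assoc])))
  l_r x y f := by
    ext a; exact congrArg f (Subtype.ext (by simp [mul_assoc]))
  gr i := 𝔸.dualGr (i + 1)
  isInternal := by
    have h := dual_isInternal (𝔸 := 𝔸)
    refine isInternal_of_proj (fun i => proj h (i + 1))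
      (fun i m hm => proj_self _ hm) (fun i j hij m hm => proj_ne _ (by omega) hm)
      (fun S hS m => graded_le h (fun i => ?_) m)
    simpa using hS (i - 1)
  l_mem i x f hf j hj a ha :=
    hf j hj _ (by simpa using 𝔸.mul_mem _ _ _ ha _ (𝔸.unit_mem x))
  r_mem i x f hf j hj a ha :=
    hf j hj _ (by simpa using 𝔸.mul_mem _ _ _ (𝔸.unit_mem x) _ ha)

theorem desuspDual_l (x : Fin t → k) : 𝔸.desuspDual.l x = (𝔸.barR x).dualMap := rfl

theorem desuspDual_r (x : Fin t → k) : 𝔸.desuspDual.r x = (𝔸.barL x).dualMap := rfl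

/-- The underlying algebra of the Koszul dual: the tensor ring over `K` of the desuspension of the
coaugmentation coideal of the dual coring. -/
abbrev KoszulDual := TensorRing 𝔸.desuspDual

/-- The inclusion `f ↦ ⟨f⟩` of the generators of the Koszul dual. -/
noncomputable abbrev bracket : 𝔸.DualBar →ₗ[k] 𝔸.KoszulDual := TensorRing.gen 𝔸.desuspDual

/-- The differential of the cobar construction on generators:
`⟨f⟩ ↦ - ⟨d f⟩ - ∑ (-1) ^ |f₁| ⟨f₁⟩ ⟨f₂⟩`, where `Δ f = ∑ f₁ ⊗ f₂`. -/
noncomputable def cobarD : 𝔸.DualBar →ₗ[k] 𝔸.KoszulDual :=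
  -(𝔸.bracket ∘ₗ 𝔸.dualD) - LinearMap.mul' k 𝔸.KoszulDual ∘ₗ
    TensorProduct.map (𝔸.bracket ∘ₗ 𝔸.dualParity) 𝔸.bracket ∘ₗ 𝔸.dualCoprod

variable {𝔸}

theorem cobarD_apply (f : 𝔸.DualBar) : 𝔸.cobarD f = -𝔸.bracket (𝔸.dualD f) -
    LinearMap.mul' k 𝔸.KoszulDual
      (TensorProduct.map (𝔸.bracket ∘ₗ 𝔸.dualParity) 𝔸.bracket (𝔸.dualCoprod f)) := rfl

theorem dualParity_l (x : Fin t → k) (f : 𝔸.DualBar) :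
    𝔸.dualParity (𝔸.desuspDual.l x f) = 𝔸.desuspDual.l x (𝔸.dualParity f) := by
  ext a
  refine congrArg f (Subtype.ext ?_)
  simp [parity_mul _ 𝔸.mul_mem, parity_unit]

theorem cobarD_l (x : Fin t → k) (f : 𝔸.DualBar) :
    𝔸.cobarD (𝔸.desuspDual.l x f) = TensorRing.coef 𝔸.desuspDual x * 𝔸.cobarD f := by
  have h1 : 𝔸.dualD (𝔸.desuspDual.l x f) = 𝔸.desuspDual.l x (𝔸.dualD f) := by
    ext a
    rw [dualD_apply, desuspDual_l, LinearMap.dualMap_apply, LinearMap.dualMap_apply, dualD_apply]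
    refine congrArg f (Subtype.ext ?_)
    simp [parity_mul _ 𝔸.mul_mem, parity_unit, 𝔸.d_mul, 𝔸.d_unit]
  have h2 : 𝔸.dualCoprod (𝔸.desuspDual.l x f)
      = TensorProduct.map (𝔸.desuspDual.l x) LinearMap.id (𝔸.dualCoprod f) := by
    refine ev_ext fun a b => ?_
    rw [desuspDual_l]
    refine Eq.trans ?_ (ev_map (𝔸.barR x) LinearMap.id a b _).symm
    rw [ev_coprod, ev_coprod]
    exact congrArg f (Subtype.ext (mul_assoc _ _ _))
  have h3 : ∀ z, LinearMap.mul' k 𝔸.KoszulDual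
      (TensorProduct.map (𝔸.bracket ∘ₗ 𝔸.dualParity) 𝔸.bracket
        (TensorProduct.map (𝔸.desuspDual.l x) LinearMap.id z)) =
      TensorRing.coef 𝔸.desuspDual x * LinearMap.mul' k 𝔸.KoszulDual
        (TensorProduct.map (𝔸.bracket ∘ₗ 𝔸.dualParity) 𝔸.bracket z) := by
    intro z
    induction z using TensorProduct.induction_on with
    | zero => simp
    | tmul f g =>
      simp only [TensorProduct.map_tmul, LinearMap.comp_apply, LinearMap.mul'_apply,
        LinearMap.id_apply]
      rw [dualParity_l, TensorRing.gen_l, mul_assoc]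
    | add z w hz hw => simp only [map_add, hz, hw, mul_add]
  rw [cobarD_apply, cobarD_apply, h1, h2, h3, TensorRing.gen_l, mul_sub, mul_neg]

theorem cobarD_r (x : Fin t → k) (f : 𝔸.DualBar) :
    𝔸.cobarD (𝔸.desuspDual.r x f) = 𝔸.cobarD f * TensorRing.coef 𝔸.desuspDual x := by
  have h1 : 𝔸.dualD (𝔸.desuspDual.r x f) = 𝔸.desuspDual.r x (𝔸.dualD f) := by
    ext a
    rw [dualD_apply, desuspDual_r, LinearMap.dualMap_apply, LinearMap.dualMap_apply, dualD_apply]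
    refine congrArg f (Subtype.ext ?_)
    simp [parity_mul _ 𝔸.mul_mem, parity_unit, 𝔸.d_mul, 𝔸.d_unit]
  have h2 : 𝔸.dualCoprod (𝔸.desuspDual.r x f)
      = TensorProduct.map LinearMap.id (𝔸.desuspDual.r x) (𝔸.dualCoprod f) := by
    refine ev_ext fun a b => ?_
    rw [desuspDual_r]
    refine Eq.trans ?_ (ev_map LinearMap.id (𝔸.barL x) a b _).symm
    rw [ev_coprod, ev_coprod]
    exact congrArg f (Subtype.ext (mul_assoc _ _ _).symm)
  have h3 : ∀ z, LinearMap.mul' k 𝔸.KoszulDual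
      (TensorProduct.map (𝔸.bracket ∘ₗ 𝔸.dualParity) 𝔸.bracket
        (TensorProduct.map LinearMap.id (𝔸.desuspDual.r x) z)) =
      LinearMap.mul' k 𝔸.KoszulDual
        (TensorProduct.map (𝔸.bracket ∘ₗ 𝔸.dualParity) 𝔸.bracket z) *
          TensorRing.coef 𝔸.desuspDual x := by
    intro z
    induction z using TensorProduct.induction_on with
    | zero => simp
    | tmul f g =>
      simp only [TensorProduct.map_tmul, LinearMap.comp_apply, LinearMap.mul'_apply,
        LinearMap.id_apply]
      rw [TensorRing.gen_r, mul_assoc]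
    | add z w hz hw => simp only [map_add, hz, hw, add_mul]
  rw [cobarD_apply, cobarD_apply, h1, h2, h3, TensorRing.gen_r, sub_mul, neg_mul]

theorem bracket_mem {i : ℤ} {f : 𝔸.DualBar} (hf : f ∈ 𝔸.dualGr i) :
    𝔸.bracket f ∈ TensorRing.gr 𝔸.desuspDual (i - 1) := by
  refine TensorRing.gen_mem (i - 1) f ?_
  change f ∈ 𝔸.dualGr (i - 1 + 1)
  rwa [sub_add_cancel]

theorem dualParity_mem {i : ℤ} {f : 𝔸.DualBar} (hf : f ∈ 𝔸.dualGr i) :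
    𝔸.dualParity f ∈ 𝔸.dualGr i := by
  rw [dualParity_apply hf]
  exact smul_mem_gr hf _

theorem cobarD_mem (i : ℤ) (f : 𝔸.DualBar) (hf : f ∈ 𝔸.desuspDual.gr i) :
    𝔸.cobarD f ∈ TensorRing.gr 𝔸.desuspDual (i - 1) := by
  change f ∈ 𝔸.dualGr (i + 1) at hf
  rw [cobarD_apply]
  refine sub_mem (neg_mem ?_) ?_
  · have := bracket_mem (dualD_mem hf)
    rwa [add_sub_cancel_right] at this
  · obtain ⟨s, hs⟩ := dual_eq_sum (𝔸 := 𝔸)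
    have hz : ∀ z : 𝔸.DualBar ⊗[k] 𝔸.DualBar, z = ∑ p ∈ s, ∑ q ∈ s,
        TensorProduct.map (𝔸.barProj (-p)).dualMap (𝔸.barProj (-q)).dualMap z := by
      intro z
      induction z using TensorProduct.induction_on with
      | zero => simp
      | tmul f g =>
        simp only [TensorProduct.map_tmul, ← TensorProduct.tmul_sum, ← TensorProduct.sum_tmul, hs]
      | add z w hz hw => simp only [map_add, Finset.sum_add_distrib, ← hz, ← hw]
    rw [hz (𝔸.dualCoprod f)]
    simp only [map_sum]
    refine sum_mem fun p _ => sum_mem fun q _ => ?_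
    by_cases hpq : p + q = i + 1
    · have : ∀ z, LinearMap.mul' k 𝔸.KoszulDual
        (TensorProduct.map (𝔸.bracket ∘ₗ 𝔸.dualParity) 𝔸.bracket
          (TensorProduct.map (𝔸.barProj (-p)).dualMap (𝔸.barProj (-q)).dualMap z)) ∈
          TensorRing.gr 𝔸.desuspDual (i - 1) := by
        intro z
        induction z using TensorProduct.induction_on with
        | zero => simp
        | tmul f g =>
          have := TensorRing.gr_mul_mem _ _ _ (bracket_mem (dualParity_mem (dualProj_mem p f)))
            _ (bracket_mem (dualProj_mem q g))
          rwa [show p - 1 + (q - 1) = i - 1 by omega] at this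
        | add z w hz hw => simp only [map_add]; exact add_mem hz hw
      exact this _
    · have : TensorProduct.map (𝔸.barProj (-p)).dualMap (𝔸.barProj (-q)).dualMap (𝔸.dualCoprod f)
          = 0 := by
        refine ev_ext fun a b => ?_
        rw [ev_map, ev_coprod, ev_zero]
        exact hf (-q + -p) (by omega) _
          (𝔸.mul_mem _ _ _ (𝔸.proj_mem (-q) _) _ (𝔸.proj_mem (-p) _))
      rw [this, map_zero, map_zero]
      exact zero_mem _

theorem parity_bracket (f : 𝔸.DualBar) :
    parity (TensorRing.gr_isInternal (β := 𝔸.desuspDual)) (𝔸.bracket f) = -𝔸.bracket (𝔸.dualParity f) := by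
  refine graded_ext (dual_isInternal (𝔸 := 𝔸))
    (f := parity (TensorRing.gr_isInternal (β := 𝔸.desuspDual)) ∘ₗ 𝔸.bracket)
    (g := -(𝔸.bracket ∘ₗ 𝔸.dualParity)) (fun i f hf => ?_) f
  simp only [LinearMap.comp_apply, LinearMap.neg_apply]
  rw [parity_apply _ (bracket_mem hf), dualParity_apply hf, map_units_smul, Int.negOnePow_sub,
    Int.negOnePow_one]
  simp

theorem cobarD_cobarD (f : 𝔸.DualBar) :
    TensorRing.deriv 𝔸.desuspDual 𝔸.cobarD cobarD_l cobarD_r (𝔸.cobarD f) = 0 := by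
  set D := TensorRing.deriv 𝔸.desuspDual 𝔸.cobarD cobarD_l cobarD_r with hD
  have hgen : ∀ g, D (𝔸.bracket g) = 𝔸.cobarD g := fun g => TensorRing.deriv_gen g
  have hD2 : ∀ z, D (LinearMap.mul' k 𝔸.KoszulDual
        (TensorProduct.map (𝔸.bracket ∘ₗ 𝔸.dualParity) 𝔸.bracket z))
      = LinearMap.mul' k 𝔸.KoszulDual
          (TensorProduct.map (𝔸.cobarD ∘ₗ 𝔸.dualParity) 𝔸.bracket z)
        - LinearMap.mul' k 𝔸.KoszulDual (TensorProduct.map 𝔸.bracket 𝔸.cobarD z) := by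
    intro z
    induction z using TensorProduct.induction_on with
    | zero => simp
    | tmul f g =>
      simp only [TensorProduct.map_tmul, LinearMap.comp_apply, LinearMap.mul'_apply]
      rw [hD, TensorRing.deriv_mul, ← hD, hgen, hgen, parity_bracket, dualParity_dualParity,
        neg_mul, sub_eq_add_neg]
    | add z w hz hw => simp only [map_add, hz, hw]; abel
  let τ : 𝔸.DualBar ⊗[k] (𝔸.DualBar ⊗[k] 𝔸.DualBar) →ₗ[k] 𝔸.KoszulDual :=
    LinearMap.mul' k 𝔸.KoszulDual ∘ₗ TensorProduct.map 𝔸.bracket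
      (LinearMap.mul' k 𝔸.KoszulDual ∘ₗ
        TensorProduct.map (𝔸.bracket ∘ₗ 𝔸.dualParity) 𝔸.bracket)
  have hτ : ∀ z h, τ (TensorProduct.assoc k _ _ _ (z ⊗ₜ h)) = LinearMap.mul' k 𝔸.KoszulDual
      (TensorProduct.map 𝔸.bracket (𝔸.bracket ∘ₗ 𝔸.dualParity) z) * 𝔸.bracket h := by
    intro z h
    induction z using TensorProduct.induction_on with
    | zero => simp
    | tmul f g =>
      change 𝔸.bracket f * (𝔸.bracket (𝔸.dualParity g) * 𝔸.bracket h)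
        = 𝔸.bracket f * 𝔸.bracket (𝔸.dualParity g) * 𝔸.bracket h
      rw [mul_assoc]
    | add z w hz hw => rw [TensorProduct.add_tmul, map_add, map_add, hz, hw, map_add, map_add, add_mul]
  have hσ : ∀ g, 𝔸.cobarD (𝔸.dualParity g) = 𝔸.bracket (𝔸.dualParity (𝔸.dualD g)) -
      LinearMap.mul' k 𝔸.KoszulDual
        (TensorProduct.map 𝔸.bracket (𝔸.bracket ∘ₗ 𝔸.dualParity) (𝔸.dualCoprod g)) := by
    intro g
    have : ∀ z, TensorProduct.map (𝔸.bracket ∘ₗ 𝔸.dualParity) 𝔸.bracket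
        (TensorProduct.map 𝔸.dualParity 𝔸.dualParity z)
        = TensorProduct.map 𝔸.bracket (𝔸.bracket ∘ₗ 𝔸.dualParity) z := by
      intro z
      induction z using TensorProduct.induction_on with
      | zero => simp
      | tmul f g =>
        simp only [TensorProduct.map_tmul, LinearMap.comp_apply, dualParity_dualParity]
      | add z w hz hw => simp only [map_add, hz, hw]
    rw [cobarD_apply, dualD_dualParity, map_neg, neg_neg, coprod_parity, this]
  have hA : ∀ z, LinearMap.mul' k 𝔸.KoszulDual
      (TensorProduct.map (𝔸.cobarD ∘ₗ 𝔸.dualParity) 𝔸.bracket z) =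
      LinearMap.mul' k 𝔸.KoszulDual (TensorProduct.map (𝔸.bracket ∘ₗ 𝔸.dualParity) 𝔸.bracket
        (TensorProduct.map 𝔸.dualD LinearMap.id z)) -
      τ (TensorProduct.assoc k _ _ _ (TensorProduct.map 𝔸.dualCoprod LinearMap.id z)) := by
    intro z
    induction z using TensorProduct.induction_on with
    | zero => simp
    | tmul f g =>
      rw [TensorProduct.map_tmul, TensorProduct.map_tmul, TensorProduct.map_tmul,
        TensorProduct.map_tmul, hτ, LinearMap.mul'_apply, LinearMap.mul'_apply,
        LinearMap.comp_apply, hσ, sub_mul]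
      rfl
    | add z w hz hw => simp only [map_add, hz, hw]; abel
  have hB : ∀ z, LinearMap.mul' k 𝔸.KoszulDual (TensorProduct.map 𝔸.bracket 𝔸.cobarD z) =
      -LinearMap.mul' k 𝔸.KoszulDual (TensorProduct.map (𝔸.bracket ∘ₗ 𝔸.dualParity) 𝔸.bracket
        (TensorProduct.map 𝔸.dualParity 𝔸.dualD z)) -
      τ (TensorProduct.map LinearMap.id 𝔸.dualCoprod z) := by
    intro z
    induction z using TensorProduct.induction_on with
    | zero => simp
    | tmul f g =>
      have : τ (f ⊗ₜ 𝔸.dualCoprod g) = 𝔸.bracket f * LinearMap.mul' k 𝔸.KoszulDual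
        (TensorProduct.map (𝔸.bracket ∘ₗ 𝔸.dualParity) 𝔸.bracket (𝔸.dualCoprod g)) := rfl
      rw [TensorProduct.map_tmul, TensorProduct.map_tmul, TensorProduct.map_tmul,
        TensorProduct.map_tmul, LinearMap.id_apply, this, LinearMap.mul'_apply,
        LinearMap.mul'_apply, LinearMap.comp_apply, dualParity_dualParity, cobarD_apply, mul_sub,
        mul_neg]
    | add z w hz hw => simp only [map_add, hz, hw]; abel
  rw [cobarD_apply, map_sub, map_neg, hgen, cobarD_apply, dualD_dualD, hD2, hA, hB, coassoc,
    coprod_d]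
  simp only [map_add, map_zero]
  abel

end

/-- The Koszul dual of a finite dimensional augmented dg `K`-ring `A`: the cobar construction of the
dual coring of `A`, as a dg algebra. -/
noncomputable def koszulDual [FiniteDimensional k A] (𝔸 : AugDGKRing k t A) :
    DGAlgStr k 𝔸.KoszulDual :=
  TensorRing.dgAlgStr 𝔸.desuspDual 𝔸.cobarD cobarD_l cobarD_r cobarD_mem cobarD_cobarD

end AugDGKRing

end DG

/-! Write `Ω = T_K(V)`, where `V` is the desuspended dual of the augmentation ideal `I` of `A`. If
differentials are ignored, `0 → Ω ⊗_K V ⊗_K Ω → Ω ⊗_K Ω → Ω → 0` is a finite projective resolution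
of `Ω` over bimodules, because `V` is finite dimensional and `K` is separable. The proof builds the
same resolution one generator at a time, in an order that respects the differential.

For a dg subalgebra `S` of `Ω`, let `relKer S` be the kernel of `Ω ⊗_k Ω → Ω ⊗_S Ω`, a dg
subbimodule of the free bimodule. For `S = Ω` it is the kernel of the product, so `Ω` is perfect as
soon as `relKer Ω` is (`isShortExact_relKer_top`). For `S = K` it is generated by the idempotent `1
⊗ 1 - ∑ e_i ⊗ e_i`, hence is a direct summand of the free bimodule (`exists_isCell_relKer_adjoin`).

Between these extremes, let `S` be generated by `K` and a subspace `U` of `V`, and adjoin one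
homogeneous `f` in `e_i V e_j` with `d⟨f⟩ ∈ S`, giving `T`. Then `relKer T / relKer S` is generated
by the class of `⟨f⟩ ⊗ 1 - 1 ⊗ ⟨f⟩`, which is a cycle, and it is a shifted copy of the summand `Ω
e_i ⊗ e_j Ω` of the free bimodule. The absence of further relations is seen from the derivation `Ω →
Ω ⊗ Ω` that kills `S` and sends `⟨f⟩` to `e_i ⊗ e_j`; it exists because `Ω` is a tensor ring
(`exists_isCell_relKer`, `IsSubcoring.exists_isCell`).

Completeness ensures that a suitable `f` exists whenever `U ≠ V` (`IsComplete.exists_notMem`). Since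
`I` is nilpotent, `V` is exhausted by the forms vanishing on `I ^ (n + 1)`, and the reduced
coproduct of a form in one layer involves only the preceding layer. The linear part of the
differential is handled by replacing `f` with `d f` if `d f` is not yet in `U`. As `V` is finite
dimensional, a maximal `U` with `relKer` in the given thick subcategory exists, and it must be all
of `V`. -/

namespace DG

/-! ### Homogeneous subspaces of graded vector spaces. -/

section Homogeneous

variable {k : Type u} [Field k] {M : Type v} [AddCommGroup M] [Module k M]
  {N : Type w} [AddCommGroup N] [Module k N] {gr : ℤ → Submodule k M} {gr' : ℤ → Submodule k N}

/-- A subspace of a graded vector space is homogeneous if it is spanned by homogeneous elements. -/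
def IsHomogeneous (gr : ℤ → Submodule k M) (S : Submodule k M) : Prop := S ≤ ⨆ i, S ⊓ gr i

theorem IsHomogeneous.proj_mem {S : Submodule k M} (hS : IsHomogeneous gr S)
    (h : DirectSum.IsInternal gr) (i : ℤ) {m : M} (hm : m ∈ S) : proj h i m ∈ S := by
  refine (iSup_le fun j y hy => ?_ : _ ≤ S.comap (proj h i)) (hS hm)
  rw [Submodule.mem_comap]
  by_cases hij : j = i
  · subst hij
    rw [proj_self h hy.2]
    exact hy.1
  · rw [proj_ne h hij hy.2]
    exact zero_mem _

theorem IsHomogeneous.parity_mem {S : Submodule k M} (hS : IsHomogeneous gr S)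
    (h : DirectSum.IsInternal gr) {m : M} (hm : m ∈ S) : parity h m ∈ S := by
  refine (iSup_le fun j y hy => ?_ : _ ≤ S.comap (parity h)) (hS hm)
  rw [Submodule.mem_comap, parity_apply h hy.2]
  rcases Int.units_eq_one_or j.negOnePow with e | e <;> simpa [e] using hy.1

theorem proj_mem_gr (h : DirectSum.IsInternal gr) (i : ℤ) (m : M) : proj h i m ∈ gr i := by
  refine graded_le h (S := (gr i).comap (proj h i)) (fun j a ha => ?_) m
  rw [Submodule.mem_comap]
  by_cases hij : j = i
  · subst hij
    rwa [proj_self h ha]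
  · rw [proj_ne h hij ha]
    exact zero_mem _

theorem proj_comm (h : DirectSum.IsInternal gr) (h' : DirectSum.IsInternal gr') (f : M →ₗ[k] N)
    (hf : ∀ i, ∀ m ∈ gr i, f m ∈ gr' i) (i : ℤ) (m : M) : f (proj h i m) = proj h' i (f m) := by
  refine graded_ext h (f := f ∘ₗ proj h i) (g := proj h' i ∘ₗ f) (fun j a ha => ?_) m
  rw [LinearMap.comp_apply, LinearMap.comp_apply]
  by_cases hij : j = i
  · subst hij
    rw [proj_self h ha, proj_self h' (hf _ _ ha)]
  · rw [proj_ne h hij ha, proj_ne h' hij (hf _ _ ha), map_zero]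

theorem isHomogeneous_span {s : Set M} (hs : ∀ x ∈ s, x ∈ ⨆ i, Submodule.span k s ⊓ gr i) :
    IsHomogeneous gr (Submodule.span k s) :=
  Submodule.span_le.2 hs

theorem IsHomogeneous.sup {S T : Submodule k M} (hS : IsHomogeneous gr S)
    (hT : IsHomogeneous gr T) : IsHomogeneous gr (S ⊔ T) :=
  sup_le (hS.trans (iSup_mono fun _ => inf_le_inf_right _ le_sup_left))
    (hT.trans (iSup_mono fun _ => inf_le_inf_right _ le_sup_right))

end Homogeneous

namespace DGBimod

variable {k : Type u} {A : Type v} [Field k] [Ring A] [Algebra k A] {𝔸 : DGAlgStr k A}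

/-! ### Dg subbimodules and quotients -/

/-- Dg subbimodules. -/
structure IsSub (M : DGBimod 𝔸) (S : Submodule k M.carrier) : Prop where
  l_mem : ∀ a, ∀ m ∈ S, M.l a m ∈ S
  r_mem : ∀ a, ∀ m ∈ S, M.r a m ∈ S
  d_mem : ∀ m ∈ S, M.d m ∈ S
  homogeneous : IsHomogeneous M.gr S

/-- A dg subbimodule as a dg bimodule. -/
noncomputable def sub (M : DGBimod 𝔸) (S : Submodule k M.carrier) (hS : M.IsSub S) : DGBimod 𝔸 where
  carrier := S
  l := LinearMap.mk₂ k (fun a m => ⟨M.l a m, hS.l_mem a m m.2⟩)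
    (fun a b m => Subtype.ext (by simp)) (fun c a m => Subtype.ext (by simp))
    (fun a m n => Subtype.ext (by simp)) (fun c a m => Subtype.ext (by simp))
  r := LinearMap.mk₂ k (fun a m => ⟨M.r a m, hS.r_mem a m m.2⟩)
    (fun a b m => Subtype.ext (by simp)) (fun c a m => Subtype.ext (by simp))
    (fun a m n => Subtype.ext (by simp)) (fun c a m => Subtype.ext (by simp))
  l_one m := Subtype.ext (M.l_one m)
  l_mul a b m := Subtype.ext (M.l_mul a b m)
  r_one m := Subtype.ext (M.r_one m)
  r_mul a b m := Subtype.ext (M.r_mul a b m)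
  l_r a b m := Subtype.ext (M.l_r a b m)
  gr i := (M.gr i).comap S.subtype
  isInternal := by
    refine isInternal_of_proj
      (fun i => (proj M.isInternal i).restrict fun m hm => hS.homogeneous.proj_mem M.isInternal i hm)
      (fun i m hm => Subtype.ext (proj_self _ hm))
      (fun i j hij m hm => Subtype.ext (proj_ne _ hij hm)) (fun T hT m => ?_)
    have hle : (⨆ i, S ⊓ M.gr i) ≤ T.map S.subtype :=
      iSup_le fun i y hy => ⟨⟨y, hy.1⟩, hT i hy.2, rfl⟩
    obtain ⟨m', hm', h⟩ := hle (hS.homogeneous m.2)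
    rwa [← Subtype.ext h]
  l_mem i j a ha m hm := M.l_mem i j a ha m hm
  r_mem i j m hm b hb := M.r_mem i j m hm b hb
  d := M.d.restrict hS.d_mem
  d_mem i m hm := M.d_mem i m hm
  d_d m := Subtype.ext (M.d_d m)
  d_l i a ha m := Subtype.ext <| (M.d_l i a ha m).trans <| congrArg (M.l (𝔸.d a) m + ·)
    (map_units_smul S.subtype i.negOnePow ⟨M.l a (M.d m), hS.l_mem a _ (hS.d_mem m m.2)⟩).symm
  d_r i m hm b := Subtype.ext <| (M.d_r i m hm b).trans <| congrArg (M.r b (M.d m) + ·)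
    (map_units_smul S.subtype i.negOnePow ⟨M.r (𝔸.d b) m, hS.r_mem (𝔸.d b) _ m.2⟩).symm

/-- The quotient by a dg subbimodule. -/
noncomputable def quot (M : DGBimod 𝔸) (S : Submodule k M.carrier) (hS : M.IsSub S) :
    DGBimod 𝔸 where
  carrier := M.carrier ⧸ S
  l := LinearMap.mk ⟨fun a => S.mapQ S (M.l a) (hS.l_mem a),
      fun a b => Submodule.linearMap_qext _ (by ext; simp)⟩
    (fun c a => Submodule.linearMap_qext _ (by ext; simp))
  r := LinearMap.mk ⟨fun a => S.mapQ S (M.r a) (hS.r_mem a),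
      fun a b => Submodule.linearMap_qext _ (by ext; simp)⟩
    (fun c a => Submodule.linearMap_qext _ (by ext; simp))
  l_one := S.mkQ_surjective.forall.2 fun m => congrArg S.mkQ (M.l_one m)
  l_mul a b := S.mkQ_surjective.forall.2 fun m => congrArg S.mkQ (M.l_mul a b m)
  r_one := S.mkQ_surjective.forall.2 fun m => congrArg S.mkQ (M.r_one m)
  r_mul a b := S.mkQ_surjective.forall.2 fun m => congrArg S.mkQ (M.r_mul a b m)
  l_r a b := S.mkQ_surjective.forall.2 fun m => congrArg S.mkQ (M.l_r a b m)
  gr i := (M.gr i).map S.mkQ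
  isInternal := by
    refine isInternal_of_proj (fun i => S.mapQ S (proj M.isInternal i)
      fun m hm => hS.homogeneous.proj_mem M.isInternal i hm) ?_ ?_ (fun T hT => ?_)
    · rintro i _ ⟨m, hm, rfl⟩
      exact congrArg S.mkQ (proj_self _ hm)
    · rintro i j hij _ ⟨m, hm, rfl⟩
      exact (congrArg S.mkQ (proj_ne _ hij hm)).trans (map_zero _)
    · refine S.mkQ_surjective.forall.2 fun m => ?_
      exact graded_le M.isInternal (S := T.comap S.mkQ) (fun i m hm => hT i ⟨m, hm, rfl⟩) m
  l_mem i j a ha := by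
    rintro _ ⟨m, hm, rfl⟩
    exact ⟨_, M.l_mem i j a ha m hm, rfl⟩
  r_mem i j := by
    rintro _ ⟨m, hm, rfl⟩ b hb
    exact ⟨_, M.r_mem i j m hm b hb, rfl⟩
  d := S.mapQ S M.d hS.d_mem
  d_mem i := by
    rintro _ ⟨m, hm, rfl⟩
    exact ⟨_, M.d_mem i m hm, rfl⟩
  d_d := S.mkQ_surjective.forall.2 fun m => congrArg S.mkQ (M.d_d m)
  d_l i a ha := S.mkQ_surjective.forall.2 fun m =>
    (congrArg S.mkQ (M.d_l i a ha m)).trans (by rw [map_add, map_units_smul]; rfl)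
  d_r i := by
    rintro _ ⟨m, hm, rfl⟩ b
    exact (congrArg S.mkQ (M.d_r i m hm b)).trans (by rw [map_add, map_units_smul]; rfl)

/-- The inclusion of a dg subbimodule. -/
noncomputable def subι (M : DGBimod 𝔸) (S : Submodule k M.carrier) (hS : M.IsSub S) :
    M.sub S hS ⟶ M :=
  Hom.mk S.subtype (fun _ _ => rfl) (fun _ _ => rfl) (fun _ _ h => h) (fun _ => rfl)

/-- The inclusion of a dg subbimodule into a larger one. -/
noncomputable def subLE (M : DGBimod 𝔸) {S T : Submodule k M.carrier} (hS : M.IsSub S)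
    (hT : M.IsSub T) (h : S ≤ T) : M.sub S hS ⟶ M.sub T hT :=
  Hom.mk (Submodule.inclusion h) (fun _ _ => rfl) (fun _ _ => rfl) (fun _ _ h => h) (fun _ => rfl)

/-- The projection onto a quotient. -/
noncomputable def quotπ (M : DGBimod 𝔸) (S : Submodule k M.carrier) (hS : M.IsSub S) :
    M ⟶ M.quot S hS :=
  Hom.mk S.mkQ (fun _ _ => rfl) (fun _ _ => rfl) (fun _ m h => ⟨m, h, rfl⟩) (fun _ => rfl)

/-- Allows the subquotient `T / S` to be formed as a quotient of `M.sub T`. -/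
theorem IsSub.comap {M : DGBimod 𝔸} {S T : Submodule k M.carrier} (hS : M.IsSub S)
    (hT : M.IsSub T) (h : S ≤ T) : (M.sub T hT).IsSub (S.comap T.subtype) where
  l_mem a m hm := hS.l_mem a _ hm
  r_mem a m hm := hS.r_mem a _ hm
  d_mem m hm := hS.d_mem _ hm
  homogeneous m hm := by
    have hle : (⨆ i, S ⊓ M.gr i) ≤ Submodule.map T.subtype
        (⨆ i, (S.comap T.subtype) ⊓ (M.sub T hT).gr i) :=
      iSup_le fun i y hy => ⟨⟨y, h hy.1⟩, Submodule.mem_iSup_of_mem i ⟨hy.1, hy.2⟩, rfl⟩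
    obtain ⟨m', hm', e⟩ := hle (hS.homogeneous hm)
    rwa [← Subtype.ext e]

/-! ### Short exact sequences -/

/-- Short exact sequences of dg bimodules. -/
structure IsShortExact {M N Q : DGBimod 𝔸} (F : M ⟶ N) (G : N ⟶ Q) : Prop where
  injective : Function.Injective F.f
  surjective : Function.Surjective G.f
  comp_zero : ∀ m, G.f (F.f m) = 0
  exact : ∀ n, G.f n = 0 → ∃ m, F.f m = n

variable {M N Q : DGBimod 𝔸}

/-- The map from the cone of a morphism to its cokernel. -/
noncomputable def coneDesc (F : M ⟶ N) (G : N ⟶ Q) (h : ∀ m, G.f (F.f m) = 0) : cone F ⟶ Q :=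
  Hom.mk (G.f ∘ₗ LinearMap.fst k _ _) (fun a x => G.map_l a x.1) (fun a x => G.map_r a x.1)
    (fun i x hx => G.map_mem i _ hx.1) (fun x => by
      change G.f (N.d x.1 + F.f x.2) = _
      rw [map_add, h, add_zero, G.map_d]
      rfl)

/-- The map from the shifted kernel of a morphism to its cone. -/
noncomputable def coneLift (F : M ⟶ N) (G : N ⟶ Q) (h : ∀ m, G.f (F.f m) = 0) :
    M.shift ⟶ cone G :=
  Hom.mk (LinearMap.inr k _ _ ∘ₗ F.f)
    (fun a m => Prod.ext (map_zero (Q.l a)).symm (F.map_l _ m))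
    (fun a m => Prod.ext (map_zero (Q.r a)).symm (F.map_r _ m))
    (fun i m hm => ⟨zero_mem _, F.map_mem _ _ hm⟩) (fun (m : M.carrier) => by
      refine Prod.ext ?_ ?_
      · change 0 = Q.d 0 + G.f (F.f m)
        rw [h, map_zero, add_zero]
      · change F.f (-M.d m) = -N.d (F.f m)
        rw [map_neg, F.map_d])

/-- The projection of a cone. -/
noncomputable def coneSnd (F : M ⟶ N) : cone F ⟶ M.shift :=
  Hom.mk (LinearMap.snd k N.carrier M.carrier) (fun _ _ => rfl) (fun _ _ => rfl) (fun _ _ h => h.2) (fun _ => rfl)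

/-- The inclusion into a cone. -/
noncomputable def coneInl (F : M ⟶ N) : N ⟶ cone F :=
  Hom.mk (LinearMap.inl k _ _)
    (fun a n => Prod.ext rfl (map_zero (M.l _)).symm)
    (fun a n => Prod.ext rfl (map_zero (M.r a)).symm)
    (fun _ _ h => ⟨h, zero_mem _⟩) (fun n => by
      refine Prod.ext ?_ ?_
      · change N.d n = N.d n + F.f 0
        rw [map_zero, add_zero]
      · change 0 = -M.d 0
        rw [map_zero, neg_zero])

/-- This rotates a triangle: it recovers `N` from the cone of `F` and the suspension of `M`. -/
theorem isShortExact_cone (F : M ⟶ N) : IsShortExact (coneInl F) (coneSnd F) where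
  injective _ _ h := congrArg Prod.fst h
  surjective m := ⟨(0, m), rfl⟩
  comp_zero _ := rfl
  exact x hx := ⟨x.1, Prod.ext rfl (Eq.symm hx)⟩

/-- A diagram chase. If `G n = d q`, lift `q` to `n'`; then `n - d n'` comes from some `m'`, and
`(n', m')` bounds the given cycle. A cycle `q` lifts to some `n` with `d n = F m`, and `(n, -m)` is
a cycle above it. -/
theorem quasiIso_coneDesc {F : M ⟶ N} {G : N ⟶ Q} (h : IsShortExact F G) :
    quasiIso 𝔸 (coneDesc F G h.comp_zero) := by
  constructor
  · rintro ⟨n, m⟩ hd ⟨q, hq⟩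
    have h1 : N.d n + F.f m = 0 := congrArg Prod.fst hd
    change G.f n = Q.d q at hq
    obtain ⟨n', rfl⟩ := h.surjective q
    obtain ⟨m', hm'⟩ := h.exact (n - N.d n') (by rw [map_sub, hq, G.map_d, sub_self])
    refine ⟨(n', m'), Prod.ext ?_ ?_⟩
    · change n = N.d n' + F.f m'
      rw [hm', add_sub_cancel]
    · change m = -M.d m'
      apply h.injective
      rw [map_neg, F.map_d, hm', map_sub, N.d_d, sub_zero]
      exact eq_neg_of_add_eq_zero_right h1
  · intro q hq
    obtain ⟨n, rfl⟩ := h.surjective q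
    obtain ⟨m, hm⟩ := h.exact (N.d n) (by rw [G.map_d, hq])
    refine ⟨(n, -m), Prod.ext ?_ ?_, 0, ?_⟩
    · change N.d n + F.f (-m) = 0
      rw [map_neg, hm, add_neg_cancel]
    · change -M.d (-m) = 0
      apply h.injective
      rw [map_neg, map_neg, map_neg, neg_neg, F.map_d, hm, N.d_d, map_zero]
    · change G.f n = G.f n + Q.d 0
      rw [map_zero, add_zero]

/-- The dual chase: for a cycle `(q, n)` of the cone of `G`, lift `q` to `n'`; then `d n' + n` lies
in the image of `F`, and subtracting the boundary of `(0, n')` moves the cycle into that image. -/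
theorem quasiIso_coneLift {F : M ⟶ N} {G : N ⟶ Q} (h : IsShortExact F G) :
    quasiIso 𝔸 (coneLift F G h.comp_zero) := by
  constructor
  · rintro m - ⟨⟨q, n⟩, hqn⟩
    have h1 : 0 = Q.d q + G.f n := congrArg Prod.fst hqn
    have h2 : F.f m = -N.d n := congrArg Prod.snd hqn
    obtain ⟨n', rfl⟩ := h.surjective q
    obtain ⟨m', hm'⟩ := h.exact (N.d n' + n) (by rw [map_add, G.map_d, ← h1])
    refine ⟨m', ?_⟩
    change m = -M.d m'
    apply h.injective
    rw [map_neg, F.map_d, hm', map_add, N.d_d, zero_add, h2]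
  · rintro ⟨q, n⟩ hqn
    have h1 : Q.d q + G.f n = 0 := congrArg Prod.fst hqn
    have h2 : N.d n = 0 := neg_eq_zero.1 (congrArg Prod.snd hqn)
    obtain ⟨n', rfl⟩ := h.surjective q
    obtain ⟨m, hm⟩ := h.exact (N.d n' + n) (by rw [map_add, G.map_d, ← h1])
    refine ⟨m, ?_, (0, n'), Prod.ext ?_ ?_⟩
    · change -M.d m = 0
      apply h.injective
      rw [map_neg, F.map_d, hm, map_add, N.d_d, h2, add_zero, neg_zero, map_zero]
    · change G.f n' = 0 + (Q.d 0 + G.f n')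
      rw [map_zero, zero_add, zero_add]
    · change n = F.f m + -N.d n'
      rw [hm]
      abel

end DGBimod

/-! ### Thick subcategories -/

namespace IsThick

open DGBimod

variable {k : Type u} {A : Type v} [Field k] [Ring A] [Algebra k A] {𝔸 : DGAlgStr k A}
  {P : ObjectProperty (DerivedCat 𝔸)} {M N Q : DGBimod 𝔸}

theorem of_retract (hP : IsThick P) (e : Retract M N) (hN : P (toDerived N)) :
    P (toDerived M) :=
  hP.retract (e.map (quasiIso 𝔸).Q) hN

theorem of_iso (hP : IsThick P) (e : M ≅ N) (hN : P (toDerived N)) : P (toDerived M) :=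
  hP.of_retract (Retract.ofIso e) hN

theorem iff_of_quasiIso (hP : IsThick P) {F : M ⟶ N} (hF : quasiIso 𝔸 F) :
    P (toDerived M) ↔ P (toDerived N) :=
  ⟨hP.retract (Retract.ofIso (Localization.Construction.wIso F hF).symm),
    hP.retract (Retract.ofIso (Localization.Construction.wIso F hF))⟩

/-- The cokernel of an injection is quasi-isomorphic to its cone. With `left` and `middle` this
gives the two-out-of-three property for short exact sequences of dg bimodules, so that no
triangulated structure has to be invoked. -/
theorem right (hP : IsThick P) {F : M ⟶ N} {G : N ⟶ Q} (h : IsShortExact F G)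
    (hM : P (toDerived M)) (hN : P (toDerived N)) : P (toDerived Q) :=
  (hP.iff_of_quasiIso (quasiIso_coneDesc h)).1 (hP.cone F hM hN)

theorem left (hP : IsThick P) {F : M ⟶ N} {G : N ⟶ Q} (h : IsShortExact F G)
    (hN : P (toDerived N)) (hQ : P (toDerived Q)) : P (toDerived M) :=
  (hP.shift M).1 ((hP.iff_of_quasiIso (quasiIso_coneLift h)).2 (hP.cone G hN hQ))

theorem middle (hP : IsThick P) {F : M ⟶ N} {G : N ⟶ Q} (h : IsShortExact F G)
    (hM : P (toDerived M)) (hQ : P (toDerived Q)) : P (toDerived N) :=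
  hP.left (isShortExact_cone F) ((hP.iff_of_quasiIso (quasiIso_coneDesc h)).2 hQ)
    ((hP.shift M).2 hM)

/-- Extensions of a dg subbimodule by a subquotient. -/
theorem of_sub_quot (hP : IsThick P) {S T : Submodule k M.carrier} (hS : M.IsSub S)
    (hT : M.IsSub T) (h : S ≤ T) (h1 : P (toDerived (M.sub S hS)))
    (h2 : P (toDerived ((M.sub T hT).quot _ (hS.comap hT h)))) : P (toDerived (M.sub T hT)) := by
  refine hP.middle (F := subLE M hS hT h) (G := quotπ (M.sub T hT) _ (hS.comap hT h)) ?_ h1 h2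
  constructor
  · exact Submodule.inclusion_injective h
  · exact Submodule.mkQ_surjective _
  · intro m
    exact (Submodule.Quotient.mk_eq_zero (S.comap T.subtype)).2 m.2
  · intro n hn
    exact ⟨⟨n.1, (Submodule.Quotient.mk_eq_zero (S.comap T.subtype)).1 hn⟩, rfl⟩

end IsThick

end DG

namespace DG

namespace DGBimod

variable {k : Type u} {A : Type v} [Field k] [Ring A] [Algebra k A] {𝔸 : DGAlgStr k A}

/-! ### Shifted summands of the free bimodule -/

/-- The pure tensors in the free bimodule. -/
noncomputable def tmul (𝔸 : DGAlgStr k A) : A →ₗ[k] A →ₗ[k] (free 𝔸).carrier :=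
  TensorProduct.mk k A A

theorem free_l (a b c : A) : (free 𝔸).l a (tmul 𝔸 b c) = tmul 𝔸 (a * b) c := rfl

theorem free_r (a b c : A) : (free 𝔸).r a (tmul 𝔸 b c) = tmul 𝔸 b (c * a) := rfl

theorem free_d (a b : A) : (free 𝔸).d (tmul 𝔸 a b)
    = tmul 𝔸 (𝔸.d a) b + tmul 𝔸 (parity 𝔸.isInternal a) (𝔸.d b) := rfl

theorem tmul_mem {i j : ℤ} {a b : A} (ha : a ∈ 𝔸.gr i) (hb : b ∈ 𝔸.gr j) :
    tmul 𝔸 a b ∈ (free 𝔸).gr (i + j) := by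
  have : a ⊗ₜ[k] b ∈ ⨆ p : ℤ, Submodule.map₂ (TensorProduct.mk k A A) (𝔸.gr p) (𝔸.gr (i + j - p)) :=
    Submodule.mem_iSup_of_mem i (Submodule.apply_mem_map₂ _ ha (by simpa using hb))
  exact this

/-- Extensionality on pure tensors, phrased for the carrier of `free 𝔸` so that the tensor product
need not be unfolded at each use. -/
theorem free_ext {N : Type*} [AddCommGroup N] [Module k N] {f g : (free 𝔸).carrier →ₗ[k] N}
    (h : ∀ a b : A, f (tmul 𝔸 a b) = g (tmul 𝔸 a b)) (t : (free 𝔸).carrier) : f t = g t :=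
  TensorProduct.induction_on (motive := fun t : A ⊗[k] A => f t = g t) t
    ((map_zero f).trans (map_zero g).symm) h
    (fun x y hx hy => (map_add f x y).trans ((congrArg₂ _ hx hy).trans (map_add g x y).symm))

/-- The bimodule map `a ⊗ b ↦ a x b`, up to signs for shifted bimodules. -/
noncomputable def mulMap (M : DGBimod 𝔸) (x : M.carrier) : (free 𝔸).carrier →ₗ[k] M.carrier :=
  TensorProduct.lift (M.l.compl₂ (M.r.flip x))

theorem mulMap_tmul (M : DGBimod 𝔸) (x : M.carrier) (a b : A) :
    M.mulMap x (tmul 𝔸 a b) = M.l a (M.r b x) := rfl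

theorem mulMap_l (M : DGBimod 𝔸) (x : M.carrier) (a : A) (t : (free 𝔸).carrier) :
    M.mulMap x ((free 𝔸).l a t) = M.l a (M.mulMap x t) :=
  free_ext (f := M.mulMap x ∘ₗ (free 𝔸).l a) (g := M.l a ∘ₗ M.mulMap x)
    (fun b _ => M.l_mul a b _) t

theorem mulMap_r (M : DGBimod 𝔸) (x : M.carrier) (a : A) (t : (free 𝔸).carrier) :
    M.mulMap x ((free 𝔸).r a t) = M.r a (M.mulMap x t) :=
  free_ext (f := M.mulMap x ∘ₗ (free 𝔸).r a) (g := M.r a ∘ₗ M.mulMap x)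
    (fun b c => (congrArg (M.l b) (M.r_mul c a x)).trans (M.l_r _ _ _)) t

/-- The morphism from the free bimodule given by a cycle of degree `0`. -/
noncomputable def mulHom (M : DGBimod 𝔸) (x : M.carrier) (hx : x ∈ M.gr 0) (hd : M.d x = 0) :
    free 𝔸 ⟶ M :=
  Hom.mk (M.mulMap x) (M.mulMap_l x) (M.mulMap_r x)
    (fun n t ht => by
      refine (iSup_le fun p => Submodule.map₂_le.2 fun a ha b hb => ?_ :
        _ ≤ (M.gr n).comap (M.mulMap x)) ht
      have := M.l_mem _ _ a ha _ (M.r_mem _ _ x hx b hb)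
      rwa [zero_add, add_sub_cancel] at this)
    (fun t => free_ext (f := M.mulMap x ∘ₗ (free 𝔸).d) (g := M.d ∘ₗ M.mulMap x) (fun a b => by
      rw [LinearMap.comp_apply, LinearMap.comp_apply, free_d, map_add, mulMap_tmul, mulMap_tmul,
        mulMap_tmul, M.d_l', M.d_r 0 x hx b, hd, map_zero, zero_add, Int.negOnePow_zero,
        one_smul]) t)

/-- The map `a ⊗ b ↦ (-1) ^ |a| a ⊗ b`. -/
noncomputable def leftParity (𝔸 : DGAlgStr k A) : (free 𝔸).carrier →ₗ[k] (free 𝔸).carrier :=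
  LinearMap.rTensor A (parity 𝔸.isInternal)

theorem leftParity_tmul (a b : A) :
    leftParity 𝔸 (tmul 𝔸 a b) = tmul 𝔸 (parity 𝔸.isInternal a) b := rfl

theorem leftParity_leftParity (t : (free 𝔸).carrier) : leftParity 𝔸 (leftParity 𝔸 t) = t :=
  free_ext (f := leftParity 𝔸 ∘ₗ leftParity 𝔸) (g := LinearMap.id) (fun a b => by
    rw [LinearMap.comp_apply, leftParity_tmul, leftParity_tmul, parity_parity,
      LinearMap.id_apply]) t

theorem leftParity_l (a : A) (t : (free 𝔸).carrier) :
    leftParity 𝔸 ((free 𝔸).l a t) = (free 𝔸).l (parity 𝔸.isInternal a) (leftParity 𝔸 t) :=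
  free_ext (f := leftParity 𝔸 ∘ₗ (free 𝔸).l a)
    (g := (free 𝔸).l (parity 𝔸.isInternal a) ∘ₗ leftParity 𝔸) (fun b c => by
      rw [LinearMap.comp_apply, LinearMap.comp_apply, free_l, leftParity_tmul, leftParity_tmul,
        free_l, parity_mul _ 𝔸.mul_mem]) t

theorem leftParity_r (a : A) (t : (free 𝔸).carrier) :
    leftParity 𝔸 ((free 𝔸).r a t) = (free 𝔸).r a (leftParity 𝔸 t) :=
  free_ext (f := leftParity 𝔸 ∘ₗ (free 𝔸).r a) (g := (free 𝔸).r a ∘ₗ leftParity 𝔸)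
    (fun _ _ => rfl) t

/-- The dg bimodule `M` is generated by a cycle `x` of degree `n`, and the bimodule map `φ` into the
free bimodule identifies it with a direct summand, up to a shift. -/
structure IsCell (M : DGBimod 𝔸) (n : ℤ) (x : M.carrier)
    (φ : M.carrier →ₗ[k] (free 𝔸).carrier) : Prop where
  mem : x ∈ M.gr n
  d_eq_zero : M.d x = 0
  map_l : ∀ a m, φ (M.l a m) = (free 𝔸).l a (φ m)
  map_r : ∀ a m, φ (M.r a m) = (free 𝔸).r a (φ m)
  map_mem : φ x ∈ (free 𝔸).gr 0
  d_map : (free 𝔸).d (φ x) = 0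
  -- Suspension twists the left action by a sign; as `φ x` is unaffected by that sign, the same
  -- element continues to work for all shifts.
  leftParity_map : leftParity 𝔸 (φ x) = φ x
  mulMap_map : M.mulMap x (φ x) = x
  surjective : Function.Surjective (M.mulMap x)

variable {M : DGBimod 𝔸} {n : ℤ} {x : M.carrier} {φ : M.carrier →ₗ[k] (free 𝔸).carrier}

/-- Since `x` generates `M`, this formula determines `φ`. It is why `φ` need not be assumed to
respect degrees or differentials: up to the shift, both properties follow from those of the cycle `φ
x`. -/
theorem IsCell.map_mulMap (h : M.IsCell n x φ) (t : (free 𝔸).carrier) :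
    φ (M.mulMap x t) = (free 𝔸).mulMap (φ x) t :=
  free_ext (f := φ ∘ₗ M.mulMap x) (g := (free 𝔸).mulMap (φ x)) (fun a b => by
    change φ (M.l a (M.r b x)) = (free 𝔸).l a ((free 𝔸).r b (φ x))
    rw [h.map_l, h.map_r]) t

/-- A cell of degree zero is a direct summand of the free bimodule. -/
noncomputable def IsCell.retract (h : M.IsCell 0 x φ) : Retract M (free 𝔸) where
  i := Hom.mk φ h.map_l h.map_r
    (fun i m hm => by
      -- A preimage `t` of `m` need not be homogeneous, but its component of degree `i` is also a
      -- preimage.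
      obtain ⟨t, rfl⟩ := h.surjective m
      have ht := proj_comm (free 𝔸).isInternal M.isInternal (M.mulMap x)
        (M.mulHom x h.mem h.d_eq_zero).map_mem i t
      rw [proj_self M.isInternal hm] at ht
      rw [← ht, h.map_mulMap]
      exact ((free 𝔸).mulHom (φ x) h.map_mem h.d_map).map_mem i _ (proj_mem_gr _ _ _))
    (fun m => by
      obtain ⟨t, rfl⟩ := h.surjective m
      have h1 : M.mulMap x ((free 𝔸).d t) = M.d (M.mulMap x t) :=
        (M.mulHom x h.mem h.d_eq_zero).map_d t
      rw [← h1, h.map_mulMap, h.map_mulMap]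
      exact ((free 𝔸).mulHom (φ x) h.map_mem h.d_map).map_d t)
  r := M.mulHom x h.mem h.d_eq_zero
  retract := by
    refine Hom.ext (LinearMap.ext fun m => ?_)
    change M.mulMap x (φ m) = m
    obtain ⟨t, rfl⟩ := h.surjective m
    rw [h.map_mulMap]
    refine free_ext (f := M.mulMap x ∘ₗ (free 𝔸).mulMap (φ x)) (g := M.mulMap x) (fun a b => ?_) t
    change M.mulMap x ((free 𝔸).l a ((free 𝔸).r b (φ x))) = _
    rw [mulMap_l, mulMap_r, h.mulMap_map]
    rfl

/-- The sign `(-1) ^ |a|` in the suspended left action is exactly `leftParity` on `a ⊗ b`. -/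
theorem mulMap_shift (M : DGBimod 𝔸) (x : M.carrier) (t : (free 𝔸).carrier) :
    M.shift.mulMap x t = M.mulMap x (leftParity 𝔸 t) :=
  free_ext (f := M.shift.mulMap x) (g := M.mulMap x ∘ₗ leftParity 𝔸) (fun _ _ => rfl) t

/-- Composing `φ` with `leftParity` turns it into a bimodule map for the twisted left action; the
two signs cancel in `mulMap_map`. -/
theorem IsCell.shift (h : M.IsCell n x φ) : M.shift.IsCell (n + 1) x (leftParity 𝔸 ∘ₗ φ) where
  mem := by
    change x ∈ M.gr (n + 1 - 1)
    rw [add_sub_cancel_right]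
    exact h.mem
  d_eq_zero := neg_eq_zero.2 h.d_eq_zero
  map_l a (m : M.carrier) := by
    change leftParity 𝔸 (φ (M.l (parity 𝔸.isInternal a) m)) = (free 𝔸).l a (leftParity 𝔸 (φ m))
    rw [h.map_l, leftParity_l, parity_parity]
  map_r a (m : M.carrier) := by
    change leftParity 𝔸 (φ (M.r a m)) = (free 𝔸).r a (leftParity 𝔸 (φ m))
    rw [h.map_r, leftParity_r]
  map_mem := by
    change leftParity 𝔸 (φ x) ∈ _
    rw [h.leftParity_map]
    exact h.map_mem
  d_map := by
    change (free 𝔸).d (leftParity 𝔸 (φ x)) = 0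
    rw [h.leftParity_map, h.d_map]
  leftParity_map := congrArg (leftParity 𝔸) h.leftParity_map
  mulMap_map := by
    refine (mulMap_shift M x _).trans ?_
    change M.mulMap x (leftParity 𝔸 (leftParity 𝔸 (φ x))) = x
    rw [leftParity_leftParity, h.mulMap_map]
  surjective m := by
    obtain ⟨t, ht⟩ := h.surjective m
    refine ⟨leftParity 𝔸 t, (mulMap_shift M x _).trans ?_⟩
    rw [leftParity_leftParity, ht]

/-- The double desuspension, which involves no signs. -/
def regrade (M : DGBimod 𝔸) : DGBimod 𝔸 where
  carrier := M.carrier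
  l := M.l
  r := M.r
  l_one := M.l_one
  l_mul := M.l_mul
  r_one := M.r_one
  r_mul := M.r_mul
  l_r := M.l_r
  gr i := M.gr (i + 2)
  isInternal := by
    refine isInternal_of_proj (fun i => proj M.isInternal (i + 2))
      (fun i m hm => proj_self _ hm) (fun i j hij m hm => proj_ne _ (by omega) hm)
      (fun S hS m => graded_le M.isInternal (fun i => ?_) m)
    simpa using hS (i - 2)
  l_mem i j a ha m hm := by
    have := M.l_mem i (j + 2) a ha m hm
    rwa [← add_assoc] at this
  r_mem i j m hm b hb := by
    have := M.r_mem (i + 2) j m hm b hb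
    rwa [add_right_comm] at this
  d := M.d
  d_mem i m hm := by
    have := M.d_mem (i + 2) m hm
    rwa [add_sub_right_comm] at this
  d_d := M.d_d
  d_l := M.d_l
  d_r i m hm b := by
    rw [M.d_r (i + 2) m hm b, Int.negOnePow_add, Int.negOnePow_even 2 even_two, mul_one]

/-- A dg bimodule is the double suspension of its double desuspension. -/
noncomputable def regradeIso (M : DGBimod 𝔸) : M ≅ M.regrade.shift.shift where
  hom := Hom.mk LinearMap.id
    (fun a m => congrArg (fun b => M.l b m) (parity_parity 𝔸.isInternal a).symm)
    (fun _ _ => rfl)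
    (fun i m hm => by
      change m ∈ M.gr (i - 1 - 1 + 2)
      rwa [show i - 1 - 1 + 2 = i by omega])
    (fun m => (neg_neg (M.d m)).symm)
  inv := Hom.mk (LinearMap.id (M := M.carrier))
    (fun a m => congrArg (fun b => M.l b m) (parity_parity 𝔸.isInternal a))
    (fun _ _ => rfl)
    (fun i (m : M.carrier) (hm : m ∈ M.gr (i - 1 - 1 + 2)) => by
      rw [show i - 1 - 1 + 2 = i by omega] at hm
      exact hm)
    (fun m => neg_neg (M.d m))
  hom_inv_id := rfl
  inv_hom_id := rfl

theorem IsCell.regrade (h : M.IsCell n x φ) : M.regrade.IsCell (n - 2) x φ where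
  mem := by
    change x ∈ M.gr (n - 2 + 2)
    rw [sub_add_cancel]
    exact h.mem
  d_eq_zero := h.d_eq_zero
  map_l := h.map_l
  map_r := h.map_r
  map_mem := h.map_mem
  d_map := h.d_map
  leftParity_map := h.leftParity_map
  mulMap_map := h.mulMap_map
  surjective := h.surjective

end DGBimod

-- Induction on the degree of the generator, starting from a summand of the free bimodule. Negative
-- degrees are raised by suspending. For positive degrees a desuspension is needed, and it is
-- obtained as `regrade` (degree `-2`) followed by `shift` (degree `+1`).
open DGBimod in
theorem IsThick.of_isCell {k : Type u} {A : Type v} [Field k] [Ring A] [Algebra k A]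
    {𝔸 : DGAlgStr k A} {P : ObjectProperty (DerivedCat 𝔸)} (hP : IsThick P)
    (hfree : P (toDerived (free 𝔸))) {n : ℤ} {M : DGBimod 𝔸} {x : M.carrier}
    {φ : M.carrier →ₗ[k] (free 𝔸).carrier} (h : M.IsCell n x φ) : P (toDerived M) := by
  induction n using Int.induction_on generalizing M with
  | zero => exact hP.of_retract h.retract hfree
  | succ n ih =>
    have := h.regrade.shift
    rw [show (n + 1 - 2 + 1 : ℤ) = n by omega] at this
    exact hP.of_iso M.regradeIso ((hP.shift _).2 (ih this))
  | pred n ih =>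
    have := h.shift
    rw [sub_add_cancel] at this
    exact (hP.shift _).1 (ih this)

end DG

namespace DG

namespace DGBimod

variable {k : Type u} {A : Type v} [Field k] [Ring A] [Algebra k A] {𝔸 : DGAlgStr k A}

/-! ### Relative tensor products of a dg algebra with itself -/

/-- Dg subalgebras. -/
structure IsDGSubalgebra (𝔸 : DGAlgStr k A) (S : Subalgebra k A) : Prop where
  d_mem : ∀ a ∈ S, 𝔸.d a ∈ S
  homogeneous : IsHomogeneous 𝔸.gr (Subalgebra.toSubmodule S)

/-- The kernel of the projection `A ⊗ A → A ⊗_S A`. -/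
noncomputable def relKer (𝔸 : DGAlgStr k A) (S : Subalgebra k A) :
    Submodule k (free 𝔸).carrier :=
  Submodule.span k {t | ∃ a b, ∃ c ∈ S, tmul 𝔸 (a * c) b - tmul 𝔸 a (c * b) = t}

variable {S T : Subalgebra k A}

theorem relKer_le {R : Submodule k (free 𝔸).carrier}
    (h : ∀ a b, ∀ c ∈ S, tmul 𝔸 (a * c) b - tmul 𝔸 a (c * b) ∈ R) : relKer 𝔸 S ≤ R :=
  Submodule.span_le.2 fun _ ⟨a, b, c, hc, e⟩ => e ▸ h a b c hc

theorem mem_relKer (a b : A) {c : A} (hc : c ∈ S) :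
    tmul 𝔸 (a * c) b - tmul 𝔸 a (c * b) ∈ relKer 𝔸 S :=
  Submodule.subset_span ⟨a, b, c, hc, rfl⟩

theorem mem_relKer_one {c : A} (hc : c ∈ S) : tmul 𝔸 c 1 - tmul 𝔸 1 c ∈ relKer 𝔸 S := by
  simpa using mem_relKer (𝔸 := 𝔸) 1 1 hc

theorem relKer_mono (h : S ≤ T) : relKer 𝔸 S ≤ relKer 𝔸 T :=
  Submodule.span_mono fun _ ⟨a, b, c, hc, e⟩ => ⟨a, b, c, h hc, e⟩

/-- The defining relations are stable under both outer actions. Stability under `d` uses that `S`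
contains `d c` and, by homogeneity, the sign twist of `c`. -/
theorem isSub_relKer (hS : IsDGSubalgebra 𝔸 S) : (free 𝔸).IsSub (relKer 𝔸 S) where
  l_mem a t ht := by
    refine (relKer_le fun b c s hs => ?_ : _ ≤ (relKer 𝔸 S).comap ((free 𝔸).l a)) ht
    rw [Submodule.mem_comap, map_sub, free_l, free_l, ← mul_assoc]
    exact mem_relKer _ _ hs
  r_mem a t ht := by
    refine (relKer_le fun b c s hs => ?_ : _ ≤ (relKer 𝔸 S).comap ((free 𝔸).r a)) ht
    rw [Submodule.mem_comap, map_sub, free_r, free_r, mul_assoc]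
    exact mem_relKer _ _ hs
  d_mem t ht := by
    refine (relKer_le fun a b c hc => ?_ : _ ≤ (relKer 𝔸 S).comap (free 𝔸).d) ht
    -- With `ā` the sign twist of `a`, the differential of the relation for `(a, c, b)` is the sum
    -- of the relations for `(d a, c, b)`, `(ā, d c, b)` and `(ā, c̄, d b)`.
    have h1 := mem_relKer (𝔸 := 𝔸) (𝔸.d a) b hc
    have h2 := mem_relKer (𝔸 := 𝔸) (parity 𝔸.isInternal a) b (hS.d_mem c hc)
    have h3 := mem_relKer (𝔸 := 𝔸) (parity 𝔸.isInternal a) (𝔸.d b)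
      (hS.homogeneous.parity_mem 𝔸.isInternal hc)
    have := add_mem (add_mem h1 h2) h3
    rw [Submodule.mem_comap, map_sub, free_d, free_d, 𝔸.d_mul, 𝔸.d_mul, parity_mul _ 𝔸.mul_mem, map_add, map_add,
      LinearMap.add_apply]
    refine (congrArg (· ∈ relKer 𝔸 S) ?_).mp this
    abel
  homogeneous := by
    refine isHomogeneous_span ?_
    rintro _ ⟨a, b, c, hc, rfl⟩
    set G := ⨆ i, relKer 𝔸 S ⊓ (free 𝔸).gr i with hG
    -- The relation is linear in each of `a`, `b`, `c`, so these are reduced to homogeneous elements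
    -- one after another, with `c` decomposed inside `S`.
    refine graded_le 𝔸.isInternal (S := G.comap ((tmul 𝔸).flip b ∘ₗ LinearMap.mulRight k c
      - (tmul 𝔸).flip (c * b))) (fun i a ha => ?_) a
    refine graded_le 𝔸.isInternal (S := G.comap (tmul 𝔸 (a * c)
      - tmul 𝔸 a ∘ₗ LinearMap.mulLeft k c)) (fun j b hb => ?_) b
    refine (iSup_le fun l c hc => ?_ : _ ≤ G.comap ((tmul 𝔸).flip b ∘ₗ LinearMap.mulLeft k a
      - tmul 𝔸 a ∘ₗ LinearMap.mulRight k b)) (hS.homogeneous hc)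
    refine Submodule.mem_iSup_of_mem (i + l + j) ⟨mem_relKer a b hc.1, ?_⟩
    change tmul 𝔸 (a * c) b - tmul 𝔸 a (c * b) ∈ _
    refine sub_mem ?_ ?_
    · exact tmul_mem (𝔸.mul_mem _ _ a ha c hc.2) hb
    · have := tmul_mem ha (𝔸.mul_mem _ _ c hc.2 b hb)
      rwa [← add_assoc] at this

/-- The map `c ↦ c ⊗ 1 - 1 ⊗ c` is a derivation: its value at `x y` is `x (y ⊗ 1 - 1 ⊗ y) + (x ⊗ 1 -
1 ⊗ x) y`. Hence the generators of an algebra suffice to control the whole subbimodule. -/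
theorem relKer_adjoin_le {s : Set A} {R : Submodule k (free 𝔸).carrier}
    (hl : ∀ a, ∀ t ∈ R, (free 𝔸).l a t ∈ R) (hr : ∀ a, ∀ t ∈ R, (free 𝔸).r a t ∈ R)
    (h : ∀ c ∈ s, tmul 𝔸 c 1 - tmul 𝔸 1 c ∈ R) : relKer 𝔸 (Algebra.adjoin k s) ≤ R := by
  refine relKer_le fun a b c hc => ?_
  suffices hc' : tmul 𝔸 c 1 - tmul 𝔸 1 c ∈ R by
    have := hl a _ (hr b _ hc')
    rwa [map_sub, map_sub, free_r, free_r, free_l, free_l, one_mul, mul_one] at this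
  induction hc using Algebra.adjoin_induction with
  | mem c hc => exact h c hc
  | algebraMap r =>
    rw [Algebra.algebraMap_eq_smul_one, map_smul, map_smul, LinearMap.smul_apply, sub_self]
    exact zero_mem _
  | add x y _ _ hx hy =>
    rw [map_add, map_add, LinearMap.add_apply, add_sub_add_comm]
    exact add_mem hx hy
  | mul x y _ _ hx hy =>
    have := add_mem (hl x _ hy) (hr y _ hx)
    rw [map_sub, map_sub, free_r, free_r, free_l, free_l, one_mul, mul_one] at this
    rwa [sub_add_sub_cancel] at this

/-- The product `A ⊗ A → A`. -/
noncomputable def mulFree (𝔸 : DGAlgStr k A) : free 𝔸 ⟶ diagonal 𝔸 :=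
  (diagonal 𝔸).mulHom (1 : A) 𝔸.one_mem 𝔸.d_one

/-- The product `A ⊗ A → A` as a linear map. -/
noncomputable def prodFree (𝔸 : DGAlgStr k A) : (free 𝔸).carrier →ₗ[k] A := (mulFree 𝔸).f

theorem prodFree_tmul (a b : A) : prodFree 𝔸 (tmul 𝔸 a b) = a * b := by
  have : a * (1 * b) = a * b := by rw [one_mul]
  exact this

theorem prodFree_of_mem_relKer {t : (free 𝔸).carrier} (ht : t ∈ relKer 𝔸 S) :
    prodFree 𝔸 t = 0 := by
  refine (relKer_le fun a b c hc => ?_ : _ ≤ LinearMap.ker (prodFree 𝔸)) ht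
  rw [LinearMap.mem_ker, map_sub, prodFree_tmul, prodFree_tmul, mul_assoc, sub_self]

/-- Every tensor `t` is congruent to `(prodFree t) ⊗ 1` modulo the relations over the whole algebra,
so these relations exhaust the kernel of the product. This reduces perfection of the diagonal
bimodule to that of `relKer ⊤`. -/
theorem isShortExact_relKer_top (h : IsDGSubalgebra 𝔸 ⊤) :
    IsShortExact (subι (free 𝔸) _ (isSub_relKer h)) (mulFree 𝔸) where
  injective := Subtype.val_injective
  surjective := (fun a => ⟨tmul 𝔸 a 1, by rw [prodFree_tmul, mul_one]⟩ :
    Function.Surjective (prodFree 𝔸))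
  comp_zero m := by
    have := prodFree_of_mem_relKer (𝔸 := 𝔸) m.2
    exact this
  exact t ht := by
    have key : ∀ t, t - (tmul 𝔸).flip 1 (prodFree 𝔸 t) ∈ relKer 𝔸 ⊤ := by
      refine fun t => (Submodule.Quotient.mk_eq_zero _).1 ?_
      refine free_ext (f := (relKer 𝔸 ⊤).mkQ ∘ₗ (LinearMap.id - (tmul 𝔸).flip 1 ∘ₗ prodFree 𝔸))
        (g := 0) (fun a b => (Submodule.Quotient.mk_eq_zero _).2 ?_) t
      change tmul 𝔸 a b - (tmul 𝔸).flip 1 (prodFree 𝔸 (tmul 𝔸 a b)) ∈ _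
      have := neg_mem (mem_relKer (𝔸 := 𝔸) a 1 (Algebra.mem_top (R := k) (x := b)))
      rwa [neg_sub, mul_one, ← prodFree_tmul (𝔸 := 𝔸) a b] at this
    have := key t
    rw [show prodFree 𝔸 t = 0 from ht, map_zero, sub_zero] at this
    exact ⟨⟨t, this⟩, rfl⟩

/-- A criterion for a subquotient to be a cell. -/
theorem isCell_quot {M : DGBimod 𝔸} {S T : Submodule k M.carrier} (hS : M.IsSub S)
    (hT : M.IsSub T) (h : S ≤ T) {n : ℤ} {y : M.carrier} (hyT : y ∈ T)
    {ψ : M.carrier →ₗ[k] (free 𝔸).carrier} (hψ : ∀ s ∈ S, ψ s = 0) (hy : y ∈ M.gr n)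
    (hdy : M.d y ∈ S) (hl : ∀ a, ∀ t ∈ T, ψ (M.l a t) = (free 𝔸).l a (ψ t))
    (hr : ∀ a, ∀ t ∈ T, ψ (M.r a t) = (free 𝔸).r a (ψ t)) (hψy : ψ y ∈ (free 𝔸).gr 0)
    (hdψ : (free 𝔸).d (ψ y) = 0) (hpψ : leftParity 𝔸 (ψ y) = ψ y)
    (hmul : M.mulMap y (ψ y) - y ∈ S) (hsurj : ∀ t ∈ T, ∃ u, t - M.mulMap y u ∈ S) :
    ∃ x φ, ((M.sub T hT).quot _ (hS.comap hT h)).IsCell n x φ := by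
  let R := S.comap T.subtype
  let Q := (M.sub T hT).quot R (hS.comap hT h)
  let π : T →ₗ[k] Q.carrier := R.mkQ
  have hπ : Function.Surjective π := R.mkQ_surjective
  have heq : ∀ z w : T, (z : M.carrier) - w ∈ S → π z = π w :=
    fun z w hz => (Submodule.Quotient.eq R).2 hz
  have hM : ∀ u, M.mulMap y u ∈ T := by
    intro u
    refine (Submodule.Quotient.mk_eq_zero T).1 ?_
    exact free_ext (f := T.mkQ ∘ₗ M.mulMap y) (g := 0) (fun a b =>
      (Submodule.Quotient.mk_eq_zero T).2 (hT.l_mem a _ (hT.r_mem b _ hyT))) u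
  have hQ : ∀ u, Q.mulMap (π ⟨y, hyT⟩) u = π ⟨M.mulMap y u, hM u⟩ := free_ext
    (f := Q.mulMap (π ⟨y, hyT⟩)) (g := π ∘ₗ (M.mulMap y).codRestrict T hM) (fun _ _ => rfl)
  -- The map `ψ` is a bimodule map only on `T`; since it kills `S`, it descends to the subquotient,
  -- where it serves as `φ`.
  refine ⟨π ⟨y, hyT⟩, R.liftQ (ψ ∘ₗ T.subtype) (fun t ht => hψ _ ht), ?_⟩
  constructor
  · exact ⟨⟨y, hyT⟩, hy, rfl⟩
  · exact (Submodule.Quotient.mk_eq_zero R).2 hdy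
  · exact fun a => hπ.forall.2 fun m => hl a m.1 m.2
  · exact fun a => hπ.forall.2 fun m => hr a m.1 m.2
  · exact hψy
  · exact hdψ
  · exact hpψ
  · exact (hQ (ψ y)).trans (heq _ _ hmul)
  · refine hπ.forall.2 fun m => ?_
    obtain ⟨u, hu⟩ := hsurj m.1 m.2
    exact ⟨u, (hQ u).trans (heq _ _ hu).symm⟩

/-- The bimodule map on the kernel of the product `A ⊗ A → A` given by a derivation, extended to
`A ⊗ A` as a map of left modules. -/
noncomputable def ofDerivation (D : A →ₗ[k] (free 𝔸).carrier) :
    (free 𝔸).carrier →ₗ[k] (free 𝔸).carrier :=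
  -TensorProduct.lift ((free 𝔸).l.compl₂ D)

/-! ### Derivations and the cell added by one generator. -/

section ofDerivation

variable {D : A →ₗ[k] (free 𝔸).carrier}

theorem ofDerivation_tmul (a b : A) : ofDerivation D (tmul 𝔸 a b) = -(free 𝔸).l a (D b) := rfl

theorem ofDerivation_l (a : A) (t : (free 𝔸).carrier) :
    ofDerivation D ((free 𝔸).l a t) = (free 𝔸).l a (ofDerivation D t) :=
  free_ext (f := ofDerivation D ∘ₗ (free 𝔸).l a) (g := (free 𝔸).l a ∘ₗ ofDerivation D)
    (fun b c => by
      rw [LinearMap.comp_apply, LinearMap.comp_apply, free_l, ofDerivation_tmul,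
        ofDerivation_tmul, (free 𝔸).l_mul, map_neg]) t

variable (hD : ∀ a b, D (a * b) = (free 𝔸).l a (D b) + (free 𝔸).r b (D a))
include hD

/-- The defect of right linearity on `b ⊗ c` is `-(b c) D a`, which depends on the tensor only
through its product and so disappears on the kernel of the product. -/
theorem ofDerivation_r (a : A) (t : (free 𝔸).carrier) (ht : prodFree 𝔸 t = 0) :
    ofDerivation D ((free 𝔸).r a t) = (free 𝔸).r a (ofDerivation D t) := by
  have key := free_ext (f := ofDerivation D ∘ₗ (free 𝔸).r a)
    (g := (free 𝔸).r a ∘ₗ ofDerivation D - (free 𝔸).l.flip (D a) ∘ₗ prodFree 𝔸) (fun b c => by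
      rw [LinearMap.sub_apply, LinearMap.comp_apply, LinearMap.comp_apply, LinearMap.comp_apply,
        free_r, ofDerivation_tmul, ofDerivation_tmul, prodFree_tmul, hD, LinearMap.flip_apply,
        (free 𝔸).l_mul, map_add, map_neg, (free 𝔸).l_r]
      abel) t
  rwa [LinearMap.sub_apply, LinearMap.comp_apply, LinearMap.comp_apply, LinearMap.comp_apply, ht,
    map_zero, sub_zero] at key

/-- The image of the relation `a c ⊗ b - a ⊗ c b` is `a (D c) b`. -/
theorem ofDerivation_relKer (h : ∀ c ∈ S, D c = 0) {t : (free 𝔸).carrier} (ht : t ∈ relKer 𝔸 S) :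
    ofDerivation D t = 0 := by
  refine (relKer_le fun a b c hc => ?_ : _ ≤ LinearMap.ker (ofDerivation D)) ht
  rw [LinearMap.mem_ker, map_sub, ofDerivation_tmul, ofDerivation_tmul, hD, h c hc,
    (free 𝔸).l_mul, map_zero, add_zero, sub_self]

/-- Passing from `S` to `T` adds to `relKer` the single bimodule generator `y = v ⊗ 1 - 1 ⊗ v`, of
the degree of `v`. Its differential lies in `relKer S` because `d v ∈ S`, and modulo `relKer S` it
satisfies `e y e' = y`. The map attached to `D` kills `relKer S` and sends `y` to `e ⊗ e'`, so that
no relations on `y` survive beyond those of `e ⊗ e'`. -/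
theorem exists_isCell_relKer (hS : IsDGSubalgebra 𝔸 S) (hT : IsDGSubalgebra 𝔸 T) (hST : S ≤ T)
    {v : A} {p : ℤ} (hv : v ∈ 𝔸.gr p) (hdv : 𝔸.d v ∈ S) (hvT : T = Algebra.adjoin k (insert v S))
    {e e' : A} (he : e ∈ 𝔸.gr 0) (he' : e' ∈ 𝔸.gr 0) (hde : 𝔸.d e = 0) (hde' : 𝔸.d e' = 0)
    (heS : e ∈ S) (heS' : e' ∈ S) (hev : e * v = v) (hve : v * e' = v)
    (hDS : ∀ c ∈ S, D c = 0) (hDv : D v = tmul 𝔸 e e') :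
    ∃ x φ, (((free 𝔸).sub _ (isSub_relKer hT)).quot _
      ((isSub_relKer hS).comap (isSub_relKer hT) (relKer_mono hST))).IsCell p x φ := by
  have hvT' : v ∈ T := hvT ▸ Algebra.subset_adjoin (Set.mem_insert _ _)
  have hφ : ofDerivation D (tmul 𝔸 v 1 - tmul 𝔸 1 v) = tmul 𝔸 e e' := by
    rw [map_sub, ofDerivation_tmul, ofDerivation_tmul, hDS 1 S.one_mem, hDv, map_zero, neg_zero,
      zero_sub, neg_neg, (free 𝔸).l_one]
  refine isCell_quot (isSub_relKer hS) (isSub_relKer hT) (relKer_mono hST)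
    (y := tmul 𝔸 v 1 - tmul 𝔸 1 v) (ψ := ofDerivation D)
    (mem_relKer_one hvT') (fun _ => ofDerivation_relKer hD hDS) (sub_mem ?_ ?_) ?_
    (fun a t _ => ofDerivation_l a t)
    (fun a t ht => ofDerivation_r hD a t (prodFree_of_mem_relKer ht)) ?_ ?_ ?_ ?_ ?_
  · simpa using tmul_mem (𝔸 := 𝔸) hv 𝔸.one_mem
  · simpa using tmul_mem (𝔸 := 𝔸) 𝔸.one_mem hv
  · rw [map_sub, free_d, free_d, 𝔸.d_one, map_zero, map_zero, LinearMap.zero_apply, add_zero,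
      zero_add, parity_one _ 𝔸.one_mem]
    exact mem_relKer_one hdv
  · rw [hφ]
    have := tmul_mem he he'
    rwa [add_zero] at this
  · rw [hφ, free_d, hde, hde', map_zero, map_zero, LinearMap.zero_apply, add_zero]
  · rw [hφ, leftParity_tmul, parity_apply _ he, Int.negOnePow_zero, one_smul]
  · rw [hφ, mulMap_tmul, map_sub, map_sub, free_r, free_r, free_l, free_l, hev, hve, one_mul,
      mul_one]
    -- Here `e y e' = v ⊗ e' - e ⊗ v`; moving `e'` and `e`, which lie in `S`, across the tensor sign
    -- turns this into `v ⊗ 1 - 1 ⊗ v`.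
    have h1 := mem_relKer (𝔸 := 𝔸) v 1 heS'
    have h2 := mem_relKer (𝔸 := 𝔸) 1 v heS
    rw [hve, mul_one] at h1
    rw [hev, one_mul] at h2
    have := neg_mem (add_mem h1 h2)
    refine (congrArg (· ∈ relKer 𝔸 S) ?_).mp this
    abel
  · have key : relKer 𝔸 T ≤
        relKer 𝔸 S ⊔ LinearMap.range ((free 𝔸).mulMap (tmul 𝔸 v 1 - tmul 𝔸 1 v)) := by
      subst hvT
      refine relKer_adjoin_le (fun a t ht => ?_) (fun a t ht => ?_) ?_
      · obtain ⟨s, hs, _, ⟨u, rfl⟩, rfl⟩ := Submodule.mem_sup.1 ht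
        rw [map_add, ← mulMap_l]
        exact Submodule.add_mem_sup ((isSub_relKer hS).l_mem a s hs) ⟨_, rfl⟩
      · obtain ⟨s, hs, _, ⟨u, rfl⟩, rfl⟩ := Submodule.mem_sup.1 ht
        rw [map_add, ← mulMap_r]
        exact Submodule.add_mem_sup ((isSub_relKer hS).r_mem a s hs) ⟨_, rfl⟩
      · rintro c (rfl | hc)
        · refine Submodule.mem_sup_right ⟨tmul 𝔸 1 1, ?_⟩
          rw [mulMap_tmul, (free 𝔸).r_one, (free 𝔸).l_one]
        · exact Submodule.mem_sup_left (mem_relKer_one hc)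
    intro t ht
    obtain ⟨s, hs, _, ⟨u, rfl⟩, rfl⟩ := Submodule.mem_sup.1 (key ht)
    exact ⟨u, by rwa [add_sub_cancel_right]⟩

end ofDerivation

end DGBimod

/-- Derivations of a tensor ring with values in a bimodule. -/
theorem TensorRing.exists_derivation {k : Type u} {K : Type w} {V : Type v} [Field k] [CommRing K]
    [Algebra k K] [AddCommGroup V] [Module k V] {β : GrBimod k K V}
    {𝔸 : DGAlgStr k (TensorRing β)} (M : DGBimod 𝔸) (δ : V →ₗ[k] M.carrier)
    (hl : ∀ x v, δ (β.l x v) = M.l (coef β x) (δ v))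
    (hr : ∀ x v, δ (β.r x v) = M.r (coef β x) (δ v)) :
    ∃ D : TensorRing β →ₗ[k] M.carrier, (∀ a b, D (a * b) = M.l a (D b) + M.r b (D a)) ∧
      (∀ x, D (coef β x) = 0) ∧ ∀ v, D (gen β v) = δ v := by
  -- The derivation is encoded in a representation on `T_K(V) × M`: an element `a` acts by `(b, m) ↦
  -- (a b, a m + (D a) b)`. The universal property needs this only for `K`, where `D` is zero, and
  -- for `V`, where `D` is `δ`; then `D a` is read off as the second component of the action on `(1,
  -- 0)`.
  let f : K →ₐ[k] Module.End k (TensorRing β × M.carrier) := AlgHom.comp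
    (AlgHom.ofLinearMap (LinearMap.mk ⟨fun a => LinearMap.prodMap (LinearMap.mulLeft k a) (M.l a),
        fun a b => by ext <;> simp [add_mul]⟩ (fun c a => by ext <;> simp))
      (by ext <;> simp [M.l_one]) (fun a b => by ext <;> simp [M.l_mul])) (coef β)
  let g : V →ₗ[k] Module.End k (TensorRing β × M.carrier) := LinearMap.mk
    ⟨fun v => LinearMap.prodMap (LinearMap.mulLeft k (gen β v)) (M.l (gen β v)) +
      LinearMap.inr k _ _ ∘ₗ M.r.flip (δ v) ∘ₗ LinearMap.fst k _ _,
      fun a b => by ext <;> simp [add_mul]⟩ (fun c a => by ext <;> simp)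
  have hf : ∀ x b m, f x (b, m) = (coef β x * b, M.l (coef β x) m) := fun _ _ _ => rfl
  have hg : ∀ v b m, g v (b, m) = (gen β v * b, M.l (gen β v) m + M.r b (δ v)) := fun v b m =>
    Prod.ext (by simp [g]) (by simp [g])
  let F := lift (β := β) f g
    (fun x v => LinearMap.ext fun ⟨b, m⟩ => by
      rw [Module.End.mul_apply, hg, hg, hf, gen_l, hl, M.l_mul, map_add, M.l_r, mul_assoc])
    (fun x v => LinearMap.ext fun ⟨b, m⟩ => by
      rw [Module.End.mul_apply, hf, hg, hg, gen_r, hr, M.l_mul, M.r_mul, mul_assoc])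
  have hFf : ∀ x, F (coef β x) = f x := fun x => lift_coef x
  have hFg : ∀ v, F (gen β v) = g v := fun v => lift_gen v
  -- The elements which act by an operator of this triangular form are a subalgebra, so checking the
  -- generators is enough.
  let S : Subalgebra k (TensorRing β) :=
    { carrier := {a | ∀ b m, F a (b, m) = (a * b, M.l a m + M.r b (F a (1, 0)).2)}
      mul_mem' := by
        intro a c ha hc b m
        rw [map_mul, Module.End.mul_apply, Module.End.mul_apply, hc b m, ha, hc 1 0, ha (c * 1)]
        simp [M.l_mul, M.r_mul, M.r_one, M.l_r, mul_assoc, add_assoc]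
      add_mem' := by
        intro a c ha hc b m
        rw [map_add, LinearMap.add_apply, LinearMap.add_apply, hc b m, ha b m]
        refine Prod.ext (by simp [add_mul]) ?_
        simp only [Prod.snd_add, map_add, LinearMap.add_apply]
        abel
      algebraMap_mem' := by
        intro c b m
        rw [AlgHom.commutes]
        simp [Algebra.algebraMap_eq_smul_one, M.l_one] }
  have hF : ∀ a b m, F a (b, m) = (a * b, M.l a m + M.r b (F a (1, 0)).2) := by
    intro a
    refine induction (S := S) (fun x b m => ?_) (fun v b m => ?_) a
    · rw [hFf, hf, hf]
      simp
    · rw [hFg, hg, hg]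
      simp [M.r_one]
  refine ⟨LinearMap.mk ⟨fun a => (F a (1, 0)).2, fun a b => by simp⟩ (fun c a => by simp),
    fun a b => ?_, fun x => ?_, fun v => ?_⟩
  · change (F (a * b) (1, 0)).2 = M.l a (F b (1, 0)).2 + M.r b (F a (1, 0)).2
    rw [map_mul, Module.End.mul_apply, hF b 1 0, hF a]
    simp [M.r_one]
  · change (F (coef β x) (1, 0)).2 = 0
    rw [hFf, hf, map_zero]
  · change (F (gen β v) (1, 0)).2 = δ v
    rw [hFg, hg, map_zero, zero_add, M.r_one]

end DG

/-! ### Subalgebras given by generators, and the separable base. -/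

namespace DG

namespace DGBimod

variable {k : Type u} {A : Type v} [Field k] [Ring A] [Algebra k A] {𝔸 : DGAlgStr k A}

/-- The span of the homogeneous elements of the subalgebra is closed under products, so it is
everything once it contains the generators. -/
theorem isHomogeneous_adjoin {s : Set A}
    (h : ∀ c ∈ s, c ∈ ⨆ i, Subalgebra.toSubmodule (Algebra.adjoin k s) ⊓ 𝔸.gr i) :
    IsHomogeneous 𝔸.gr (Subalgebra.toSubmodule (Algebra.adjoin k s)) := by
  set G := ⨆ i, Subalgebra.toSubmodule (Algebra.adjoin k s) ⊓ 𝔸.gr i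
  have hm : ∀ a b, a ∈ G → b ∈ G → a * b ∈ G := by
    intro a b ha hb
    refine (iSup_le fun i x hx => ?_ : _ ≤ G.comap ((LinearMap.mul k A).flip b)) ha
    refine (iSup_le fun j y hy => ?_ : _ ≤ G.comap (LinearMap.mul k A x)) hb
    exact Submodule.mem_iSup_of_mem (i + j) ⟨Subalgebra.mul_mem _ hx.1 hy.1, 𝔸.mul_mem i j x hx.2 y hy.2⟩
  exact (Algebra.adjoin_le h : Algebra.adjoin k s ≤
    Submodule.toSubalgebra G (Submodule.mem_iSup_of_mem 0 ⟨Subalgebra.one_mem _, 𝔸.one_mem⟩) hm)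

theorem isDGSubalgebra_adjoin {s : Set A}
    (h : ∀ c ∈ s, c ∈ ⨆ i, Subalgebra.toSubmodule (Algebra.adjoin k s) ⊓ 𝔸.gr i)
    (hd : ∀ c ∈ s, 𝔸.d c ∈ Algebra.adjoin k s) :
    IsDGSubalgebra 𝔸 (Algebra.adjoin k s) where
  homogeneous := isHomogeneous_adjoin h
  d_mem a ha := by
    induction ha using Algebra.adjoin_induction with
    | mem c hc => exact hd c hc
    | algebraMap r =>
      rw [Algebra.algebraMap_eq_smul_one, map_smul, 𝔸.d_one, smul_zero]
      exact zero_mem _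
    | add x y _ _ hx hy =>
      rw [map_add]
      exact add_mem hx hy
    | mul x y hx' hy' hx hy =>
      rw [𝔸.d_mul]
      exact add_mem (mul_mem hx hy')
        (mul_mem ((isHomogeneous_adjoin h).parity_mem 𝔸.isInternal hx') hy)

/-- If `S` is a product of copies of `k`, then the kernel of `A ⊗ A → A ⊗_S A` is a direct summand
of the free bimodule. -/
theorem exists_isCell_relKer_adjoin {ι : Type*} [Fintype ι] [DecidableEq ι] {s : Set A}
    (hS : IsDGSubalgebra 𝔸 (Algebra.adjoin k s)) {e : ι → A} (he : ∀ i, e i ∈ 𝔸.gr 0)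
    (hd : ∀ i, 𝔸.d (e i) = 0) (heS : ∀ i, e i ∈ Algebra.adjoin k s)
    (hmul : ∀ i j, e i * e j = if i = j then e i else 0) (hone : ∑ i, e i = 1)
    (hs : ∀ c ∈ s, ∀ i, ∃ r : k, c * e i = r • e i ∧ e i * c = r • e i) :
    ∃ x φ, ((free 𝔸).sub _ (isSub_relKer hS)).IsCell 0 x φ := by
  have hii : ∀ i, e i * e i = e i := fun i => by rw [hmul, if_pos rfl]
  -- `∑ e_i ⊗ e_i` is the separability idempotent of the product of copies of `k`, and `z` is the
  -- complementary idempotent.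
  obtain ⟨z, hz⟩ : ∃ z, z = tmul 𝔸 1 1 - ∑ i, tmul 𝔸 (e i) (e i) := ⟨_, rfl⟩
  have hzS : z ∈ relKer 𝔸 (Algebra.adjoin k s) := by
    have : z = ∑ i, (tmul 𝔸 (e i * e i) 1 - tmul 𝔸 (e i) (e i * 1)) := by
      simp_rw [hii, mul_one]
      rw [Finset.sum_sub_distrib, ← LinearMap.sum_apply, ← map_sum, hone, hz]
    rw [this]
    exact sum_mem fun i _ => mem_relKer _ _ (heS i)
  have hl : ∀ a, (free 𝔸).l a z = tmul 𝔸 a 1 - ∑ i, tmul 𝔸 (a * e i) (e i) := fun a => by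
    simp_rw [hz, map_sub, map_sum, free_l, mul_one]
  have hr : ∀ a, (free 𝔸).r a z = tmul 𝔸 1 a - ∑ i, tmul 𝔸 (e i) (e i * a) := fun a => by
    simp_rw [hz, map_sub, map_sum, free_r, one_mul]
  -- Applying `z` to itself gives `z - ∑ e_i z e_i`, and `e_i z e_i = e_i ⊗ e_i - e_i ⊗ e_i = 0` by
  -- orthogonality.
  have hzz : (free 𝔸).mulMap z z = z := by
    conv_lhs => arg 2; rw [hz]
    rw [map_sub, mulMap_tmul, (free 𝔸).r_one, (free 𝔸).l_one, map_sum, Finset.sum_eq_zero, sub_zero]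
    intro i _
    rw [mulMap_tmul, hr, map_sub, map_sum, free_l, mul_one, Finset.sum_eq_single i, free_l, hii,
      sub_self]
    · intro j _ hj
      rw [free_l, hmul, if_neg hj.symm, map_zero, LinearMap.zero_apply]
    · simp
  have hM : ∀ u, (((free 𝔸).sub _ (isSub_relKer hS)).mulMap ⟨z, hzS⟩ u).1
      = (free 𝔸).mulMap z u := free_ext
    (f := (relKer 𝔸 (Algebra.adjoin k s)).subtype ∘ₗ
      ((free 𝔸).sub _ (isSub_relKer hS)).mulMap ⟨z, hzS⟩)
    (g := (free 𝔸).mulMap z) (fun _ _ => rfl)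
  have hz0 : z ∈ (free 𝔸).gr 0 := by
    have h : ∀ {a b}, a ∈ 𝔸.gr 0 → b ∈ 𝔸.gr 0 → tmul 𝔸 a b ∈ (free 𝔸).gr 0 := fun ha hb => by
      have := tmul_mem ha hb
      rwa [add_zero] at this
    rw [hz]
    exact sub_mem (h 𝔸.one_mem 𝔸.one_mem) (sum_mem fun i _ => h (he i) (he i))
  have hdz : (free 𝔸).d z = 0 := by
    rw [hz, map_sub, map_sum, free_d, 𝔸.d_one]
    simp_rw [free_d, hd]
    simp
  refine ⟨⟨z, hzS⟩, (relKer 𝔸 (Algebra.adjoin k s)).subtype, ?_⟩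
  constructor
  · exact hz0
  · exact Subtype.ext hdz
  · exact fun _ _ => rfl
  · exact fun _ _ => rfl
  · exact hz0
  · exact hdz
  · change leftParity 𝔸 z = z
    rw [hz, map_sub, map_sum, leftParity_tmul, parity_one _ 𝔸.one_mem]
    simp_rw [leftParity_tmul, parity_apply _ (he _), Int.negOnePow_zero, one_smul]
  · exact Subtype.ext ((hM z).trans hzz)
  · have key : relKer 𝔸 (Algebra.adjoin k s) ≤ LinearMap.range ((free 𝔸).mulMap z) := by
      refine relKer_adjoin_le ?_ ?_ fun c hc => ?_
      · rintro a _ ⟨u, rfl⟩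
        exact ⟨_, mulMap_l _ _ _ _⟩
      · rintro a _ ⟨u, rfl⟩
        exact ⟨_, mulMap_r _ _ _ _⟩
      -- This tensor is its own preimage: its value under `mulMap z` is `c z - z c`, and the sums
      -- over the idempotents cancel since `c` acts on each `e_i` by the same scalar from both
      -- sides.
      · refine ⟨tmul 𝔸 c 1 - tmul 𝔸 1 c, ?_⟩
        have : ∀ i, tmul 𝔸 (c * e i) (e i) = tmul 𝔸 (e i) (e i * c) := fun i => by
          obtain ⟨r, h1, h2⟩ := hs c hc i
          rw [h1, h2, map_smul, map_smul, LinearMap.smul_apply]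
        rw [map_sub, mulMap_tmul, mulMap_tmul, (free 𝔸).r_one, (free 𝔸).l_one, hl, hr]
        simp_rw [this]
        abel
    rintro ⟨t, ht⟩
    obtain ⟨u, rfl⟩ := key ht
    exact ⟨u, Subtype.ext (hM u)⟩

end DGBimod

/-! ### Subrings of the cobar construction generated by part of the dual coring. -/

namespace AugDGKRing

open DGBimod

variable {k : Type u} {t : ℕ} {A : Type v} [Field k] [Ring A] [Algebra k A]
  [FiniteDimensional k A] (𝔸 : AugDGKRing k t A)

/-- The image in the Koszul dual of the idempotents of `K`. -/
noncomputable def idem (i : Fin t) : 𝔸.KoszulDual :=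
  TensorRing.coef 𝔸.desuspDual (Pi.single i 1)

/-- The subalgebra of the Koszul dual generated by `K` and a subspace of the coaugmentation
coideal. -/
noncomputable def subring (U : Submodule k 𝔸.DualBar) : Subalgebra k 𝔸.KoszulDual :=
  Algebra.adjoin k (Set.range (TensorRing.coef 𝔸.desuspDual) ∪ 𝔸.bracket '' U)

/-- A homogeneous `K`-subbimodule of the coaugmentation coideal of the dual coring such that the
subring which it generates is closed under the differential of the cobar construction. -/
structure IsSubcoring (U : Submodule k 𝔸.DualBar) : Prop where
  l_mem : ∀ x, ∀ f ∈ U, 𝔸.desuspDual.l x f ∈ U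
  r_mem : ∀ x, ∀ f ∈ U, 𝔸.desuspDual.r x f ∈ U
  homogeneous : IsHomogeneous 𝔸.dualGr U
  cobarD_mem : ∀ f ∈ U, 𝔸.cobarD f ∈ 𝔸.subring U

variable {𝔸} {U W : Submodule k 𝔸.DualBar}

theorem coef_mem_subring (x : Fin t → k) : TensorRing.coef 𝔸.desuspDual x ∈ 𝔸.subring U :=
  Algebra.subset_adjoin (Or.inl ⟨x, rfl⟩)

theorem bracket_mem_subring {f : 𝔸.DualBar} (hf : f ∈ U) : 𝔸.bracket f ∈ 𝔸.subring U :=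
  Algebra.subset_adjoin (Or.inr ⟨f, hf, rfl⟩)

theorem subring_mono (h : U ≤ W) : 𝔸.subring U ≤ 𝔸.subring W :=
  Algebra.adjoin_mono (Set.union_subset_union_right _ (Set.image_mono h))

theorem subring_top : 𝔸.subring ⊤ = ⊤ :=
  eq_top_iff.2 fun x _ => TensorRing.induction (S := 𝔸.subring ⊤) coef_mem_subring
    (fun f => bracket_mem_subring (f := f) trivial) x

theorem subring_sup_span (f : 𝔸.DualBar) :
    𝔸.subring (U ⊔ Submodule.span k {f}) = Algebra.adjoin k (insert (𝔸.bracket f) (𝔸.subring U)) := by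
  refine le_antisymm (Algebra.adjoin_le ?_) (Algebra.adjoin_le ?_)
  · rintro _ (⟨x, rfl⟩ | ⟨g, hg, rfl⟩)
    · exact Algebra.subset_adjoin (Or.inr (coef_mem_subring x))
    · obtain ⟨g, hg', _, hc, rfl⟩ := Submodule.mem_sup.1 hg
      obtain ⟨c, rfl⟩ := Submodule.mem_span_singleton.1 hc
      rw [map_add, map_smul]
      exact add_mem (Algebra.subset_adjoin (Or.inr (bracket_mem_subring hg')))
        (Subalgebra.smul_mem _ (Algebra.subset_adjoin (Set.mem_insert _ _)) c)
  · rintro _ (rfl | hx)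
    · exact bracket_mem_subring (Submodule.mem_sup_right (Submodule.mem_span_singleton_self f))
    · exact subring_mono le_sup_left hx

theorem koszulDual_d_coef (x : Fin t → k) :
    𝔸.koszulDual.d (TensorRing.coef 𝔸.desuspDual x) = 0 :=
  TensorRing.deriv_coef x

theorem koszulDual_d_bracket (f : 𝔸.DualBar) : 𝔸.koszulDual.d (𝔸.bracket f) = 𝔸.cobarD f :=
  TensorRing.deriv_gen f

theorem coef_mem_gr (x : Fin t → k) : TensorRing.coef 𝔸.desuspDual x ∈ 𝔸.koszulDual.gr 0 :=
  TensorRing.coef_mem x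

theorem IsSubcoring.isDGSubalgebra (h : 𝔸.IsSubcoring U) :
    IsDGSubalgebra 𝔸.koszulDual (𝔸.subring U) := by
  refine isDGSubalgebra_adjoin ?_ ?_
  · rintro _ (⟨x, rfl⟩ | ⟨f, hf, rfl⟩)
    · exact Submodule.mem_iSup_of_mem 0 ⟨coef_mem_subring x, coef_mem_gr x⟩
    · refine (iSup_le fun i g hg => ?_ : _ ≤ Submodule.comap 𝔸.bracket
        (⨆ i, Subalgebra.toSubmodule (𝔸.subring U) ⊓ 𝔸.koszulDual.gr i)) (h.homogeneous hf)
      exact Submodule.mem_iSup_of_mem (i - 1) ⟨bracket_mem_subring hg.1, bracket_mem hg.2⟩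
  · rintro _ (⟨x, rfl⟩ | ⟨f, hf, rfl⟩)
    · rw [koszulDual_d_coef]
      exact zero_mem _
    · rw [koszulDual_d_bracket]
      exact h.cobarD_mem f hf

theorem single_mul (i : Fin t) (x : Fin t → k) : x * Pi.single i 1 = x i • Pi.single i 1 := by
  ext j
  by_cases h : j = i
  · subst h; simp
  · simp [h]

theorem coef_mul_idem (i : Fin t) (x : Fin t → k) :
    TensorRing.coef 𝔸.desuspDual x * 𝔸.idem i = x i • 𝔸.idem i := by
  rw [idem, ← map_mul, single_mul, map_smul]

theorem idem_mul_coef (i : Fin t) (x : Fin t → k) :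
    𝔸.idem i * TensorRing.coef 𝔸.desuspDual x = x i • 𝔸.idem i := by
  rw [idem, ← map_mul, mul_comm, single_mul, map_smul]

theorem idem_mul_idem (i j : Fin t) : 𝔸.idem i * 𝔸.idem j = if i = j then 𝔸.idem i else 0 := by
  rw [idem, coef_mul_idem]
  split_ifs with h
  · subst h; simp [idem]
  · simp [Ne.symm h]

theorem sum_idem : ∑ i, 𝔸.idem i = 1 := by
  simp_rw [idem]
  rw [← map_sum, Finset.univ_sum_single (fun _ : Fin t => (1 : k))]
  exact map_one _

theorem isSubcoring_bot : 𝔸.IsSubcoring ⊥ where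
  l_mem x f hf := by
    rw [Submodule.mem_bot] at *
    rw [hf, map_zero]
  r_mem x f hf := by
    rw [Submodule.mem_bot] at *
    rw [hf, map_zero]
  homogeneous := bot_le
  cobarD_mem f hf := by
    rw [Submodule.mem_bot] at hf
    rw [hf, map_zero]
    exact zero_mem _

/-- The starting point: with no generators from `V`, the subring is the image of `K = k^t`, whose
elements act on each idempotent by a scalar. -/
theorem exists_isCell_bot : ∃ x φ, ((free 𝔸.koszulDual).sub _
    (isSub_relKer (isSubcoring_bot (𝔸 := 𝔸)).isDGSubalgebra)).IsCell 0 x φ := by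
  refine exists_isCell_relKer_adjoin (e := 𝔸.idem) isSubcoring_bot.isDGSubalgebra
    (fun i => coef_mem_gr _) (fun i => koszulDual_d_coef _) (fun i => coef_mem_subring (U := ⊥) _)
    idem_mul_idem sum_idem ?_
  rintro _ (⟨x, rfl⟩ | ⟨f, rfl, rfl⟩) i
  · exact ⟨x i, coef_mul_idem i x, idem_mul_coef i x⟩
  · exact ⟨0, by simp, by simp⟩

theorem desuspDual_l_of_idem {i : Fin t} {f : 𝔸.DualBar}
    (hf : 𝔸.desuspDual.l (Pi.single i 1) f = f) (x : Fin t → k) : 𝔸.desuspDual.l x f = x i • f := by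
  conv_lhs => rw [← hf, ← Module.End.mul_apply, ← map_mul, single_mul, map_smul,
    LinearMap.smul_apply, hf]

theorem desuspDual_r_of_idem {i : Fin t} {f : 𝔸.DualBar}
    (hf : 𝔸.desuspDual.r (Pi.single i 1) f = f) (x : Fin t → k) : 𝔸.desuspDual.r x f = x i • f := by
  conv_lhs => rw [← hf, ← Module.End.mul_apply, ← map_mul, single_mul, map_smul,
    LinearMap.smul_apply, hf]

/-- A nonzero element of `e_i V e_j` spans a one-dimensional subbimodule, so a single vector can be
added at a time. -/
theorem IsSubcoring.sup_span (h : 𝔸.IsSubcoring U) {i j : Fin t} {p : ℤ} {f : 𝔸.DualBar}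
    (hp : f ∈ 𝔸.dualGr p) (hi : 𝔸.desuspDual.l (Pi.single i 1) f = f)
    (hj : 𝔸.desuspDual.r (Pi.single j 1) f = f) (hd : 𝔸.cobarD f ∈ 𝔸.subring U) :
    𝔸.IsSubcoring (U ⊔ Submodule.span k {f}) where
  l_mem x g hg := by
    obtain ⟨g, hg', _, hc, rfl⟩ := Submodule.mem_sup.1 hg
    obtain ⟨c, rfl⟩ := Submodule.mem_span_singleton.1 hc
    rw [map_add, map_smul, desuspDual_l_of_idem hi]
    exact Submodule.add_mem_sup (h.l_mem x g hg')
      (Submodule.smul_mem _ _ (Submodule.smul_mem _ _ (Submodule.mem_span_singleton_self f)))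
  r_mem x g hg := by
    obtain ⟨g, hg', _, hc, rfl⟩ := Submodule.mem_sup.1 hg
    obtain ⟨c, rfl⟩ := Submodule.mem_span_singleton.1 hc
    rw [map_add, map_smul, desuspDual_r_of_idem hj]
    exact Submodule.add_mem_sup (h.r_mem x g hg')
      (Submodule.smul_mem _ _ (Submodule.smul_mem _ _ (Submodule.mem_span_singleton_self f)))
  homogeneous := h.homogeneous.sup (isHomogeneous_span (by
    rintro _ rfl
    exact Submodule.mem_iSup_of_mem p ⟨Submodule.mem_span_singleton_self _, hp⟩))
  cobarD_mem g hg := by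
    obtain ⟨g, hg', _, hc, rfl⟩ := Submodule.mem_sup.1 hg
    obtain ⟨c, rfl⟩ := Submodule.mem_span_singleton.1 hc
    rw [map_add, map_smul]
    exact subring_mono le_sup_left
      (add_mem (h.cobarD_mem g hg') (Subalgebra.smul_mem _ hd c))

/-- Any bimodule map from `V` into the free bimodule extends to a derivation of the tensor ring. The
one used here kills `U` and sends `f` to `e_i ⊗ e_j`. The degree is `p - 1` because `⟨f⟩` is
desuspended. -/
theorem IsSubcoring.exists_isCell (h : 𝔸.IsSubcoring U) {i j : Fin t} {p : ℤ} {f : 𝔸.DualBar}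
    (hf : f ∉ U) (hp : f ∈ 𝔸.dualGr p) (hi : 𝔸.desuspDual.l (Pi.single i 1) f = f)
    (hj : 𝔸.desuspDual.r (Pi.single j 1) f = f) (hd : 𝔸.cobarD f ∈ 𝔸.subring U)
    (hW : 𝔸.IsSubcoring (U ⊔ Submodule.span k {f})) :
    ∃ x φ, (((free 𝔸.koszulDual).sub _ (isSub_relKer hW.isDGSubalgebra)).quot _
      ((isSub_relKer h.isDGSubalgebra).comap (isSub_relKer hW.isDGSubalgebra)
        (relKer_mono (subring_mono le_sup_left)))).IsCell (p - 1) x φ := by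
  obtain ⟨l, hlf, hlU⟩ := Submodule.exists_le_ker_of_notMem hf
  -- A linear form vanishing on `U` but not on `f` is precomposed with the projection onto `e_i V
  -- e_j`, which makes it compatible with both `K`-actions, and is normalised to be `1` at `f`.
  obtain ⟨m, hm⟩ : ∃ m : 𝔸.DualBar →ₗ[k] k, ∀ g, m g = (l f)⁻¹ *
      l (𝔸.desuspDual.l (Pi.single i 1) (𝔸.desuspDual.r (Pi.single j 1) g)) :=
    ⟨(l f)⁻¹ • l ∘ₗ (𝔸.desuspDual.l (Pi.single i 1) ∘ₗ 𝔸.desuspDual.r (Pi.single j 1)),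
      fun _ => rfl⟩
  have hmf : m f = 1 := by rw [hm, hj, hi, inv_mul_cancel₀ hlf]
  have hmU : ∀ g ∈ U, m g = 0 := fun g hg => by
    rw [hm, show l _ = 0 from hlU (h.l_mem _ _ (h.r_mem _ _ hg)), mul_zero]
  have hml : ∀ x g, m (𝔸.desuspDual.l x g) = x i • m g := fun x g => by
    rw [hm, hm, ← 𝔸.desuspDual.l_r, ← Module.End.mul_apply (𝔸.desuspDual.l _), ← map_mul,
      mul_comm (Pi.single i 1) x, single_mul, map_smul, LinearMap.smul_apply, map_smul,
      𝔸.desuspDual.l_r, mul_smul_comm]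
  have hmr : ∀ x g, m (𝔸.desuspDual.r x g) = x j • m g := fun x g => by
    rw [hm, hm, ← Module.End.mul_apply (𝔸.desuspDual.r _), ← map_mul,
      mul_comm (Pi.single j 1) x, single_mul, map_smul, LinearMap.smul_apply, map_smul, map_smul,
      mul_smul_comm]
  obtain ⟨D, hD, hDc, hDg⟩ := TensorRing.exists_derivation (free 𝔸.koszulDual)
    (m.smulRight (tmul 𝔸.koszulDual (𝔸.idem i) (𝔸.idem j)))
    (fun x g => by
      rw [LinearMap.smulRight_apply, LinearMap.smulRight_apply, hml, map_smul, free_l,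
        coef_mul_idem, map_smul, LinearMap.smul_apply, smul_assoc, smul_comm (m g)])
    (fun x g => by
      rw [LinearMap.smulRight_apply, LinearMap.smulRight_apply, hmr, map_smul, free_r,
        idem_mul_coef, map_smul, smul_assoc, smul_comm (m g)])
  refine exists_isCell_relKer (D := D) (v := 𝔸.bracket f) (e := 𝔸.idem i) (e' := 𝔸.idem j) hD
    h.isDGSubalgebra hW.isDGSubalgebra (subring_mono le_sup_left) (bracket_mem hp)
    (by rwa [koszulDual_d_bracket]) (subring_sup_span f) (coef_mem_gr _) (coef_mem_gr _)
    (koszulDual_d_coef _) (koszulDual_d_coef _) (coef_mem_subring _) (coef_mem_subring _)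
    ?_ ?_ ?_ ?_
  · exact (TensorRing.gen_l _ _ _).symm.trans (congrArg 𝔸.bracket hi)
  · exact (TensorRing.gen_r _ _ _).symm.trans (congrArg 𝔸.bracket hj)
  · intro c hc
    induction hc using Algebra.adjoin_induction with
    | mem c hc =>
      obtain ⟨x, rfl⟩ | ⟨g, hg, rfl⟩ := hc
      · exact hDc x
      · rw [hDg, LinearMap.smulRight_apply, hmU g hg, zero_smul]
    | algebraMap r =>
      rw [← AlgHom.commutes (TensorRing.coef 𝔸.desuspDual), hDc]
    | add x y _ _ hx hy => rw [map_add, hx, hy, add_zero]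
    | mul x y _ _ hx hy => rw [hD, hx, hy, map_zero, map_zero, add_zero]
  · rw [hDg, LinearMap.smulRight_apply, hmf, one_smul]

end AugDGKRing

end DG

namespace DG

theorem IsHomogeneous.mul {k : Type u} {A : Type v} [Field k] [Ring A] [Algebra k A]
    {gr : ℤ → Submodule k A} (hgr : ∀ i j : ℤ, ∀ a ∈ gr i, ∀ b ∈ gr j, a * b ∈ gr (i + j))
    {S T : Submodule k A} (hS : IsHomogeneous gr S) (hT : IsHomogeneous gr T) :
    IsHomogeneous gr (S * T) := by
  refine Submodule.mul_le.2 fun a ha b hb => ?_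
  set G := ⨆ i, S * T ⊓ gr i
  refine (iSup_le fun i a ha => ?_ : _ ≤ G.comap ((LinearMap.mul k A).flip b)) (hS ha)
  refine (iSup_le fun j b hb => ?_ : _ ≤ G.comap (LinearMap.mul k A a)) (hT hb)
  exact Submodule.mem_iSup_of_mem (i + j)
    ⟨Submodule.mul_mem_mul ha.1 hb.1, hgr i j a ha.2 b hb.2⟩

namespace AugDGKRing

open DGBimod

variable {k : Type u} {t : ℕ} {A : Type v} [Field k] [Ring A] [Algebra k A]

/-! ### Powers of the augmentation ideal. -/

section powers

variable {𝔸 : AugDGKRing k t A} (n : ℕ) {a : A}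

theorem isHomogeneous_augIdeal_pow [FiniteDimensional k A] :
    IsHomogeneous 𝔸.gr (𝔸.augIdeal ^ (n + 1)) := by
  have h1 : IsHomogeneous 𝔸.gr 𝔸.augIdeal := by
    obtain ⟨s, hs⟩ := 𝔸.exists_finset
    intro a ha
    rw [← hs a]
    exact sum_mem fun i _ => Submodule.mem_iSup_of_mem i ⟨aug_proj i a ha, 𝔸.proj_mem i a⟩
  induction n with
  | zero => simpa using h1
  | succ n ih =>
    rw [pow_succ]
    exact ih.mul 𝔸.mul_mem h1

theorem d_mem_augIdeal_pow [FiniteDimensional k A] (ha : a ∈ 𝔸.augIdeal ^ (n + 1)) :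
    𝔸.d a ∈ 𝔸.augIdeal ^ (n + 1) := by
  induction n generalizing a with
  | zero =>
    rw [zero_add, pow_one]
    exact 𝔸.aug_d a
  | succ n ih =>
    have h := isHomogeneous_augIdeal_pow (𝔸 := 𝔸) n
    rw [pow_succ] at ha ⊢
    refine (Submodule.mul_le.2 fun a ha b hb => ?_ : _ ≤ Submodule.comap 𝔸.d
      (𝔸.augIdeal ^ (n + 1) * 𝔸.augIdeal)) ha
    rw [Submodule.mem_comap, 𝔸.d_mul]
    exact add_mem (Submodule.mul_mem_mul (ih ha) hb)
      (Submodule.mul_mem_mul (h.parity_mem 𝔸.isInternal ha) (𝔸.aug_d b))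

theorem unit_mul_mem_augIdeal_pow (x : Fin t → k) (ha : a ∈ 𝔸.augIdeal ^ (n + 1)) :
    𝔸.unit x * a ∈ 𝔸.augIdeal ^ (n + 1) := by
  rw [pow_succ'] at ha ⊢
  refine (Submodule.mul_le.2 fun a ha b hb => ?_ :
    _ ≤ Submodule.comap (LinearMap.mulLeft k (𝔸.unit x))
      (𝔸.augIdeal * 𝔸.augIdeal ^ n)) ha
  rw [Submodule.mem_comap, LinearMap.mulLeft_apply, ← mul_assoc]
  refine Submodule.mul_mem_mul ?_ hb
  rw [mem_augIdeal] at *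
  rw [map_mul, ha, mul_zero]

theorem mul_unit_mem_augIdeal_pow (x : Fin t → k) (ha : a ∈ 𝔸.augIdeal ^ (n + 1)) :
    a * 𝔸.unit x ∈ 𝔸.augIdeal ^ (n + 1) := by
  rw [pow_succ] at ha ⊢
  refine (Submodule.mul_le.2 fun a ha b hb => ?_ :
    _ ≤ Submodule.comap (LinearMap.mulRight k (𝔸.unit x))
      (𝔸.augIdeal ^ n * 𝔸.augIdeal)) ha
  rw [Submodule.mem_comap, LinearMap.mulRight_apply, mul_assoc]
  refine Submodule.mul_mem_mul ha ?_
  rw [mem_augIdeal] at *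
  rw [map_mul, hb, zero_mul]

theorem augIdeal_pow_succ_le : 𝔸.augIdeal ^ (n + 1 + 1) ≤ 𝔸.augIdeal ^ (n + 1) := by
  rw [pow_succ, pow_succ, mul_assoc]
  refine mul_le_mul' le_rfl (Submodule.mul_le.2 fun a ha b hb => ?_)
  rw [mem_augIdeal] at *
  rw [map_mul, ha, zero_mul]

/-- The augmentation ideal of a finite dimensional complete ring is nilpotent. -/
theorem IsComplete.exists_pow_eq_bot [FiniteDimensional k A] (h : 𝔸.IsComplete) :
    ∃ n, 𝔸.augIdeal ^ (n + 1) = ⊥ := by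
  have hanti : Antitone fun n => 𝔸.augIdeal ^ (n + 1) := antitone_nat_of_succ_le augIdeal_pow_succ_le
  -- The decreasing chain of powers becomes constant, and its final value is the intersection, which
  -- is zero.
  obtain ⟨N, hN⟩ := IsArtinian.monotone_stabilizes (⟨_, hanti⟩ : ℕ →o (Submodule k A)ᵒᵈ)
  refine ⟨N, eq_bot_iff.2 (h ▸ le_iInf fun n => ?_)⟩
  rcases le_total N n with hn | hn
  · exact (show 𝔸.augIdeal ^ (N + 1) = 𝔸.augIdeal ^ (n + 1) from hN n hn).le
  · exact hanti hn

end powers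

/-! ### The coradical filtration and the choice of the next generator. -/

variable (𝔸 : AugDGKRing k t A)

/-- The coradical filtration of the dual coring: the linear forms on the augmentation ideal `I`
which vanish on `I ^ (n + 1)`. -/
noncomputable def filtration (n : ℕ) : Submodule k 𝔸.DualBar :=
  ((𝔸.augIdeal ^ (n + 1)).comap 𝔸.augIdeal.subtype).dualAnnihilator

variable {𝔸} {n : ℕ} {f : 𝔸.DualBar}

theorem mem_filtration :
    f ∈ 𝔸.filtration n ↔ ∀ a : 𝔸.augIdeal, (a : A) ∈ 𝔸.augIdeal ^ (n + 1) → f a = 0 :=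
  Submodule.mem_dualAnnihilator f

theorem dualMap_mem_filtration (T : 𝔸.augIdeal →ₗ[k] 𝔸.augIdeal)
    (hT : ∀ a : 𝔸.augIdeal, (a : A) ∈ 𝔸.augIdeal ^ (n + 1) → (T a : A) ∈ 𝔸.augIdeal ^ (n + 1))
    (hf : f ∈ 𝔸.filtration n) : T.dualMap f ∈ 𝔸.filtration n := by
  rw [mem_filtration] at *
  exact fun a ha => hf _ (hT a ha)

/-- The forms live on `I` itself rather than on `A`, so vanishing on `I ^ 1` leaves nothing; the
filtration starts from zero. -/
theorem filtration_zero : 𝔸.filtration 0 = ⊥ := by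
  refine eq_bot_iff.2 fun f hf => (Submodule.mem_bot k).2 (LinearMap.ext fun a => ?_)
  refine mem_filtration.1 hf a ?_
  rw [zero_add, pow_one]
  exact a.2

theorem IsComplete.exists_filtration_eq_top [FiniteDimensional k A] (h : 𝔸.IsComplete) :
    ∃ n, 𝔸.filtration n = ⊤ := by
  obtain ⟨n, hn⟩ := h.exists_pow_eq_bot
  refine ⟨n, eq_top_iff.2 fun f _ => mem_filtration.2 fun a ha => ?_⟩
  rw [hn, Submodule.mem_bot] at ha
  rw [show a = 0 from Subtype.ext ha, map_zero]

variable [FiniteDimensional k A]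

theorem l_mem_filtration (x : Fin t → k) (hf : f ∈ 𝔸.filtration n) :
    𝔸.desuspDual.l x f ∈ 𝔸.filtration n :=
  dualMap_mem_filtration (𝔸.barR x) (fun _ => mul_unit_mem_augIdeal_pow n x) hf

theorem r_mem_filtration (x : Fin t → k) (hf : f ∈ 𝔸.filtration n) :
    𝔸.desuspDual.r x f ∈ 𝔸.filtration n :=
  dualMap_mem_filtration (𝔸.barL x) (fun _ => unit_mul_mem_augIdeal_pow n x) hf

theorem dualParity_mem_filtration (hf : f ∈ 𝔸.filtration n) :
    𝔸.dualParity f ∈ 𝔸.filtration n :=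
  dualMap_mem_filtration 𝔸.barParity
    (fun _ => (isHomogeneous_augIdeal_pow n).parity_mem 𝔸.isInternal) hf

theorem dualD_mem_filtration (hf : f ∈ 𝔸.filtration n) : 𝔸.dualD f ∈ 𝔸.filtration n := by
  rw [dualD_eq]
  exact dualMap_mem_filtration (𝔸.barD ∘ₗ 𝔸.barParity) (fun _ ha => d_mem_augIdeal_pow n
    ((isHomogeneous_augIdeal_pow n).parity_mem 𝔸.isInternal ha)) hf

theorem isHomogeneous_filtration : IsHomogeneous 𝔸.dualGr (𝔸.filtration n) := by
  obtain ⟨s, hs⟩ := dual_eq_sum (𝔸 := 𝔸)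
  intro f hf
  rw [← hs f]
  exact sum_mem fun i _ => Submodule.mem_iSup_of_mem i ⟨dualMap_mem_filtration _
    (fun _ => (isHomogeneous_augIdeal_pow n).proj_mem 𝔸.isInternal _) hf, dualProj_mem i f⟩

variable {U : Submodule k 𝔸.DualBar}

/-- The coradical filtration is a filtration by coideals without counit. -/
theorem dualCoprod_mem_filtration (hf : f ∈ 𝔸.filtration (n + 1)) :
    ∃ π : 𝔸.augIdeal →ₗ[k] 𝔸.augIdeal, (∀ g, π.dualMap g ∈ 𝔸.filtration n) ∧
      𝔸.dualCoprod f = TensorProduct.map π.dualMap π.dualMap (𝔸.dualCoprod f) := by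
  -- `π` is the projection of `I` onto a complement of `I ^ (n + 1)`. Applying its transpose to both
  -- tensor factors does not change the coproduct, because `a b - a' b' = (a - a') b + a' (b - b')`
  -- lies in `I ^ (n + 2)`, where `f` vanishes.
  set J := (𝔸.augIdeal ^ (n + 1)).comap 𝔸.augIdeal.subtype
  obtain ⟨g, hg⟩ := LinearMap.exists_rightInverse_of_surjective J.mkQ J.range_mkQ
  have hπ : ∀ a, a - g (J.mkQ a) ∈ J := fun a =>
    (Submodule.Quotient.eq J).1 (LinearMap.congr_fun hg (J.mkQ a)).symm
  refine ⟨g ∘ₗ J.mkQ, fun h => mem_filtration.2 fun a ha => ?_, ev_ext fun a b => ?_⟩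
  · have : J.mkQ a = 0 := (Submodule.Quotient.mk_eq_zero J).2 ha
    rw [LinearMap.dualMap_apply, LinearMap.comp_apply, this, map_zero, map_zero]
  · rw [ev_map, ev_coprod, ev_coprod, ← sub_eq_zero, ← map_sub]
    set a' := (g ∘ₗ J.mkQ) a
    set b' := (g ∘ₗ J.mkQ) b
    refine mem_filtration.1 hf _ ?_
    have h1 : ((a - a' : 𝔸.augIdeal) : A) * b ∈ 𝔸.augIdeal ^ (n + 1 + 1) := by
      rw [pow_succ]
      exact Submodule.mul_mem_mul (hπ a) b.2
    have h2 : (a' : A) * (b - b' : 𝔸.augIdeal) ∈ 𝔸.augIdeal ^ (n + 1 + 1) := by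
      rw [pow_succ']
      exact Submodule.mul_mem_mul a'.2 (hπ b)
    have := add_mem h1 h2
    simp only [Submodule.coe_sub, sub_mul, mul_sub, sub_add_sub_cancel] at this
    exact this

/-- The quadratic part of the cobar differential involves only the preceding layer of the
filtration, by `dualCoprod_mem_filtration`; only the linear part `⟨d f⟩` needs a separate
hypothesis. -/
theorem cobarD_mem_subring (hf : f ∈ 𝔸.filtration (n + 1)) (hU : 𝔸.filtration n ≤ U)
    (hd : 𝔸.dualD f ∈ U) : 𝔸.cobarD f ∈ 𝔸.subring U := by
  obtain ⟨π, hπ, h⟩ := dualCoprod_mem_filtration hf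
  rw [cobarD_apply, h]
  refine sub_mem (neg_mem (bracket_mem_subring hd)) ?_
  generalize 𝔸.dualCoprod f = z
  induction z using TensorProduct.induction_on with
  | zero => simp only [map_zero, zero_mem]
  | tmul a b =>
    exact mul_mem (bracket_mem_subring (hU (dualParity_mem_filtration (hπ a))))
      (bracket_mem_subring (hU (hπ b)))
  | add x y hx hy => simp only [map_add]; exact add_mem hx hy

/-- The Peirce decomposition `V = ⨁ e_i V e_j`. -/
theorem sum_desuspDual (f : 𝔸.DualBar) :
    ∑ i, ∑ j, 𝔸.desuspDual.l (Pi.single i 1) (𝔸.desuspDual.r (Pi.single j 1) f) = f := by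
  have h : ∑ i : Fin t, (Pi.single i 1 : Fin t → k) = 1 :=
    Finset.univ_sum_single (fun _ : Fin t => (1 : k))
  simp_rw [← map_sum, ← LinearMap.sum_apply, ← map_sum, h, map_one, Module.End.one_apply]

theorem dualD_l (x : Fin t → k) (f : 𝔸.DualBar) :
    𝔸.dualD (𝔸.desuspDual.l x f) = 𝔸.desuspDual.l x (𝔸.dualD f) := by
  ext a
  rw [dualD_apply, desuspDual_l, LinearMap.dualMap_apply, LinearMap.dualMap_apply, dualD_apply]
  refine congrArg f (Subtype.ext ?_)
  simp [parity_mul _ 𝔸.mul_mem, parity_unit, 𝔸.d_mul, 𝔸.d_unit]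

theorem dualD_r (x : Fin t → k) (f : 𝔸.DualBar) :
    𝔸.dualD (𝔸.desuspDual.r x f) = 𝔸.desuspDual.r x (𝔸.dualD f) := by
  ext a
  rw [dualD_apply, desuspDual_r, LinearMap.dualMap_apply, LinearMap.dualMap_apply, dualD_apply]
  refine congrArg f (Subtype.ext ?_)
  simp [parity_mul _ 𝔸.mul_mem, parity_unit, 𝔸.d_mul, 𝔸.d_unit]

/-- A proper subspace of the dual of a complete ring can be enlarged by a homogeneous element of
some `e_i V e_j` whose differential comes from the subspace. -/
theorem IsComplete.exists_notMem (hA : 𝔸.IsComplete) (hU : U ≠ ⊤) :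
    ∃ (i j : Fin t) (p : ℤ) (f : 𝔸.DualBar), f ∉ U ∧ f ∈ 𝔸.dualGr p ∧
      𝔸.desuspDual.l (Pi.single i 1) f = f ∧ 𝔸.desuspDual.r (Pi.single j 1) f = f ∧
        𝔸.cobarD f ∈ 𝔸.subring U := by
  classical
  have hex : ∃ n, ¬𝔸.filtration n ≤ U := by
    obtain ⟨n, hn⟩ := hA.exists_filtration_eq_top
    exact ⟨n, fun h => hU (top_le_iff.1 (hn ▸ h))⟩
  -- The first layer not contained in `U` is not the zeroth one, which is zero; so it has a
  -- predecessor, and that one is contained in `U`.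
  obtain ⟨n, hn, hn'⟩ : ∃ n, 𝔸.filtration n ≤ U ∧ ¬𝔸.filtration (n + 1) ≤ U := by
    have h0 : Nat.find hex ≠ 0 := fun h => by
      have := Nat.find_spec hex
      rw [h, filtration_zero] at this
      exact this bot_le
    obtain ⟨n, hn⟩ := Nat.exists_eq_succ_of_ne_zero h0
    refine ⟨n, not_not.1 (Nat.find_min hex (by omega)), ?_⟩
    have := Nat.find_spec hex
    rwa [hn] at this
  obtain ⟨p, w, hw, hp, hwU⟩ : ∃ p, ∃ w ∈ 𝔸.filtration (n + 1), w ∈ 𝔸.dualGr p ∧ w ∉ U := by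
    by_contra! h
    exact hn' (isHomogeneous_filtration.trans (iSup_le fun p w hw => h p w hw.1 hw.2))
  obtain ⟨i, j, hij⟩ : ∃ i j,
      𝔸.desuspDual.l (Pi.single i 1) (𝔸.desuspDual.r (Pi.single j 1) w) ∉ U := by
    by_contra! h
    refine hwU ?_
    rw [← sum_desuspDual w]
    exact sum_mem fun i _ => sum_mem fun j _ => h i j
  obtain ⟨v, hv⟩ : ∃ v, v = 𝔸.desuspDual.l (Pi.single i 1) (𝔸.desuspDual.r (Pi.single j 1) w) :=
    ⟨_, rfl⟩
  rw [← hv] at hij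
  have hidem : ∀ i : Fin t, (Pi.single i 1 : Fin t → k) * Pi.single i 1 = Pi.single i 1 := fun i => by
    rw [single_mul, Pi.single_eq_same, one_smul]
  have hvi : 𝔸.desuspDual.l (Pi.single i 1) v = v := by
    rw [hv, ← Module.End.mul_apply, ← map_mul, hidem]
  have hvj : 𝔸.desuspDual.r (Pi.single j 1) v = v := by
    rw [hv, ← 𝔸.desuspDual.l_r, ← Module.End.mul_apply (𝔸.desuspDual.r _), ← map_mul, hidem]
  have hvF : v ∈ 𝔸.filtration (n + 1) := hv ▸ l_mem_filtration _ (r_mem_filtration _ hw)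
  have hvp : v ∈ 𝔸.dualGr p := by
    have h : w ∈ 𝔸.desuspDual.gr (p - 1) := by
      change w ∈ 𝔸.dualGr (p - 1 + 1)
      rwa [sub_add_cancel]
    have := 𝔸.desuspDual.l_mem _ (Pi.single i 1) _ (𝔸.desuspDual.r_mem _ (Pi.single j 1) w h)
    rw [← hv] at this
    change v ∈ 𝔸.dualGr (p - 1 + 1) at this
    rwa [sub_add_cancel] at this
  -- If the linear part of the differential of `v` leaves `U`, then `d v` is added instead of `v`:
  -- it is in the same layer and the same `e_i V e_j`, one degree lower, and its own linear part
  -- vanishes as `d ∘ d = 0`.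
  by_cases hd : 𝔸.dualD v ∈ U
  · exact ⟨i, j, p, v, hij, hvp, hvi, hvj, cobarD_mem_subring hvF hn hd⟩
  · refine ⟨i, j, p - 1, 𝔸.dualD v, hd, dualD_mem hvp, ?_, ?_,
      cobarD_mem_subring (dualD_mem_filtration hvF) hn ?_⟩
    · rw [← dualD_l, hvi]
    · rw [← dualD_r, hvj]
    · rw [dualD_dualD]
      exact zero_mem _

end AugDGKRing

end DG

/-! ### The maximality argument. -/

open DG DGBimod AugDGKRing in
/-- Let `K = k^t` for a field `k` and `t ≥ 1`. The Koszul dual of a finite dimensional complete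
(augmented) dg `K`-ring is a homologically smooth dg algebra. -/
theorem theorem7 {k : Type u} [Field k] {t : ℕ} (ht : 0 < t) {A : Type v} [Ring A] [Algebra k A]
    [FiniteDimensional k A] (𝔸 : DG.AugDGKRing k t A) (hA : 𝔸.IsComplete) :
    DG.IsHomologicallySmooth 𝔸.koszulDual := by
  intro P hP hfree
  let good : Set (Submodule k 𝔸.DualBar) := {U | ∃ h : 𝔸.IsSubcoring U,
    P (toDerived ((free 𝔸.koszulDual).sub _ (isSub_relKer h.isDGSubalgebra)))}
  have hbot : ⊥ ∈ good := by
    obtain ⟨x, φ, h⟩ := exists_isCell_bot (𝔸 := 𝔸)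
    exact ⟨isSubcoring_bot, hP.of_isCell hfree h⟩
  -- Finite dimensionality of the dual replaces an explicit enumeration of generators: a maximal
  -- good subspace is taken, and any further generator would enlarge it by one cell.
  obtain ⟨U, ⟨hU, hPU⟩, hmax⟩ := WellFounded.has_min
    (wellFounded_gt (α := Submodule k 𝔸.DualBar)) good ⟨⊥, hbot⟩
  have htop : U = ⊤ := by
    by_contra hne
    obtain ⟨i, j, p, f, hf, hp, hi, hj, hd⟩ := hA.exists_notMem hne
    have hW := hU.sup_span hp hi hj hd
    obtain ⟨x, φ, h⟩ := hU.exists_isCell hf hp hi hj hd hW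
    refine hmax (U ⊔ Submodule.span k {f}) ⟨hW, ?_⟩ ?_
    · exact hP.of_sub_quot _ _ (relKer_mono (subring_mono le_sup_left)) hPU (hP.of_isCell hfree h)
    · exact lt_of_le_of_ne le_sup_left fun h =>
        hf (h ▸ Submodule.mem_sup_right (Submodule.mem_span_singleton_self f))
  subst htop
  have hdg : IsDGSubalgebra 𝔸.koszulDual ⊤ := subring_top (𝔸 := 𝔸) ▸ hU.isDGSubalgebra
  -- The diagonal bimodule is the cokernel of `relKer ⊤` in the free bimodule, and both of these are
  -- in `P`.
  refine hP.right (isShortExact_relKer_top hdg) ?_ hfree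
  -- The objects depend on the subalgebra and on a proof about it, so the equality of `⊤` with the
  -- subring generated by all of `V` is transported through a variable `S`.
  have : ∀ S (hS : IsDGSubalgebra 𝔸.koszulDual S), S = 𝔸.subring ⊤ →
      P (toDerived ((free 𝔸.koszulDual).sub _ (isSub_relKer hS))) := by
    rintro _ hS rfl
    exact hPU
  exact this _ hdg subring_top.symm
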